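/- Let $\Sigma$ be a finite alphabet with $|\Sigma|\ge 2$ and $\Xi$ an infinite set of variables. \emph{Regex.} Regex over $\Sigma$ and $\Xi$ are built from $\varepsilon$, terminals $a\in\Sigma$ and variable references $\&x$ ($x\in\Xi$) by concatenation, disjunction $\vee$, Kleene plus, and variable binding $\langle x\colon\alpha\rangle$, the last one only if $x$ does not occur in $\alpha$ (neither bound nor referenced); in addition $\emptyset$ is a regex, which is not part of any other regex. Let $\Gamma=\{[_x,\,]_x : x\in\Xi\}$. The ref-language $\mathcal R(\alpha)\subseteq(\Sigma\cup\Xi\cup\Gamma)^*$ is defined by $\mathcal R(\emptyset)=\emptyset$, $\mathcal R(\varepsilon)=\{\varepsilon\}$, $\mathcal R(a)=\{a\}$, $\mathcal R(\&x)=\{x\}$, $\mathcal R(\langle x\colon\alpha\rangle)=\,[_x\,\mathcal R(\alpha)\,]_x$, and by concatenation, union and $^+$ in the other cases. The dereference $\mathcal D(r)\in\Sigma^*$ of a ref-word $r$ arises, from left to right, by replacing each occurrence of a variable $x$ by the (dereferenced) content of the closest complete factor $[_x\cdots]_x$ to its left, or by $\varepsilon$ if there is none, and deleting all brackets. The language of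 $\alpha$ is $\mathcal L(\alpha)=\{\mathcal D(r) : r\in\mathcal R(\alpha)\}$. Let $\tilde\alpha$ be $\alpha$ with each occurrence of a terminal, a variable reference or a bracket marked by its own number (written as an index $(i)$), and let $\mathcal R(\tilde\alpha)$ be the resulting set of marked ref-words. The regex $\alpha$ is \emph{not deterministic} if there are $\rho_1,\rho_2\in\mathcal R(\tilde\alpha)$, marked ref-words $r,s_1,s_2$ and words $\gamma_1,\gamma_2$ of marked brackets such that one of the following holds: (1) $\rho_1=r\gamma_1a_{(i)}s_1$ and $\rho_2=r\gamma_2a_{(j)}s_2$ with $a\in\Sigma$, $i\ne j$; (2) $\rho_1=r\gamma_1x_{(i)}s_1$ and $\rho_2=r\gamma_2\chi_{(j)}s_2$ with $x\in\Xi$, $\chi\in\Sigma\cup\Xi$, $i\ne j$; (3) $\rho_1=r\gamma_1\chi_{(i)}s_1$ and $\rho_2=r\gamma_2\chi_{(i)}s_2$ with $\chi\in\Sigma\cup\Xi$, $\gamma_1\neq\gamma_2$; (4) $\rho_1=r\gamma_1$ and $\rho_2=r\gamma_2$ with $\gamma_1\ne\gamma_2$. Otherwise $\alpha$ is deterministic.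 $\mathcal L(\mathrm{DRX})$ is the class of languages $\mathcal L(\alpha)\subseteq\Sigma^*$ of deterministic regex $\alpha$; $\mathcal L(\mathrm{DREG})$ is the subclass given by deterministic regex without variables. \emph{Memory automata with trap state.} Such an automaton, with $k\ge0$ memories, is a tuple $(Q,\Sigma,\delta,q_0,F)$ with a finite set $Q$ of states that contains $q_0$ and a trap state $t$, $F\subseteq Q$, and $\delta\colon Q\times(\Sigma\cup\{\varepsilon\}\cup\{1,\dots,k\})\to\mathcal P(Q\times\{\mathsf o,\mathsf c,\mathsf r,\diamond\}^k)$ with $\delta(t,b)=\{(t,\diamond,\dots,\diamond)\}$ for $b\in\Sigma\cup\{\varepsilon\}$ and $\delta(t,i)=\emptyset$ for $1\le i\le k$. A configuration consists of a state, the remaining input and, for each memory $i$, a content $u_i\in\Sigma^*$ and a status (open or closed); initially the state is $q_0$ and all memories are empty and closed. In a configuration with state $q$, a transition $(p,s_1,\dots,s_k)\in\delta(q,b)$ removes a prefix $v$ from the remaining input, where $v=b$ if $b\in\Sigma\cup\{\varepsilon\}$, and $v=u_b$ if $b\in\{1,\dots,k\}$, the latter only if $s_b=\mathsf c$. It moves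 to $p$ and changes each memory $i$ as follows: $s_i=\mathsf o$ opens it with content $v$; $s_i=\mathsf c$ closes it and keeps its content; $s_i=\mathsf r$ closes it and empties it; $s_i=\diamond$ keeps the status and appends $v$ to the content if the memory is open. If $b\in\{1,\dots,k\}$, $s_b=\mathsf c$ and $u_b$ is not a prefix of the remaining input, the automaton instead removes the longest common prefix of $u_b$ and the remaining input and moves to $t$, leaving the memories unchanged. A word is accepted if some computation on it reaches a state of $F$ with empty remaining input. The automaton is deterministic if for every $q\in Q\setminus\{t\}$ one has $|\delta(q,b)|\le1$ for all $b$ and, whenever $\delta(q,x)\neq\emptyset$ for some $x\in\{\varepsilon,1,\dots,k\}$, then $\delta(q,y)=\emptyset$ for all $y\ne x$. $\mathcal L(\mathrm{DTMFA}_{\mathrm{rej}})$ is the class of languages over $\Sigma$ accepted by deterministic such automata with $t\notin F$. \textbf{Theorem.} For each of the two classes $\mathcal C=\mathcal L(\mathrm{DRX})$ and $\mathcal C=\mathcal L(\mathrm{DTMFA}_{\mathrm{rej}})$ over $\Sigma$, $\mathcal C$ is not closed under any of the following operations: union, concatenation, reversal, complement (in $\Sigma^*$), homomorphism (images $h(L)$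 under monoid homomorphisms $h\colon\Sigma^*\to\Sigma^*$), and inverse homomorphism (preimages $h^{-1}(L)$ under such $h$). Moreover, $\mathcal L(\mathrm{DRX})$ is not closed under intersection, nor under intersection with languages from $\mathcal L(\mathrm{DREG})$. -/

import Mathlib

/-! ### Regular expressions with backreferences: syntax -/

/-- The letters of ref-words over the terminal alphabet `A` and the variable alphabet `X`:
terminals, variable references, and the brackets that open and close a binding. -/
inductive RefSym (A : Type*) (X : Type*) where
  | term (a : A)
  | ref (x : X)
  | opn (x : X)
  | cls (x : X)

/-- The letter is one of the two kinds of brackets. -/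
def RefSym.IsBracket {A X : Type*} : RefSym A X → Prop
  | .term _ => False
  | .ref _ => False
  | .opn _ => True
  | .cls _ => True

/-- The letter is a terminal or a variable reference. -/
def RefSym.IsTermOrRef {A X : Type*} : RefSym A X → Prop
  | .term _ => True
  | .ref _ => True
  | .opn _ => False
  | .cls _ => False

/-- Raw expressions; the side condition on variable bindings is `RegexExpr.WellFormed`. -/
inductive RegexExpr (A : Type*) (X : Type*) where
  | eps
  | term (a : A)
  | ref (x : X)
  | cat (α β : RegexExpr A X)
  | alt (α β : RegexExpr A X)
  | plus (α : RegexExpr A X)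
  | bind (x : X) (α : RegexExpr A X)

namespace RegexExpr

variable {A X : Type*}

/-- The variables of an expression. -/
def vars : RegexExpr A X → Set X
  | eps => ∅
  | term _ => ∅
  | ref x => {x}
  | cat α β => α.vars ∪ β.vars
  | alt α β => α.vars ∪ β.vars
  | plus α => α.vars
  | bind x α => α.vars ∪ {x}

/-- A binding of `x` contains neither a reference to `x` nor another binding of `x`. -/
def WellFormed : RegexExpr A X → Prop
  | eps => True
  | term _ => True
  | ref _ => True
  | cat α β => α.WellFormed ∧ β.WellFormed
  | alt α β => α.WellFormed ∧ β.WellFormed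
  | plus α => α.WellFormed
  | bind x α => α.WellFormed ∧ x ∉ α.vars

/-- The ref-language of an expression. -/
def refLang : RegexExpr A X → Language (RefSym A X)
  | eps => {[]}
  | term a => {[.term a]}
  | ref x => {[.ref x]}
  | cat α β => α.refLang * β.refLang
  | alt α β => α.refLang + β.refLang
  | plus α => α.refLang * KStar.kstar α.refLang
  | bind x α => ({[.opn x]} : Language (RefSym A X)) * α.refLang * {[.cls x]}

/-- The number of occurrences of terminals, references and brackets in an expression, where
a binding contributes its two brackets. -/
def numOcc : RegexExpr A X → ℕ
  | eps => 0
  | term _ => 1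
  | ref _ => 1
  | cat α β => α.numOcc + β.numOcc
  | alt α β => α.numOcc + β.numOcc
  | plus α => α.numOcc
  | bind _ α => α.numOcc + 2

/-- The ref-language of the marked expression, in which the occurrences of terminals, references
and brackets are numbered from left to right by `n, n + 1, n + 2, …`. -/
def markedRefLangFrom : RegexExpr A X → ℕ → Language (RefSym A X × ℕ)
  | eps, _ => {[]}
  | term a, n => {[(.term a, n)]}
  | ref x, n => {[(.ref x, n)]}
  | cat α β, n => α.markedRefLangFrom n * β.markedRefLangFrom (n + α.numOcc)
  | alt α β, n => α.markedRefLangFrom n + β.markedRefLangFrom (n + α.numOcc)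
  | plus α, n => α.markedRefLangFrom n * KStar.kstar (α.markedRefLangFrom n)
  | bind x α, n =>
      ({[(.opn x, n)]} : Language (RefSym A X × ℕ)) * α.markedRefLangFrom (n + 1) *
        {[(.cls x, n + 1 + α.numOcc)]}

end RegexExpr

/-- Regex over `A` and `X`: the regex for the empty language, which is not a part of any other
regex, and the well-formed expressions. -/
inductive Regex (A : Type*) (X : Type*) where
  | empty
  | expr (α : RegexExpr A X) (hα : α.WellFormed)

/-! ### Regular expressions with backreferences: semantics -/

/-- The state of a left-to-right pass over a ref-word: the terminal word produced so far, for each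
variable the position in that word where its latest opening bracket was met, and for each variable
the terminal word that its latest completed binding stands for (`[]` if there is none). -/
structure DerefState (A : Type*) (X : Type*) where
  out : List A
  start : X → ℕ
  val : X → List A

open Classical in
/-- Effect of one letter of a ref-word. -/
noncomputable def DerefState.step {A X : Type*} (s : DerefState A X) :
    RefSym A X → DerefState A X
  | .term a => { s with out := s.out ++ [a] }
  | .ref x => { s with out := s.out ++ s.val x }
  | .opn x => { s with start := Function.update s.start x s.out.length }
  | .cls x => { s with val := Function.update s.val x (s.out.drop (s.start x)) }

/-- The dereference of a ref-word: each reference to `x` is replaced by what the closest complete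
binding of `x` to its left stands for (by the empty word if there is none), and the brackets
are dropped. -/
noncomputable def deref {A X : Type*} (r : List (RefSym A X)) : List A :=
  (r.foldl DerefState.step ⟨[], fun _ => 0, fun _ => []⟩).out

namespace Regex

variable {A X : Type*}

/-- The variables of a regex. -/
def vars : Regex A X → Set X
  | empty => ∅
  | expr α _ => α.vars

/-- The ref-language of a regex. -/
def refLang : Regex A X → Language (RefSym A X)
  | empty => 0
  | expr α _ => α.refLang

/-- The language of a regex. -/
def language (α : Regex A X) : Language A :=
  {w | ∃ r ∈ α.refLang, deref r = w}

/-- The ref-language of the marked regex; the markings start at `1`. -/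
def markedRefLang : Regex A X → Language (RefSym A X × ℕ)
  | empty => 0
  | expr α _ => α.markedRefLangFrom 1

/-- The four ways in which two marked ref-words can witness that a regex is not deterministic. -/
def Conflict (ρ₁ ρ₂ : List (RefSym A X × ℕ)) : Prop :=
  ∃ r γ₁ γ₂ : List (RefSym A X × ℕ),
    (∀ c ∈ γ₁, c.1.IsBracket) ∧ (∀ c ∈ γ₂, c.1.IsBracket) ∧
    ((∃ (a : A) (i j : ℕ) (s₁ s₂ : List (RefSym A X × ℕ)), i ≠ j ∧
        ρ₁ = r ++ γ₁ ++ (RefSym.term a, i) :: s₁ ∧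
        ρ₂ = r ++ γ₂ ++ (RefSym.term a, j) :: s₂) ∨
     (∃ (x : X) (χ : RefSym A X) (i j : ℕ) (s₁ s₂ : List (RefSym A X × ℕ)),
        χ.IsTermOrRef ∧ i ≠ j ∧
        ρ₁ = r ++ γ₁ ++ (RefSym.ref x, i) :: s₁ ∧
        ρ₂ = r ++ γ₂ ++ (χ, j) :: s₂) ∨
     (∃ (χ : RefSym A X) (i : ℕ) (s₁ s₂ : List (RefSym A X × ℕ)),
        χ.IsTermOrRef ∧ γ₁ ≠ γ₂ ∧
        ρ₁ = r ++ γ₁ ++ (χ, i) :: s₁ ∧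
        ρ₂ = r ++ γ₂ ++ (χ, i) :: s₂) ∨
     (γ₁ ≠ γ₂ ∧ ρ₁ = r ++ γ₁ ∧ ρ₂ = r ++ γ₂))

/-- Deterministic regex. -/
def Deterministic (α : Regex A X) : Prop :=
  ¬ ∃ ρ₁ ∈ α.markedRefLang, ∃ ρ₂ ∈ α.markedRefLang, Conflict ρ₁ ρ₂

end Regex

/-- The languages over `A` of deterministic regex. -/
def drxLanguages (A X : Type*) : Set (Language A) :=
  {L | ∃ α : Regex A X, α.Deterministic ∧ α.language = L}

/-- The languages over `A` of deterministic regular expressions, that is, of deterministic regex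
without variables. -/
def dregLanguages (A X : Type*) : Set (Language A) :=
  {L | ∃ α : Regex A X, α.vars = ∅ ∧ α.Deterministic ∧ α.language = L}

/-! ### Memory automata with trap state -/

/-- Memory instructions. -/
inductive MemInstr where
  | opening
  | closing
  | resetting
  | unchanged

/-- Status of a memory. -/
inductive MemStatus where
  | opened
  | closed

/-- Transition labels: the empty word, a letter, or the recall of a memory. -/
inductive TransLabel (A : Type*) (k : ℕ) where
  | eps
  | letter (a : A)
  | recall (i : Fin k)

/-- Memory automata with trap state, with `k` memories, over the alphabet `A`. -/
structure TMFA (A : Type*) (k : ℕ) where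
  Q : Type
  finite_Q : Finite Q
  trap : Q
  start : Q
  final : Set Q
  δ : Q → TransLabel A k → Set (Q × (Fin k → MemInstr))
  trap_eps : δ trap .eps = {(trap, fun _ => .unchanged)}
  trap_letter : ∀ a, δ trap (.letter a) = {(trap, fun _ => .unchanged)}
  trap_recall : ∀ i, δ trap (.recall i) = ∅

/-- The new content and status of a memory when the instruction is applied and `v` is consumed. -/
def MemInstr.apply {A : Type*} (v : List A) :
    MemInstr → List A × MemStatus → List A × MemStatus
  | .unchanged, (u, .opened) => (u ++ v, .opened)
  | .unchanged, (u, .closed) => (u, .closed)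
  | .opening, _ => (v, .opened)
  | .closing, (u, _) => (u, .closed)
  | .resetting, _ => ([], .closed)

namespace TMFA

variable {A : Type*} {k : ℕ}

/-- Configurations: current state, remaining input, contents and status of the memories. -/
structure Config (M : TMFA A k) where
  state : M.Q
  input : List A
  mem : Fin k → List A × MemStatus

/-- A transition with label `b` and instructions `s` consumes `v`, for given memories. In
particular a recalled memory has to be closed by the transition. -/
def Consumes (s : Fin k → MemInstr) (mem : Fin k → List A × MemStatus) (v : List A) :
    TransLabel A k → Prop
  | .eps => v = []
  | .letter a => v = [a]
  | .recall i => s i = .closing ∧ v = (mem i).1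

/-- One step of a computation: an ordinary transition, or a memory recall failure, which consumes
the longest common prefix of the memory content and the remaining input and leads to the
trap state. -/
inductive Step (M : TMFA A k) : M.Config → M.Config → Prop
  | move {q p : M.Q} {b : TransLabel A k} {s : Fin k → MemInstr} {v w : List A}
      {mem : Fin k → List A × MemStatus}
      (h : (p, s) ∈ M.δ q b) (hv : Consumes s mem v b) :
      Step M ⟨q, v ++ w, mem⟩ ⟨p, w, fun i => (s i).apply v (mem i)⟩
  | fail {q p : M.Q} {i : Fin k} {s : Fin k → MemInstr} {v v' w : List A}
      {mem : Fin k → List A × MemStatus}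
      (h : (p, s) ∈ M.δ q (.recall i)) (hs : s i = .closing)
      (hu : (mem i).1 = v ++ v') (hne : v' ≠ []) (hw : v'.head? ≠ w.head?) :
      Step M ⟨q, v ++ w, mem⟩ ⟨M.trap, w, mem⟩

/-- The initial configuration on input `w`. -/
def init (M : TMFA A k) (w : List A) : M.Config :=
  ⟨M.start, w, fun _ => ([], .closed)⟩

/-- The accepted language. -/
def language (M : TMFA A k) : Language A :=
  {w | ∃ c : M.Config, Relation.ReflTransGen M.Step (M.init w) c ∧
    c.input = [] ∧ c.state ∈ M.final}

/-- Deterministic automata. The trap state, whose transitions are prescribed, is exempt. -/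
def Deterministic (M : TMFA A k) : Prop :=
  ∀ q, q ≠ M.trap →
    (∀ b, (M.δ q b).Subsingleton) ∧
    (∀ b, (b = .eps ∨ ∃ i, b = .recall i) → (M.δ q b).Nonempty →
      ∀ b', b' ≠ b → M.δ q b' = ∅)

/-- The trap state is rejecting. -/
def Rejecting (M : TMFA A k) : Prop :=
  M.trap ∉ M.final

end TMFA

/-- The languages over `A` of deterministic memory automata with rejecting trap state. -/
def dtmfaRejLanguages (A : Type*) : Set (Language A) :=
  {L | ∃ (k : ℕ) (M : TMFA A k), M.Deterministic ∧ M.Rejecting ∧ M.language = L}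

/-! ### Closure properties of a class of languages over a fixed alphabet -/

section Closure

variable {A : Type*}

def ClosedUnderUnion (C : Set (Language A)) : Prop :=
  ∀ L₁ ∈ C, ∀ L₂ ∈ C, L₁ + L₂ ∈ C

def ClosedUnderConcatenation (C : Set (Language A)) : Prop :=
  ∀ L₁ ∈ C, ∀ L₂ ∈ C, L₁ * L₂ ∈ C

def ClosedUnderReversal (C : Set (Language A)) : Prop :=
  ∀ L ∈ C, L.reverse ∈ C

def ClosedUnderComplement (C : Set (Language A)) : Prop :=
  ∀ L ∈ C, Lᶜ ∈ C

/-- The homomorphism `A* → A*` given by `h` on letters sends `w` to `w.flatMap h`. -/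
def ClosedUnderHomomorphism (C : Set (Language A)) : Prop :=
  ∀ h : A → List A, ∀ L ∈ C, ({w | ∃ u ∈ L, u.flatMap h = w} : Language A) ∈ C

def ClosedUnderInverseHomomorphism (C : Set (Language A)) : Prop :=
  ∀ h : A → List A, ∀ L ∈ C, ({u | u.flatMap h ∈ L} : Language A) ∈ C

/-- Closure under intersection with languages from the class `D`. -/
def ClosedUnderIntersectionWith (D C : Set (Language A)) : Prop :=
  ∀ L ∈ C, ∀ R ∈ D, L ⊓ R ∈ C

end Closure

/-! ### Languages without long forced continuations -/

/-! A recall is a commitment: a deterministic device that is about to produce a nonempty content has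
excluded all proper continuations of the word read so far that do not begin with this content.
`Language.NoJump N` says that no commitment of length at least `N` is compatible with the language.
In a deterministic memory automaton with rejecting trap state for such a language, accepting
computations recall only contents shorter than `N`. Longer contents can be forgotten, so finitely
many data determine each left quotient (`TMFA.finite_range_leftQuotient`), and the language is
regular.

`growthLanguage` has a deterministic automaton with two memories, and its words of even length form
the nonregular set of all `a ^ (2 * i * (i + 1))`. Each of the operations turns it into a language
that satisfies `NoJump` but still contains a trace of this set, which keeps the number of left
quotients infinite.

For a deterministic regex, `NoJump 1` forces every reference to stand for the empty word, and then
the last marked terminal determines the left quotient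
(`Regex.Deterministic.finite_range_leftQuotient_expr`). This settles complement, by way of the words
`a ^ n * b * a ^ n` with `n ≥ 1`.

The other operations on regex languages produce the set of all alternating words `abab…` from
languages of deterministic regular expressions. This set is regular but has no deterministic regex
(`Regex.not_mem_drxLanguages_of_alternating`). Since every next letter is forced, the marked
ref-words of such a regex follow a single path, and all but finitely many have the form `r₀ * c ^ n
* γ` (`RegexExpr.eventuallyCyclic`). All lengths occur, so eventually each pass over `c` adds at
most one letter. By `repeat_of_passes` an added letter equals a neighbour: a terminal returns in the
next pass, and a reference either copies the letter of the previous pass or is repeated in the next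
one. This contradicts alternation. -/

/-- Every prefix `p` of a word of `L` has a proper continuation in `L` that avoids a given word of
length at least `N`. -/
def Language.NoJump {A : Type*} (N : ℕ) (L : Language A) : Prop :=
  ∀ p v : List A, N ≤ v.length → (∃ s, p ++ s ∈ L) → ∃ u, u ≠ [] ∧ p ++ u ∈ L ∧ ¬ v <+: u

theorem Language.NoJump.of_short {A : Type*} {N : ℕ} {L : Language A}
    (h : ∀ p : List A, (∃ s, p ++ s ∈ L) → ∃ u, u ≠ [] ∧ u.length < N ∧ p ++ u ∈ L) :
    L.NoJump N := by
  intro p v hv hp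
  obtain ⟨u, hu, hl, hm⟩ := h p hp
  exact ⟨u, hu, hm, fun hvu => by have := hvu.length_le; omega⟩

/-- The range of a function is finite if its values are determined by finitely many data. -/
theorem Set.finite_range_of_factor {α β γ : Type*} [Finite γ] (f : α → β) (g : α → γ)
    (h : ∀ x y, g x = g y → f x = f y) : (Set.range f).Finite := by
  classical
  rcases isEmpty_or_nonempty α with hα | hα
  · exact Set.finite_range f
  · refine (Set.finite_range (fun c : γ => f (Function.invFun g c))).subset ?_
    rintro _ ⟨x, rfl⟩
    exact ⟨g x, h _ _ (Function.invFun_eq ⟨x, rfl⟩)⟩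

/-! ### Runs of deterministic memory automata -/

namespace TMFA

variable {A : Type*} {k : ℕ} {M : TMFA A k}

theorem step_iff {c c' : M.Config} : M.Step c c' ↔
    (∃ p b s v w, (p, s) ∈ M.δ c.state b ∧ Consumes s c.mem v b ∧ c.input = v ++ w ∧
      c' = ⟨p, w, fun i => (s i).apply v (c.mem i)⟩) ∨
    (∃ p i s v v' w, (p, s) ∈ M.δ c.state (.recall i) ∧ s i = .closing ∧
      (c.mem i).1 = v ++ v' ∧ v' ≠ [] ∧ v'.head? ≠ w.head? ∧ c.input = v ++ w ∧
      c' = ⟨M.trap, w, c.mem⟩) := by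
  constructor
  · intro h
    cases h with
    | move h hv => exact Or.inl ⟨_, _, _, _, _, h, hv, rfl, rfl⟩
    | fail h hs hu hne hw => exact Or.inr ⟨_, _, _, _, _, _, h, hs, hu, hne, hw, rfl, rfl⟩
  · obtain ⟨q, w₀, mem⟩ := c
    rintro (⟨p, b, s, v, w, h, hv, rfl, rfl⟩ | ⟨p, i, s, v, v', w, h, hs, hu, hne, hw, rfl, rfl⟩)
    · exact Step.move h hv
    · exact Step.fail h hs hu hne hw

/-- Some computation from `c` reaches a final state with empty remaining input. -/
def Accepts (M : TMFA A k) (c : M.Config) : Prop :=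
  ∃ c', Relation.ReflTransGen M.Step c c' ∧ c'.input = [] ∧ c'.state ∈ M.final

theorem Step.input_suffix {c c' : M.Config} (h : M.Step c c') : c'.input <:+ c.input := by
  rw [step_iff] at h
  rcases h with ⟨p, b, s, v, w, -, -, hi, rfl⟩ | ⟨p, i, s, v, v', w, -, -, -, -, -, hi, rfl⟩ <;>
  · rw [hi]; exact List.suffix_append _ _

theorem Step.state_eq_trap {c c' : M.Config} (h : M.Step c c') (hc : c.state = M.trap) :
    c'.state = M.trap := by
  rw [step_iff] at h
  rcases h with ⟨p, b, s, v, w, hδ, -, -, rfl⟩ | ⟨p, i, s, v, v', w, hδ, -, -, -, -, hi, rfl⟩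
  · rw [hc] at hδ
    rcases b with _ | a | i
    · rw [M.trap_eps] at hδ; exact (Prod.ext_iff.1 hδ).1
    · rw [M.trap_letter] at hδ; exact (Prod.ext_iff.1 hδ).1
    · rw [M.trap_recall] at hδ; exact hδ.elim
  · rfl

theorem not_accepts_of_trap (hR : M.Rejecting) {c : M.Config} (hc : c.state = M.trap) :
    ¬ M.Accepts c := by
  rintro ⟨c', h, -, hf⟩
  have : c'.state = M.trap := by
    clear hf
    induction h with
    | refl => exact hc
    | tail _ hs ih => exact hs.state_eq_trap ih
  exact hR (this ▸ hf)

/-- A mismatch directly after a common prefix makes it the longest one, so a failing recall consumes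
a uniquely determined word. -/
theorem append_eq_append_of_mismatch {v₁ v₂ v₁' v₂' w₁ w₂ : List A}
    (hu : v₁ ++ v₁' = v₂ ++ v₂') (hw : v₁ ++ w₁ = v₂ ++ w₂)
    (h₁ : v₁'.head? ≠ w₁.head?) (h₂ : v₂'.head? ≠ w₂.head?) : v₁ = v₂ := by
  induction v₁ generalizing v₂ v₁' v₂' w₁ w₂ with
  | nil =>
    cases v₂ with
    | nil => rfl
    | cons c v₂ =>
      simp only [List.nil_append] at hu hw
      simp [hu, hw] at h₁
  | cons d v₁ ih =>
    cases v₂ with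
    | nil =>
      simp only [List.nil_append] at hu hw
      simp [← hu, ← hw] at h₂
    | cons c v₂ =>
      simp only [List.cons_append, List.cons.injEq] at hu hw
      rw [hu.1, ih hu.2 hw.2 h₁ h₂]

/-- The trap state is excluded because its `ε`-transition competes with its letter transitions.
Elsewhere a successful and a failing recall exclude each other, since success makes the whole
content a prefix of the input. -/
theorem Step.unique (hM : M.Deterministic) {c c₁ c₂ : M.Config} (hc : c.state ≠ M.trap)
    (h₁ : M.Step c c₁) (h₂ : M.Step c c₂) : c₁ = c₂ := by
  obtain ⟨hsub, hexcl⟩ := hM _ hc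
  have key : ∀ {b b' : TransLabel A k} {x y}, x ∈ M.δ c.state b → y ∈ M.δ c.state b' →
      (b = .eps ∨ ∃ i, b = .recall i) → b' = b := by
    intro b b' x y hx hy hb
    by_contra hne
    have := hexcl b hb ⟨x, hx⟩ b' hne
    rw [this] at hy
    exact hy
  rw [step_iff] at h₁ h₂
  rcases h₁ with ⟨p, b, s, v, w, hδ, hv, hi, rfl⟩ | ⟨p, i, s, v, v', w, hδ, hs, hu, hne, hh, hi, rfl⟩
  · rcases h₂ with ⟨p₂, b₂, s₂, v₂, w₂, hδ₂, hv₂, hi₂, rfl⟩ |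
      ⟨p₂, i₂, s₂, v₂, v₂', w₂, hδ₂, hs₂, hu₂, hne₂, hh₂, hi₂, rfl⟩
    · have hb : b₂ = b := by
        rcases b with _ | a | i
        · exact key hδ hδ₂ (Or.inl rfl)
        · rcases b₂ with _ | a₂ | i
          · exact (key hδ₂ hδ (Or.inl rfl)).symm
          · simp only [Consumes] at hv hv₂
            subst hv hv₂
            rw [hi] at hi₂
            simp at hi₂
            rw [hi₂.1]
          · exact (key hδ₂ hδ (Or.inr ⟨i, rfl⟩)).symm
        · exact key hδ hδ₂ (Or.inr ⟨i, rfl⟩)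
      subst hb
      have hps := hsub _ hδ hδ₂
      simp only [Prod.mk.injEq] at hps
      obtain ⟨rfl, rfl⟩ := hps
      have hvv : v = v₂ := by
        cases b₂ <;> simp only [Consumes] at hv hv₂
        · rw [hv, hv₂]
        · rw [hv, hv₂]
        · rw [hv.2, hv₂.2]
      subst hvv
      rw [hi] at hi₂
      rw [List.append_cancel_left hi₂]
    · have hb := key hδ₂ hδ (Or.inr ⟨_, rfl⟩)
      subst hb
      obtain ⟨-, rfl⟩ := hv
      rw [hi, hu₂, List.append_assoc] at hi₂
      rw [← List.append_cancel_left hi₂] at hh₂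
      cases v₂' with
      | nil => exact (hne₂ rfl).elim
      | cons d t => simp at hh₂
  · rcases h₂ with ⟨p₂, b₂, s₂, v₂, w₂, hδ₂, hv₂, hi₂, rfl⟩ |
      ⟨p₂, i₂, s₂, v₂, v₂', w₂, hδ₂, hs₂, hu₂, hne₂, hh₂, hi₂, rfl⟩
    · have hb := key hδ hδ₂ (Or.inr ⟨_, rfl⟩)
      subst hb
      obtain ⟨-, rfl⟩ := hv₂
      rw [hi, hu, List.append_assoc] at hi₂
      rw [List.append_cancel_left hi₂] at hh
      cases v' with
      | nil => exact (hne rfl).elim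
      | cons d t => simp at hh
    · have hb := key hδ hδ₂ (Or.inr ⟨_, rfl⟩)
      simp only [TransLabel.recall.injEq] at hb
      subst hb
      have hvv := append_eq_append_of_mismatch (hu.symm.trans hu₂) (hi.symm.trans hi₂) hh hh₂
      subst hvv
      rw [hi] at hi₂
      rw [List.append_cancel_left hi₂]

theorem Accepts.of_step (hM : M.Deterministic) (hR : M.Rejecting) {c c' : M.Config}
    (ha : M.Accepts c) (hc : c.input ≠ []) (hs : M.Step c c') : M.Accepts c' := by
  have ht : c.state ≠ M.trap := fun h => not_accepts_of_trap hR h ha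
  obtain ⟨d, hd, hi, hf⟩ := ha
  rcases Relation.ReflTransGen.cases_head hd with rfl | ⟨c₁, h₁, h₂⟩
  · exact (hc hi).elim
  · rw [Step.unique hM ht hs h₁]
    exact ⟨d, h₂, hi, hf⟩

theorem Accepts.head {c c' : M.Config} (ha : M.Accepts c') (hs : Relation.ReflTransGen M.Step c c') :
    M.Accepts c := by
  obtain ⟨d, hd, h⟩ := ha
  exact ⟨d, hs.trans hd, h⟩

/-- Inputs only shrink along a computation, so a nonempty input at `c'` means that no earlier
configuration has accepted. By determinism the accepting computation passes through `c'`. -/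
theorem Accepts.of_steps (hM : M.Deterministic) (hR : M.Rejecting) {c c' : M.Config}
    (ha : M.Accepts c) (hs : Relation.ReflTransGen M.Step c c') (hc : c'.input ≠ []) :
    M.Accepts c' := by
  induction hs with
  | refl => exact ha
  | tail _ h ih =>
    have hb := h.input_suffix
    refine (ih ?_).of_step hM hR ?_ h <;>
    · intro h0
      rw [h0] at hb
      exact hc (List.suffix_nil.1 hb)

/-- The computation reads the prefix `p`, whatever follows it, and arrives at the given state and
memories. -/
def Reads (M : TMFA A k) (p : List A) (q : M.Q) (mem : Fin k → List A × MemStatus) : Prop :=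
  ∀ w, Relation.ReflTransGen M.Step (M.init (p ++ w)) ⟨q, w, mem⟩

theorem Reads.move {p : List A} {q q' : M.Q} {mem : Fin k → List A × MemStatus}
    (h : M.Reads p q mem) {b : TransLabel A k} {s : Fin k → MemInstr} {v : List A}
    (hδ : (q', s) ∈ M.δ q b) (hv : Consumes s mem v b) :
    M.Reads (p ++ v) q' (fun i => (s i).apply v (mem i)) := by
  intro w
  rw [List.append_assoc]
  exact (h (v ++ w)).tail (Step.move hδ hv)

/-- If the content were long, `NoJump` would give an accepted continuation `u` that does not begin
with it. The computation on `u` reaches the same state and memories and must attempt the same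
recall, which fails and leads to the rejecting trap state. -/
theorem Reads.recall_length_lt (hM : M.Deterministic) (hR : M.Rejecting) {N : ℕ}
    (hN : M.language.NoJump N) {p : List A} {q : M.Q} {mem : Fin k → List A × MemStatus}
    (h : M.Reads p q mem) {w : List A} (ha : M.Accepts ⟨q, w, mem⟩) {i : Fin k} {q' : M.Q}
    {s : Fin k → MemInstr} (hδ : (q', s) ∈ M.δ q (.recall i)) :
    (mem i).1.length < N := by
  by_contra! hlen
  have ht : q ≠ M.trap := fun hq => not_accepts_of_trap hR hq ha
  obtain ⟨u, hu, hm, hp⟩ := hN p _ hlen ⟨w, ha.head (h w)⟩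
  -- Here `u ≠ []` is essential: otherwise acceptance might have occurred before this configuration.
  have hau : M.Accepts ⟨q, u, mem⟩ := Accepts.of_steps hM hR hm (h u) hu
  obtain ⟨d, hd, hi, hf⟩ := hau
  rcases Relation.ReflTransGen.cases_head hd with rfl | ⟨c₁, h₁, h₂⟩
  · exact hu hi
  have hac : M.Accepts c₁ := ⟨d, h₂, hi, hf⟩
  rw [step_iff] at h₁
  rcases h₁ with ⟨p₂, b₂, s₂, v₂, w₂, hδ₂, hv₂, hi₂, rfl⟩ |
    ⟨p₂, i₂, s₂, v₂, v₂', w₂, hδ₂, hs₂, hu₂, hne₂, hh₂, hi₂, rfl⟩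
  · have hb : b₂ = .recall i := by
      by_contra hne
      have := (hM q ht).2 _ (Or.inr ⟨i, rfl⟩) ⟨_, hδ⟩ b₂ hne
      rw [this] at hδ₂
      exact hδ₂
    subst hb
    obtain ⟨-, rfl⟩ := hv₂
    exact hp ⟨w₂, hi₂.symm⟩
  · exact not_accepts_of_trap hR rfl hac

/-- The memory with its content forgotten if it has length at least `N`. -/
def truncate (N : ℕ) (m : List A × MemStatus) : Option {l : List A // l.length < N} × MemStatus :=
  open Classical in (if h : m.1.length < N then some ⟨m.1, h⟩ else none, m.2)

/-- Appending and closing keep a content of length at least `N` above the bound, while opening and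
resetting discard it. -/
theorem truncate_apply {N : ℕ} {m m' : List A × MemStatus} (h : truncate N m = truncate N m')
    (s : MemInstr) (v : List A) : truncate N (s.apply v m) = truncate N (s.apply v m') := by
  obtain ⟨u, t⟩ := m
  obtain ⟨u', t'⟩ := m'
  simp only [truncate, Prod.mk.injEq] at h
  obtain ⟨h, rfl⟩ := h
  by_cases h1 : u.length < N <;> by_cases h2 : u'.length < N <;> simp [h1, h2] at h
  · rw [h]
  · have h3 : ¬ (u.length + v.length < N) := by omega
    have h4 : ¬ (u'.length + v.length < N) := by omega
    cases s <;> cases t <;> first | rfl | simp [MemInstr.apply, truncate, h1, h2, h3, h4]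

theorem eq_of_truncate {N : ℕ} {m m' : List A × MemStatus} (h : truncate N m = truncate N m')
    (hm : m.1.length < N) : m.1 = m'.1 := by
  simp only [truncate, Prod.mk.injEq] at h
  obtain ⟨h, -⟩ := h
  by_cases h2 : m'.1.length < N <;> simp [hm, h2] at h
  exact h

/-- Accepting computations never recall a content of length at least `N`, so the same transitions
remain possible when such contents are exchanged. `Reads` is carried along because the bound on
recalled contents depends on it. -/
theorem Accepts.of_truncate (hM : M.Deterministic) (hR : M.Rejecting) {N : ℕ}
    (hN : M.language.NoJump N) {c : M.Config} (ha : M.Accepts c) :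
    ∀ {p : List A} {mem' : Fin k → List A × MemStatus}, M.Reads p c.state c.mem →
    (∀ i, truncate N (c.mem i) = truncate N (mem' i)) → M.Accepts ⟨c.state, c.input, mem'⟩ := by
  obtain ⟨d, hd, hi, hf⟩ := ha
  induction hd using Relation.ReflTransGen.head_induction_on with
  | refl => exact fun _ _ => ⟨_, .refl, hi, hf⟩
  | head h₁ h₂ ih =>
    rename_i c c₁
    intro p mem' hr ht
    have hac : M.Accepts c₁ := ⟨d, h₂, hi, hf⟩
    have hacc : M.Accepts c := hac.head (.single h₁)
    rw [step_iff] at h₁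
    rcases h₁ with ⟨q, b, s, v, w, hδ, hv, hi', rfl⟩ | ⟨_, _, _, _, _, _, -, -, -, -, -, -, rfl⟩
    · have hv' : Consumes s mem' v b := by
        rcases b with _ | a | i
        · exact hv
        · exact hv
        · refine ⟨hv.1, hv.2.trans (eq_of_truncate (ht i) ?_)⟩
          exact hr.recall_length_lt hM hR hN (w := c.input) hacc hδ
      have hacc' := ih (mem' := fun i => (s i).apply v (mem' i)) (hr.move hδ hv)
        (fun i => truncate_apply (ht i) _ _)
      refine hacc'.head (.single ?_)
      rw [hi']
      exact Step.move hδ hv'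
    · exact (not_accepts_of_trap hR rfl hac).elim

/-- Each step of an accepting computation consumes at most `N` letters: a single letter, whence `1 ≤
N`, or a short content. So some configuration is met at most `N` letters before the end of the given
prefix. -/
theorem Reads.exists_near (hM : M.Deterministic) (hR : M.Rejecting) {N : ℕ} (hN0 : 1 ≤ N)
    (hN : M.language.NoJump N) {s : List A} {c : M.Config} (ha : M.Accepts c) :
    ∀ {p₁ p₂ : List A}, c.input = p₂ ++ s → M.Reads p₁ c.state c.mem →
    ∃ p₁' p₂' q mem, p₁' ++ p₂' = p₁ ++ p₂ ∧ p₂'.length ≤ N ∧ M.Reads p₁' q mem ∧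
      M.Accepts ⟨q, p₂' ++ s, mem⟩ := by
  obtain ⟨d, hd, hi, hf⟩ := ha
  induction hd using Relation.ReflTransGen.head_induction_on with
  | refl =>
    intro p₁ p₂ hp hr
    rw [hi] at hp
    have hp2 := (List.append_eq_nil_iff.1 hp.symm).1
    refine ⟨p₁, p₂, _, _, rfl, by simp [hp2], hr, d, ?_, hi, hf⟩
    rw [← hp, ← hi]
  | head h₁ h₂ ih =>
    rename_i c c₁
    intro p₁ p₂ hp hr
    have hac : M.Accepts c₁ := ⟨d, h₂, hi, hf⟩
    have hacc : M.Accepts c := hac.head (.single h₁)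
    by_cases hlen : p₂.length ≤ N
    · refine ⟨p₁, p₂, _, _, rfl, hlen, hr, ?_⟩
      rw [← hp]
      exact hacc
    rw [step_iff] at h₁
    rcases h₁ with ⟨q, b, s', v, w, hδ, hv, hi', rfl⟩ | ⟨_, _, _, _, _, _, -, -, -, -, -, -, rfl⟩
    · have hvl : v.length ≤ N := by
        rcases b with _ | a | i
        · simp only [Consumes] at hv; simp [hv]
        · simp only [Consumes] at hv; simp [hv, hN0]
        · rw [hv.2]
          exact (hr.recall_length_lt hM hR hN (w := c.input) hacc hδ).le
      rw [hi'] at hp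
      have hpre : v <+: p₂ := List.prefix_of_prefix_length_le (l₃ := v ++ w)
        (List.prefix_append _ _) (hp ▸ List.prefix_append _ _) (by omega)
      obtain ⟨p₃, rfl⟩ := hpre
      obtain ⟨p₁', p₂', q', mem', h1, h2⟩ := ih (p₁ := p₁ ++ v) (p₂ := p₃)
        (List.append_cancel_left (by rw [hp, List.append_assoc])) (hr.move hδ hv)
      exact ⟨p₁', p₂', q', mem', by rw [h1, List.append_assoc], h2⟩
    · exact (not_accepts_of_trap hR rfl hac).elim

/-- The quotient by `p` is determined by the state and the truncated memories in a configuration at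
most `N` letters before the end of `p`, by these last letters, and by whether `p` itself is
accepted. -/
theorem finite_range_leftQuotient [Finite A] (hM : M.Deterministic) (hR : M.Rejecting) {N : ℕ}
    (hN0 : 1 ≤ N) (hN : M.language.NoJump N) : (Set.range M.language.leftQuotient).Finite := by
  classical
  have := M.finite_Q
  have : Finite {l : List A // l.length < N} := (List.finite_length_lt A N).to_subtype
  have : Finite {l : List A // l.length ≤ N} := (List.finite_length_le A N).to_subtype
  have : Finite MemStatus := Finite.of_injective
    (fun s => match s with | .opened => true | .closed => false) (by
      intro x y h; cases x <;> cases y <;> simp_all)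
  have near : ∀ p : List A, (∃ s, p ++ s ∈ M.language) → ∃ p₁ p₂ q mem, p₁ ++ p₂ = p ∧
      p₂.length ≤ N ∧ M.Reads p₁ q mem := by
    rintro p ⟨s, hs⟩
    obtain ⟨p₁', p₂', q, mem, h1, h2, h3, -⟩ := Reads.exists_near hM hR hN0 hN (s := s)
      (c := M.init (p ++ s)) hs (p₁ := []) (p₂ := p) rfl (fun w => .refl)
    exact ⟨p₁', p₂', q, mem, by simpa using h1, h2, h3⟩
  have : Nonempty M.Q := ⟨M.start⟩
  have : Nonempty MemStatus := ⟨.closed⟩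
  choose! f g q mem hfg hg hr using near
  -- Membership of `p` is recorded separately because the computation on `p` alone may accept before
  -- the chosen configuration. The value `none` collects the prefixes without continuation in the
  -- language.
  let code : List A → Option (M.Q × (Fin k → Option {l : List A // l.length < N} × MemStatus) ×
      {l : List A // l.length ≤ N} × Prop) := fun p =>
    if h : ∃ s, p ++ s ∈ M.language then
      some (q p, fun i => truncate N (mem p i), ⟨g p, hg p h⟩, p ∈ M.language)
    else none
  have key : ∀ p p', code p = code p' → ∀ u, p ++ u ∈ M.language → p' ++ u ∈ M.language := by
    intro p p' hc u hu
    have h1 : ∃ s, p ++ s ∈ M.language := ⟨u, hu⟩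
    by_cases h2 : ∃ s, p' ++ s ∈ M.language
    · simp only [code, dif_pos h1, dif_pos h2, Option.some.injEq, Prod.mk.injEq, Subtype.mk.injEq,
        eq_iff_iff] at hc
      obtain ⟨hq, hmem, hgg, hl⟩ := hc
      rcases eq_or_ne u [] with rfl | hne
      · simpa using hl.1 (by simpa using hu)
      · have hacc : M.Accepts ⟨q p, g p ++ u, mem p⟩ := by
          have hs := hr p h1 (g p ++ u)
          rw [← List.append_assoc, hfg p h1] at hs
          exact Accepts.of_steps hM hR hu hs (by simp [hne])
        have hacc' := hacc.of_truncate hM hR hN (hr p h1) (mem' := mem p')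
          (fun i => congrFun hmem i)
        simp only [hq, hgg] at hacc'
        have hs := hr p' h2 (g p' ++ u)
        rw [← List.append_assoc, hfg p' h2] at hs
        exact hacc'.head hs
    · simp [code, h1, h2] at hc
  refine Set.finite_range_of_factor _ code fun p p' h => ?_
  ext u
  exact ⟨key p p' h u, key p' p h.symm u⟩

theorem not_mem_dtmfaRejLanguages [Finite A] {L : Language A} {N : ℕ} (hN0 : 1 ≤ N)
    (hN : L.NoJump N) (hL : ¬ (Set.range L.leftQuotient).Finite) : L ∉ dtmfaRejLanguages A := by
  rintro ⟨k, M, hM, hR, rfl⟩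
  exact hL (finite_range_leftQuotient hM hR hN0 hN)

end TMFA

/-! ### Regular languages and a nonregular language of deterministic memory automata -/

namespace TMFA

/-- A deterministic finite automaton as a memory automaton without memories. -/
def ofDFA {A σ : Type*} {τ : Type} [Finite τ] (D : DFA A σ) (e : σ ≃ τ) : TMFA A 0 where
  Q := Option τ
  finite_Q := inferInstance
  trap := none
  start := some (e D.start)
  final := {q | ∃ t, q = some t ∧ e.symm t ∈ D.accept}
  δ q b := match q, b with
    | none, .eps => {(none, fun _ => .unchanged)}
    | none, .letter _ => {(none, fun _ => .unchanged)}
    | none, .recall _ => ∅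
    | some t, .letter a => {(some (e (D.step (e.symm t) a)), fun _ => .unchanged)}
    | some _, _ => ∅
  trap_eps := rfl
  trap_letter _ := rfl
  trap_recall _ := rfl

theorem ofDFA_deterministic {A σ : Type*} {τ : Type} [Finite τ] (D : DFA A σ) (e : σ ≃ τ) :
    (ofDFA D e).Deterministic := by
  rintro (_ | t) hq
  · exact (hq rfl).elim
  refine ⟨?_, ?_⟩
  · rintro (_ | a | i) x hx y hy
    · exact hx.elim
    · exact (Set.mem_singleton_iff.1 hx).trans (Set.mem_singleton_iff.1 hy).symm
    · exact hx.elim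
  · rintro (_ | a | i) hb ⟨x, hx⟩
    · exact hx.elim
    · simp at hb
    · exact hx.elim

theorem ofDFA_rejecting {A σ : Type*} {τ : Type} [Finite τ] (D : DFA A σ) (e : σ ≃ τ) :
    (ofDFA D e).Rejecting := by
  rintro ⟨t, h, -⟩
  exact Option.some_ne_none t h.symm

theorem ofDFA_language {A σ : Type*} {τ : Type} [Finite τ] (D : DFA A σ) (e : σ ≃ τ) :
    (ofDFA D e).language = D.accepts := by
  have fwd : ∀ c c' : (ofDFA D e).Config, Relation.ReflTransGen (ofDFA D e).Step c c' →
      ∀ t, c.state = some t → c'.state = none ∨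
        ∃ w, c.input = w ++ c'.input ∧ c'.state = some (e (D.evalFrom (e.symm t) w)) := by
    intro c c' h t ht
    induction h with
    | refl => exact Or.inr ⟨[], by simp, by simpa using ht⟩
    | tail _ hs ih =>
      rename_i c₁ c₂ _
      rcases ih with ih | ⟨w, hw, ih⟩
      · exact Or.inl (hs.state_eq_trap ih)
      rw [step_iff] at hs
      rcases hs with ⟨p, b, s, v, w', hδ, hv, hi, rfl⟩ | ⟨p, i, s, v, v', w, hδ, -⟩
      · rw [ih] at hδ
        rcases b with _ | a | i
        · exact hδ.elim
        · refine Or.inr ⟨w ++ v, by rw [hw, hi, List.append_assoc], ?_⟩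
          have hp : p = _ := (Prod.ext_iff.1 (Set.mem_singleton_iff.1 hδ)).1
          simp only [Consumes] at hv
          subst hv
          rw [DFA.evalFrom_of_append]
          simpa using hp
        · exact hδ.elim
      · exact i.elim0
  ext w
  constructor
  · rintro ⟨c', h, hi, hf⟩
    rcases fwd _ _ h _ rfl with h0 | ⟨u, hu, hs⟩
    · rw [h0] at hf
      exact (ofDFA_rejecting D e hf).elim
    · rw [hi, List.append_nil] at hu
      obtain ⟨t, ht, hacc⟩ := hf
      have hs' := Option.some.inj (ht.symm.trans hs)
      rw [hs'] at hacc
      change w = u at hu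
      rw [← hu, Equiv.symm_apply_apply, Equiv.symm_apply_apply] at hacc
      exact hacc
  · intro hw
    have bwd : ∀ (w : List A) (t : τ) mem, ∃ mem', Relation.ReflTransGen (ofDFA D e).Step
        ⟨some t, w, mem⟩ ⟨some (e (D.evalFrom (e.symm t) w)), [], mem'⟩ := by
      intro w
      induction w with
      | nil => intro t mem; exact ⟨mem, by simpa using Relation.ReflTransGen.refl⟩
      | cons a w ih =>
        intro t mem
        obtain ⟨mem', h⟩ := ih (e (D.step (e.symm t) a))
          (fun i => MemInstr.unchanged.apply [a] (mem i))
        refine ⟨mem', Relation.ReflTransGen.head ?_ (by simpa using h)⟩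
        exact Step.move (b := .letter a) (v := [a]) (Set.mem_singleton _) rfl
    obtain ⟨mem', h⟩ := bwd w (e D.start) (fun _ => ([], .closed))
    exact ⟨_, h, rfl, _, rfl, by rw [Equiv.symm_apply_apply, Equiv.symm_apply_apply]; exact hw⟩

end TMFA

theorem Language.IsRegular.mem_dtmfaRejLanguages {A : Type*} {L : Language A}
    (h : L.IsRegular) : L ∈ dtmfaRejLanguages A := by
  obtain ⟨σ, _, D, rfl⟩ := h
  exact ⟨0, TMFA.ofDFA D (Fintype.equivFin σ), TMFA.ofDFA_deterministic _ _,
    TMFA.ofDFA_rejecting _ _, TMFA.ofDFA_language _ _⟩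

/-- The words `a ^ (2 * i * (i + 1))`, and the words `a ^ (2 * i * (i + 2)) * b * w` with `w` of
even length. -/
def growthLanguage {A : Type*} (a b : A) : Language A :=
  {x | (∃ i, x = List.replicate (2 * i * (i + 1)) a) ∨
    ∃ i w, Even w.length ∧ x = List.replicate (2 * i * (i + 2)) a ++ b :: w}

/-- The states of an automaton for `growthLanguage`. -/
inductive GrowthState where
  | loop
  | copied
  | added
  | ready
  | evenTail
  | oddTail
  | trap

namespace GrowthState

instance : Finite GrowthState :=
  Finite.of_surjective ![loop, copied, added, ready, evenTail, oddTail, trap] (by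
    rintro (_ | _)
    exacts [⟨0, rfl⟩, ⟨1, rfl⟩, ⟨2, rfl⟩, ⟨3, rfl⟩, ⟨4, rfl⟩, ⟨5, rfl⟩, ⟨6, rfl⟩])

open Classical in
/-- The transitions of an automaton for `growthLanguage`. -/
def δ {A : Type*} (a b : A) :
    GrowthState → TransLabel A 2 → Set (GrowthState × (Fin 2 → MemInstr))
  | loop, .recall i => if i = 0 then {(copied, ![.closing, .opening])} else ∅
  | copied, .letter c => if c = a then {(added, fun _ => .unchanged)} else
      if c = b then {(evenTail, fun _ => .unchanged)} else ∅
  | added, .letter c => if c = a then {(ready, fun _ => .unchanged)} else ∅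
  | ready, .recall i => if i = 1 then {(loop, ![.opening, .closing])} else ∅
  | evenTail, .letter _ => {(oddTail, fun _ => .unchanged)}
  | oddTail, .letter _ => {(evenTail, fun _ => .unchanged)}
  | trap, .letter _ => {(trap, fun _ => .unchanged)}
  | trap, .eps => {(trap, fun _ => .unchanged)}
  | _, _ => ∅

end GrowthState

/-- An automaton for `growthLanguage`. -/
def growthAutomaton {A : Type*} (a b : A) : TMFA A 2 where
  Q := GrowthState
  finite_Q := inferInstance
  trap := .trap
  start := .loop
  final := {.loop, .evenTail}
  δ := GrowthState.δ a b
  trap_eps := rfl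
  trap_letter _ := rfl
  trap_recall _ := rfl

theorem growthAutomaton_loop {A : Type*} {a b : A} :
    ((.copied, ![.closing, .opening]) : GrowthState × _) ∈ (growthAutomaton a b).δ GrowthState.loop (.recall 0) := by
  change _ ∈ GrowthState.δ a b .loop (.recall 0)
  simp [GrowthState.δ]

theorem growthAutomaton_copied {A : Type*} {a b : A} :
    ((.added, fun _ => .unchanged) : GrowthState × _) ∈ (growthAutomaton a b).δ GrowthState.copied (.letter a) := by
  change _ ∈ GrowthState.δ a b .copied (.letter a)
  simp [GrowthState.δ]

theorem growthAutomaton_copied_tail {A : Type*} {a b : A} (hab : a ≠ b) :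
    ((.evenTail, fun _ => .unchanged) : GrowthState × _) ∈ (growthAutomaton a b).δ GrowthState.copied (.letter b) := by
  change _ ∈ GrowthState.δ a b .copied (.letter b)
  simp [GrowthState.δ, hab.symm]

theorem growthAutomaton_added {A : Type*} {a b : A} :
    ((.ready, fun _ => .unchanged) : GrowthState × _) ∈ (growthAutomaton a b).δ GrowthState.added (.letter a) := by
  change _ ∈ GrowthState.δ a b .added (.letter a)
  simp [GrowthState.δ]

theorem growthAutomaton_ready {A : Type*} {a b : A} :
    ((.loop, ![.opening, .closing]) : GrowthState × _) ∈ (growthAutomaton a b).δ GrowthState.ready (.recall 1) := by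
  change _ ∈ GrowthState.δ a b .ready (.recall 1)
  simp [GrowthState.δ]

theorem growthAutomaton_deterministic {A : Type*} (a b : A) :
    (growthAutomaton a b).Deterministic := by
  intro q hq
  change GrowthState at q
  change q ≠ GrowthState.trap at hq
  change (∀ l, (GrowthState.δ a b q l).Subsingleton) ∧ (∀ l, _ → (GrowthState.δ a b q l).Nonempty →
    ∀ l', l' ≠ l → GrowthState.δ a b q l' = ∅)
  constructor
  · rintro (_ | c | i) <;> cases q <;> simp only [GrowthState.δ] <;> (try split_ifs) <;> simp
  · rintro (_ | c | i) hl hne (_ | d | j) hn <;> cases q <;> simp_all [GrowthState.δ]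
    all_goals
      split_ifs at hne <;> simp_all

theorem growthAutomaton_rejecting {A : Type*} (a b : A) : (growthAutomaton a b).Rejecting := by
  rintro (h | h) <;> cases h

/-- The relation between the consumed prefix of the input, the state and the memories. -/
def GrowthInvariant {A : Type*} (a b : A) (x : List A) (mem : Fin 2 → List A × MemStatus) :
    GrowthState → Prop
  | .loop => ∃ i, x = List.replicate (2 * i * (i + 1)) a ∧ (mem 0).1 = List.replicate (2 * i) a
  | .copied => ∃ i, x = List.replicate (2 * i * (i + 2)) a ∧
      mem 1 = (List.replicate (2 * i) a, .opened)
  | .added => ∃ i, x = List.replicate (2 * i * (i + 2) + 1) a ∧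
      mem 1 = (List.replicate (2 * i + 1) a, .opened)
  | .ready => ∃ i, x = List.replicate (2 * i * (i + 2) + 2) a ∧
      mem 1 = (List.replicate (2 * i + 2) a, .opened)
  | .evenTail => ∃ i w, Even w.length ∧ x = List.replicate (2 * i * (i + 2)) a ++ b :: w
  | .oddTail => ∃ i w, ¬ Even w.length ∧ x = List.replicate (2 * i * (i + 2)) a ++ b :: w
  | .trap => True

/-- Round `i` starts with `a ^ (2 * i)` in memory `0`. Its recall opens memory `1` with the same
content, two further letters extend that to `a ^ (2 * i + 2)`, and the recall of memory `1` opens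
memory `0` with the result. The round consumes `4 * (i + 1)` letters, so round `i` begins after `2 *
i * (i + 1)` letters. -/
theorem GrowthInvariant.step {A : Type*} {a b : A} {c c' : (growthAutomaton a b).Config}
    (h : (growthAutomaton a b).Step c c') {x : List A} (hx : GrowthInvariant a b x c.mem c.state) :
    ∃ y, c.input = y ++ c'.input ∧ GrowthInvariant a b (x ++ y) c'.mem c'.state := by
  rw [TMFA.step_iff] at h
  rcases h with ⟨p, l, s, v, w, hδ, hv, hi, rfl⟩ | ⟨p, i, s, v, v', w, hδ, hs, hu, hne, hh, hi, rfl⟩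
  · refine ⟨v, hi, ?_⟩
    obtain ⟨q, inp, mem⟩ := c
    change GrowthState at q
    change GrowthState at p
    change (p, s) ∈ GrowthState.δ a b q l at hδ
    simp only at hv hx
    change GrowthInvariant a b (x ++ v) (fun i => (s i).apply v (mem i)) p
    cases q <;> rcases l with _ | d | j <;> simp only [GrowthState.δ] at hδ
    all_goals try exact hδ.elim
    all_goals try split_ifs at hδ
    all_goals try exact hδ.elim
    all_goals
      rw [Set.mem_singleton_iff, Prod.mk.injEq] at hδ
      obtain ⟨rfl, rfl⟩ := hδ
      simp only [TMFA.Consumes] at hv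
    · obtain ⟨i, rfl, h0⟩ := hx
      obtain ⟨-, rfl⟩ := hv
      subst_vars
      refine ⟨i, ?_, by simp [MemInstr.apply, h0]⟩
      rw [h0, ← List.replicate_add]
      -- The exponent `2 * i * (i + 2)` unfolds to `2 * i * (i + 1) + 2 * i`.
      congr 1
    · obtain ⟨i, rfl, h1⟩ := hx
      subst hv
      refine ⟨i, ?_, ?_⟩
      · subst_vars; rw [← List.replicate_succ']
      · subst_vars; simp [MemInstr.apply, h1, ← List.replicate_succ']
    · obtain ⟨i, rfl, h1⟩ := hx
      subst hv
      exact ⟨i, [], by simp, by subst_vars; simp⟩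
    · obtain ⟨i, rfl, h1⟩ := hx
      subst hv
      refine ⟨i, ?_, ?_⟩
      · subst_vars; rw [← List.replicate_succ']
      · subst_vars; simp [MemInstr.apply, h1, ← List.replicate_succ']
    · obtain ⟨i, rfl, h1⟩ := hx
      obtain ⟨-, rfl⟩ := hv
      subst_vars
      refine ⟨i + 1, ?_, ?_⟩
      · rw [h1, ← List.replicate_add]
        congr 1; ring
      · simp [MemInstr.apply, h1, Nat.mul_add]
    · obtain ⟨i, w, hw, rfl⟩ := hx
      subst hv
      exact ⟨i, w ++ [d], by simpa [Nat.even_add_one] using hw, by simp⟩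
    · obtain ⟨i, w, hw, rfl⟩ := hx
      subst hv
      exact ⟨i, w ++ [d], by simpa [Nat.even_add_one] using hw, by simp⟩
    all_goals trivial
  · exact ⟨v, hi, trivial⟩

theorem growthAutomaton_language_le {A : Type*} (a b : A) :
    (growthAutomaton a b).language ≤ growthLanguage a b := by
  rintro x ⟨c, h, hi, hf⟩
  have : ∃ y, x = y ++ c.input ∧ GrowthInvariant a b y c.mem c.state := by
    clear hi hf
    induction h with
    | refl => exact ⟨[], rfl, 0, by simp, by simp [TMFA.init]⟩
    | tail _ hs ih =>
      obtain ⟨y, rfl, hy⟩ := ih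
      obtain ⟨z, hz, h⟩ := hy.step hs
      exact ⟨y ++ z, by rw [hz, List.append_assoc], h⟩
  obtain ⟨y, rfl, hy⟩ := this
  rw [hi, List.append_nil]
  obtain ⟨q, inp, mem⟩ := c
  rcases hf with hf | hf
  · simp only at hf
    subst hf
    obtain ⟨i, h, -⟩ := hy
    exact Or.inl ⟨i, h⟩
  · change q = GrowthState.evenTail at hf
    subst hf
    exact Or.inr hy

theorem growthAutomaton_steps_copied {A : Type*} (a b : A) (i : ℕ) (x : List A)
    {mem : Fin 2 → List A × MemStatus} (h0 : (mem 0).1 = List.replicate (2 * i) a) :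
    ∃ mem', mem' 1 = (List.replicate (2 * i) a, .opened) ∧ (growthAutomaton a b).Step
      ⟨GrowthState.loop, List.replicate (2 * i) a ++ x, mem⟩ ⟨GrowthState.copied, x, mem'⟩ := by
  refine ⟨_, ?_, TMFA.Step.move growthAutomaton_loop ⟨rfl, h0.symm⟩⟩
  simp [MemInstr.apply]

theorem growthAutomaton_steps_loop {A : Type*} (a b : A) (i : ℕ) (x : List A)
    {mem : Fin 2 → List A × MemStatus} (h0 : (mem 0).1 = List.replicate (2 * i) a) :
    ∃ mem', (mem' 0).1 = List.replicate (2 * (i + 1)) a ∧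
      Relation.ReflTransGen (growthAutomaton a b).Step
        ⟨GrowthState.loop, List.replicate (4 * (i + 1)) a ++ x, mem⟩ ⟨GrowthState.loop, x, mem'⟩ := by
  obtain ⟨mem₁, h₁, hs₁⟩ := growthAutomaton_steps_copied a b i
    (a :: a :: (List.replicate (2 * (i + 1)) a ++ x)) h0
  have hs₂ : (growthAutomaton a b).Step
      ⟨GrowthState.copied, [a] ++ a :: (List.replicate (2 * (i + 1)) a ++ x), mem₁⟩ _ :=
    TMFA.Step.move growthAutomaton_copied rfl
  have hs₃ : (growthAutomaton a b).Step
      ⟨GrowthState.added, [a] ++ (List.replicate (2 * (i + 1)) a ++ x),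
        fun i => MemInstr.unchanged.apply [a] (mem₁ i)⟩ _ :=
    TMFA.Step.move growthAutomaton_added rfl
  have hs₄ : (growthAutomaton a b).Step
      ⟨GrowthState.ready, List.replicate (2 * (i + 1)) a ++ x, fun i =>
        MemInstr.unchanged.apply [a] (MemInstr.unchanged.apply [a] (mem₁ i))⟩ _ :=
    TMFA.Step.move growthAutomaton_ready
      ⟨rfl, by simp [h₁, MemInstr.apply, ← List.replicate_succ', Nat.mul_add]⟩
  have he : List.replicate (4 * (i + 1)) a ++ x = List.replicate (2 * i) a ++
      (a :: a :: (List.replicate (2 * (i + 1)) a ++ x)) := by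
    have : 4 * (i + 1) = 2 * i + (1 + (1 + 2 * (i + 1))) := by ring
    rw [this, List.replicate_add, List.replicate_add, List.replicate_add]
    simp
  rw [he]
  exact ⟨_, by simp [MemInstr.apply],
    ((Relation.ReflTransGen.single hs₁).tail hs₂).tail hs₃ |>.tail hs₄⟩

theorem growthAutomaton_reaches_loop {A : Type*} (a b : A) (i : ℕ) : ∀ x : List A,
    ∃ mem, (mem 0).1 = List.replicate (2 * i) a ∧
      Relation.ReflTransGen (growthAutomaton a b).Step
        ((growthAutomaton a b).init (List.replicate (2 * i * (i + 1)) a ++ x))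
        ⟨GrowthState.loop, x, mem⟩ := by
  induction i with
  | zero => exact fun x => ⟨fun _ => ([], .closed), rfl, .refl⟩
  | succ i ih =>
    intro x
    obtain ⟨mem, hm, h⟩ := ih (List.replicate (4 * (i + 1)) a ++ x)
    obtain ⟨mem', hm', h'⟩ := growthAutomaton_steps_loop a b i x hm
    refine ⟨mem', hm', ?_⟩
    rw [← List.append_assoc, ← List.replicate_add] at h
    have : 2 * (i + 1) * (i + 1 + 1) = 2 * i * (i + 1) + 4 * (i + 1) := by ring
    rw [this]
    exact h.trans h'

theorem growthAutomaton_steps_tail {A : Type*} (a b : A) (w : List A) : ∀ mem,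
    (Even w.length → ∃ mem', Relation.ReflTransGen (growthAutomaton a b).Step
      ⟨GrowthState.evenTail, w, mem⟩ ⟨GrowthState.evenTail, [], mem'⟩) ∧
    (¬ Even w.length → ∃ mem', Relation.ReflTransGen (growthAutomaton a b).Step
      ⟨GrowthState.oddTail, w, mem⟩ ⟨GrowthState.evenTail, [], mem'⟩) := by
  induction w with
  | nil => exact fun mem => ⟨fun _ => ⟨mem, .refl⟩, by simp⟩
  | cons d w ih =>
    intro mem
    obtain ⟨h₁, h₂⟩ := ih (fun i => MemInstr.unchanged.apply [d] (mem i))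
    simp only [List.length_cons, Nat.even_add_one, not_not]
    refine ⟨fun h => (h₂ h).imp fun _ hs => .head ?_ hs, fun h => (h₁ h).imp fun _ hs => .head ?_ hs⟩
    all_goals exact TMFA.Step.move (b := .letter d) (v := [d]) (Set.mem_singleton _) rfl

theorem growthAutomaton_language {A : Type*} {a b : A} (hab : a ≠ b) :
    (growthAutomaton a b).language = growthLanguage a b := by
  refine le_antisymm (growthAutomaton_language_le a b) ?_
  rintro x (⟨i, rfl⟩ | ⟨i, w, hw, rfl⟩)
  · obtain ⟨mem, -, h⟩ := growthAutomaton_reaches_loop a b i []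
    rw [List.append_nil] at h
    exact ⟨_, h, rfl, Or.inl rfl⟩
  · obtain ⟨mem, hm, h⟩ := growthAutomaton_reaches_loop a b i
      (List.replicate (2 * i) a ++ b :: w)
    obtain ⟨mem₁, -, h₁⟩ := growthAutomaton_steps_copied a b i (b :: w) hm
    have h₂ : (growthAutomaton a b).Step ⟨GrowthState.copied, [b] ++ w, mem₁⟩ _ :=
      TMFA.Step.move (growthAutomaton_copied_tail hab) rfl
    obtain ⟨mem₃, h₃⟩ := (growthAutomaton_steps_tail a b w
      (fun i => MemInstr.unchanged.apply [b] (mem₁ i))).1 hw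
    have he : List.replicate (2 * i * (i + 2)) a ++ b :: w = List.replicate (2 * i * (i + 1)) a ++
        (List.replicate (2 * i) a ++ b :: w) := by
      rw [← List.append_assoc, ← List.replicate_add]
      congr 2
    rw [he]
    exact ⟨_, ((h.tail h₁).tail h₂).trans h₃, rfl, Or.inr rfl⟩

theorem growthLanguage_mem_dtmfaRejLanguages {A : Type*} {a b : A} (hab : a ≠ b) :
    growthLanguage a b ∈ dtmfaRejLanguages A :=
  ⟨2, _, growthAutomaton_deterministic a b, growthAutomaton_rejecting a b,
    growthAutomaton_language hab⟩

/-! ### Deterministic memory automata: failure of closure -/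

section

variable {A : Type*} {a b : A}

theorem replicate_mem_growthLanguage (hab : a ≠ b) {n : ℕ} :
    List.replicate n a ∈ growthLanguage a b ↔ ∃ i, n = 2 * i * (i + 1) := by
  constructor
  · rintro (⟨i, h⟩ | ⟨i, w, -, h⟩)
    · exact ⟨i, by simpa using congrArg List.length h⟩
    · have hb : b ∈ List.replicate n a := by rw [h]; simp
      exact (hab (List.eq_of_mem_replicate hb).symm).elim
  · rintro ⟨i, rfl⟩
    exact Or.inl ⟨i, rfl⟩

/-- Parity separates the two kinds of words: the powers of `a` have even length. Thus words of odd
length can be added below without disturbing the powers of `a`. -/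
theorem odd_length_of_mem_growthLanguage {x : List A} (hx : x ∈ growthLanguage a b)
    (hb : b ∈ x) (hab : a ≠ b) : Odd x.length := by
  rcases hx with ⟨i, rfl⟩ | ⟨i, w, hw, rfl⟩
  · exact (hab (List.eq_of_mem_replicate hb).symm).elim
  · have : (List.replicate (2 * i * (i + 2)) a ++ b :: w).length
        = 2 * (i * (i + 2)) + (w.length + 1) := by simp; ring
    rw [this]
    exact (even_two_mul _).add_odd hw.add_one

theorem mem_growthLanguage_of_even {x : List A} (hab : a ≠ b) (hx : x ∈ growthLanguage a b)
    (he : Even x.length) : ∃ i, x = List.replicate (2 * i * (i + 1)) a := by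
  by_cases hb : b ∈ x
  · exact (Nat.not_even_iff_odd.2 (odd_length_of_mem_growthLanguage hx hb hab) he).elim
  · rcases hx with h | ⟨i, w, hw, rfl⟩
    · exact h
    · simp at hb

/-- The gap `4 * (l + 1)` between consecutive exponents `2 * l * (l + 1)` grows with `l`, so the gap
after the exponent of `i` does not lead from the exponent of a larger `j` to another one. Only even
`n` are considered because some of the languages below contain further words of odd length. -/
theorem infinite_range_leftQuotient {L : Language A} (c : List A)
    (h : ∀ n, Even n → (c ++ List.replicate n a ∈ L ↔ ∃ i, n = 2 * i * (i + 1))) :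
    ¬ (Set.range L.leftQuotient).Finite := by
  intro hfin
  have hmaps : Set.MapsTo (fun i => L.leftQuotient (c ++ List.replicate (2 * i * (i + 1)) a))
      (Set.univ : Set ℕ) (Set.range L.leftQuotient) := fun i _ => ⟨_, rfl⟩
  obtain ⟨i, -, j, -, hne, hij⟩ :=
    Set.infinite_univ.exists_ne_map_eq_of_mapsTo hmaps hfin
  wlog hlt : i < j generalizing i j
  · exact this j i hne.symm hij.symm (by omega)
  have key : ∀ l, List.replicate (4 * (i + 1)) a ∈
      L.leftQuotient (c ++ List.replicate (2 * l * (l + 1)) a) ↔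
      ∃ m, 2 * l * (l + 1) + 4 * (i + 1) = 2 * m * (m + 1) := by
    intro l
    rw [Language.mem_leftQuotient, List.append_assoc, ← List.replicate_add]
    exact h _ (((even_two_mul l).mul_right _).add ((by decide : Even 4).mul_right _))
  have h1 := (key i).2 ⟨i + 1, by ring⟩
  have hij' := hij ▸ h1
  rw [key j] at hij'
  obtain ⟨m, hm⟩ := hij'
  rcases Nat.lt_or_ge j m with hjm | hjm
  · have : 2 * (j + 1) * (j + 1 + 1) ≤ 2 * m * (m + 1) := by gcongr <;> omega
    nlinarith
  · have : 2 * m * (m + 1) ≤ 2 * j * (j + 1) := by gcongr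
    omega

theorem finite_range_leftQuotient_compl {L : Language A}
    (h : (Set.range Lᶜ.leftQuotient).Finite) : (Set.range L.leftQuotient).Finite := by
  refine (h.image compl).subset ?_
  rintro _ ⟨x, rfl⟩
  exact ⟨_, ⟨x, rfl⟩, compl_compl _⟩

/-- The words of odd length. -/
def oddLanguage (A : Type*) : Language A := {x | Odd x.length}

/-- The words of odd length that end in `b`. -/
def oddEndingLanguage (b : A) : Language A := {x | Odd x.length ∧ x.getLast? = some b}

theorem isRegular_oddLanguage (A : Type*) [Finite A] : (oddLanguage A).IsRegular := by
  refine .of_finite_range_leftQuotient (Set.finite_range_of_factor _ (fun x => Odd x.length) ?_)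
  intro x y h
  ext w
  simp only [eq_iff_iff] at h
  change Odd (x ++ w).length ↔ Odd (y ++ w).length
  simp [Nat.odd_add, h]

theorem isRegular_oddEndingLanguage [Finite A] (b : A) : (oddEndingLanguage b).IsRegular := by
  refine .of_finite_range_leftQuotient (Set.finite_range_of_factor _
    (fun x => (Odd x.length, x.getLast? = some b)) ?_)
  intro x y h
  ext w
  simp only [Prod.mk.injEq, eq_iff_iff] at h
  change Odd (x ++ w).length ∧ (x ++ w).getLast? = some b ↔
    Odd (y ++ w).length ∧ (y ++ w).getLast? = some b
  rw [List.getLast?_append, List.getLast?_append]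
  cases hw : w.getLast? <;> simp [Nat.odd_add, h]

theorem nil_mem_growthLanguage : [] ∈ growthLanguage a b := Or.inl ⟨0, rfl⟩

theorem cons_mem_growthLanguage {w : List A} (hw : Even w.length) :
    b :: w ∈ growthLanguage a b := Or.inr ⟨0, w, hw, rfl⟩

theorem exists_even_append (a : A) (p : List A) :
    ∃ t : List A, t.length < 2 ∧ Even (p ++ t).length := by
  rcases Nat.even_or_odd p.length with h | h
  · exact ⟨[], by simp, by simpa using h⟩
  · exact ⟨[a], by simp, by simpa [Nat.even_add_one] using h⟩

/-- One of `p ++ [a]` and `p ++ [a, a]` is always outside `growthLanguage a b`, since words with `b`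
have odd length and words without `b` have even length. -/
theorem not_closedUnderComplement_dtmfaRejLanguages [Finite A] (hab : a ≠ b) :
    ¬ ClosedUnderComplement (dtmfaRejLanguages A) := by
  intro h
  refine TMFA.not_mem_dtmfaRejLanguages (N := 3) (by norm_num) (.of_short fun p _ => ?_) ?_
    (h _ (growthLanguage_mem_dtmfaRejLanguages hab))
  · by_contra! hc
    have h1 := not_not.1 (hc [a] (by simp) (by simp))
    have h2 := not_not.1 (hc [a, a] (by simp) (by simp))
    by_cases hb : b ∈ p
    · have h3 := odd_length_of_mem_growthLanguage h1 (by simp [hb]) hab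
      have h4 := odd_length_of_mem_growthLanguage h2 (by simp [hb]) hab
      simp only [List.length_append, List.length_cons, List.length_nil] at h3 h4
      rcases h3 with ⟨_, _⟩
      rcases h4 with ⟨_, _⟩
      omega
    · rcases h1 with ⟨i, h1⟩ | ⟨i, w, -, h1⟩
      · rcases h2 with ⟨j, h2⟩ | ⟨j, w, -, h2⟩
        · have h3 := congrArg List.length h1
          have h4 := congrArg List.length h2
          simp only [List.length_append, List.length_cons, List.length_nil,
            List.length_replicate, Nat.mul_assoc] at h3 h4
          omega
        · have : b ∈ p ++ [a, a] := by rw [h2]; simp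
          simp [hb, hab.symm] at this
      · have : b ∈ p ++ [a] := by rw [h1]; simp
        simp [hb, hab.symm] at this
  · intro hf
    exact infinite_range_leftQuotient (a := a) []
      (fun n _ => replicate_mem_growthLanguage hab) (finite_range_leftQuotient_compl hf)

/-- One or two letters complete any `p` to odd length, while the powers of `a` of even length in the
union still come from `growthLanguage a b` alone. -/
theorem not_closedUnderUnion_dtmfaRejLanguages [Finite A] (hab : a ≠ b) :
    ¬ ClosedUnderUnion (dtmfaRejLanguages A) := by
  intro h
  refine TMFA.not_mem_dtmfaRejLanguages (N := 3) (by norm_num) (.of_short fun p _ => ?_) ?_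
    (h _ (growthLanguage_mem_dtmfaRejLanguages hab) _ (isRegular_oddLanguage A).mem_dtmfaRejLanguages)
  · obtain ⟨t, ht, he⟩ := exists_even_append a p
    refine ⟨t ++ [a], by simp, by simp; omega, Or.inr ?_⟩
    change Odd (p ++ (t ++ [a])).length
    rw [← List.append_assoc, List.length_append]
    exact he.add_one
  · refine infinite_range_leftQuotient (a := a) [] fun n hn => ?_
    rw [List.nil_append, Language.mem_add, replicate_mem_growthLanguage hab, or_iff_left]
    intro (ho : Odd _)
    rw [List.length_replicate] at ho
    exact Nat.not_even_iff_odd.2 ho hn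

/-- Short continuations lead to words of odd length ending in `b`, with the empty word as second
factor. After the prefix `b`, the set of exponents reappears. -/
theorem not_closedUnderConcatenation_dtmfaRejLanguages [Finite A] (hab : a ≠ b) :
    ¬ ClosedUnderConcatenation (dtmfaRejLanguages A) := by
  intro h
  refine TMFA.not_mem_dtmfaRejLanguages (N := 3) (by norm_num) (.of_short fun p _ => ?_) ?_
    (h _ (isRegular_oddEndingLanguage b).mem_dtmfaRejLanguages
      _ (growthLanguage_mem_dtmfaRejLanguages hab))
  · obtain ⟨t, ht, he⟩ := exists_even_append a p
    refine ⟨t ++ [b], by simp, by simp; omega, ?_⟩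
    refine ⟨p ++ (t ++ [b]), ⟨?_, by simp⟩, [], nil_mem_growthLanguage, by simp⟩
    rw [← List.append_assoc, List.length_append]
    exact he.add_one
  · refine infinite_range_leftQuotient (a := a) [b] fun n hn => ?_
    constructor
    · rintro ⟨u, ⟨hu, hl⟩, v, hv, huv⟩
      simp only at huv
      have hlen := congrArg List.length huv
      simp only [List.length_append, List.length_cons, List.length_nil,
        List.length_replicate] at hlen
      have hve : Even v.length := by
        obtain ⟨m, hm⟩ := hn
        obtain ⟨l, hl⟩ := hu
        exact ⟨m - l, by omega⟩
      obtain ⟨i, rfl⟩ := mem_growthLanguage_of_even hab hv hve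
      refine ⟨i, ?_⟩
      rw [List.length_replicate] at hlen
      rcases u with _ | ⟨c, u⟩
      · simp at hl
      simp only [List.cons_append, List.nil_append, List.cons.injEq] at huv
      -- In `b` followed by a power of `a`, the first factor ends in `b` and is therefore the single
      -- letter `b`.
      rcases List.eq_nil_or_concat u with rfl | ⟨u', d, rfl⟩
      · simp at hlen; omega
      · have hd : d = b := by simpa [List.getLast?_cons] using hl
        have : b ∈ List.replicate n a := by rw [← huv.2, hd]; simp
        exact (hab (List.eq_of_mem_replicate this).symm).elim
    · rintro ⟨i, rfl⟩
      exact ⟨[b], ⟨by simp, by simp⟩, _, Or.inl ⟨i, rfl⟩, rfl⟩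

/-- The words `b :: w` with `w` of even length turn into all words of odd length that end in `b`,
and these provide short continuations. -/
theorem not_closedUnderReversal_dtmfaRejLanguages [Finite A] (hab : a ≠ b) :
    ¬ ClosedUnderReversal (dtmfaRejLanguages A) := by
  intro h
  refine TMFA.not_mem_dtmfaRejLanguages (N := 3) (by norm_num) (.of_short fun p _ => ?_) ?_
    (h _ (growthLanguage_mem_dtmfaRejLanguages hab))
  · obtain ⟨t, ht, he⟩ := exists_even_append a p
    refine ⟨t ++ [b], by simp, by simp; omega, ?_⟩
    rw [← List.append_assoc, Language.mem_reverse, List.reverse_concat']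
    exact cons_mem_growthLanguage (by rwa [List.length_reverse])
  · refine infinite_range_leftQuotient (a := a) [] fun n hn => ?_
    rw [List.nil_append, Language.mem_reverse, List.reverse_replicate,
      replicate_mem_growthLanguage hab]

theorem flatMap_const_singleton (a : A) (u : List A) :
    u.flatMap (fun _ => [a]) = List.replicate u.length a := by
  induction u with
  | nil => rfl
  | cons c u ih => simp [ih, List.replicate_succ]

/-- When every letter is mapped to `a`, the words with `b` become all odd powers of `a`, and the
even powers in the image stem from words without `b`. -/
theorem not_closedUnderHomomorphism_dtmfaRejLanguages [Finite A] (hab : a ≠ b) :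
    ¬ ClosedUnderHomomorphism (dtmfaRejLanguages A) := by
  intro h
  refine TMFA.not_mem_dtmfaRejLanguages (N := 3) (by norm_num) (.of_short fun p hp => ?_) ?_
    (h (fun _ => [a]) _ (growthLanguage_mem_dtmfaRejLanguages hab))
  · obtain ⟨s, u, hu, hps⟩ := hp
    rw [flatMap_const_singleton] at hps
    have hpr : p = List.replicate p.length a := by
      refine List.eq_replicate_of_mem fun c hc => ?_
      have : c ∈ p ++ s := by simp [hc]
      rw [← hps] at this
      exact List.eq_of_mem_replicate this
    have hodd : ∀ n, Even n → p ++ List.replicate (n + 1 - p.length) a = List.replicate (n + 1) a →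
        p ++ List.replicate (n + 1 - p.length) a ∈
          ({w | ∃ u ∈ growthLanguage a b, u.flatMap (fun _ => [a]) = w} : Language A) := by
      intro n hn hp
      exact ⟨b :: List.replicate n a, cons_mem_growthLanguage (by simpa using hn),
        by rw [flatMap_const_singleton, hp]; simp⟩
    have hcat : ∀ n, p.length < n + 1 →
        p ++ List.replicate (n + 1 - p.length) a = List.replicate (n + 1) a := by
      intro n hn
      conv_lhs => rw [hpr]
      rw [List.length_replicate, ← List.replicate_add]
      congr 1
      omega
    rcases Nat.even_or_odd p.length with he | ho
    · exact ⟨_, by simp, by simp, hodd _ he (hcat _ (by omega))⟩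
    · exact ⟨_, by simp; omega, by simp; omega, hodd _ ho.add_one (hcat _ (by omega))⟩
  · refine infinite_range_leftQuotient (a := a) [] fun n hn => ?_
    constructor
    · rintro ⟨u, hu, hun⟩
      rw [flatMap_const_singleton, List.nil_append] at hun
      have hlen : u.length = n := by simpa using congrArg List.length hun
      obtain ⟨i, rfl⟩ := mem_growthLanguage_of_even hab hu (hlen.symm ▸ hn)
      exact ⟨i, by simpa using hlen.symm⟩
    · rintro ⟨i, rfl⟩
      exact ⟨_, Or.inl ⟨i, rfl⟩, by rw [flatMap_const_singleton]; simp⟩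

/-- When every letter is mapped to `a`, the preimage is given by a condition on the length alone, so
a continuation can start with a letter other than the first letter of `v`. -/
theorem not_closedUnderInverseHomomorphism_dtmfaRejLanguages [Finite A] (hab : a ≠ b) :
    ¬ ClosedUnderInverseHomomorphism (dtmfaRejLanguages A) := by
  intro h
  have hmem : ∀ u : List A, u ∈ ({u | u.flatMap (fun _ => [a]) ∈ growthLanguage a b} : Language A) ↔
      ∃ i, u.length = 2 * i * (i + 1) := by
    intro u
    change u.flatMap _ ∈ growthLanguage a b ↔ _
    rw [flatMap_const_singleton, replicate_mem_growthLanguage hab]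
  refine TMFA.not_mem_dtmfaRejLanguages (N := 1) le_rfl ?_ ?_
    (h (fun _ => [a]) _ (growthLanguage_mem_dtmfaRejLanguages hab))
  · intro p v hv _
    have : ∃ d, v.head? ≠ some d := by
      by_contra! hc
      exact hab (Option.some.inj ((hc a).symm.trans (hc b)))
    obtain ⟨d, hd⟩ := this
    -- The index `p.length + 1` merely provides an admissible length greater than that of `p`.
    have hlt : p.length < 2 * (p.length + 1) * (p.length + 1 + 1) := by nlinarith
    obtain ⟨m, hm⟩ := Nat.exists_eq_add_of_lt hlt
    refine ⟨List.replicate (m + 1) d, by simp, (hmem _).2 ⟨p.length + 1, ?_⟩, ?_⟩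
    · rw [hm]; simp; ring
    · rintro ⟨t, ht⟩
      rcases v with _ | ⟨c, v⟩
      · simp at hv
      · simp [List.replicate_succ] at ht
        simp [ht.1] at hd
  · refine infinite_range_leftQuotient (a := a) [] fun n hn => ?_
    refine (hmem _).trans ?_
    simp

end

/-! ### Marked ref-words -/

/-- The letter is a terminal or a variable reference. -/
def RefSym.consumes {A X : Type*} : RefSym A X → Bool
  | .term _ => true
  | .ref _ => true
  | .opn _ => false
  | .cls _ => false

section Words

variable {A X : Type*}

theorem RefSym.isBracket_iff {c : RefSym A X} : c.IsBracket ↔ c.consumes = false := by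
  cases c <;> simp [RefSym.IsBracket, RefSym.consumes]

theorem RefSym.isTermOrRef_iff {c : RefSym A X} : c.IsTermOrRef ↔ c.consumes = true := by
  cases c <;> simp [RefSym.IsTermOrRef, RefSym.consumes]

/-- The number of terminals and references in a marked ref-word. -/
def consumeCount (t : List (RefSym A X × ℕ)) : ℕ := t.countP (fun c => c.1.consumes)

@[simp] theorem consumeCount_nil : consumeCount ([] : List (RefSym A X × ℕ)) = 0 := rfl

@[simp] theorem consumeCount_append (s t : List (RefSym A X × ℕ)) :
    consumeCount (s ++ t) = consumeCount s + consumeCount t := List.countP_append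

theorem consumeCount_cons (c : RefSym A X × ℕ) (t : List (RefSym A X × ℕ)) :
    consumeCount (c :: t) = consumeCount t + if c.1.consumes then 1 else 0 := List.countP_cons

theorem consumeCount_eq_zero {t : List (RefSym A X × ℕ)} :
    consumeCount t = 0 ↔ ∀ c ∈ t, c.1.IsBracket := by
  simp [consumeCount, List.countP_eq_zero, RefSym.isBracket_iff]

theorem exists_first_consuming {t : List (RefSym A X × ℕ)} (h : consumeCount t ≠ 0) :
    ∃ γ c s, (∀ d ∈ γ, d.1.IsBracket) ∧ c.1.consumes = true ∧ t = γ ++ c :: s := by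
  induction t with
  | nil => exact (h rfl).elim
  | cons d t ih =>
    by_cases hd : d.1.consumes = true
    · exact ⟨[], d, t, by simp, hd, rfl⟩
    · obtain ⟨γ, c, s, h1, h2, rfl⟩ := ih (by simpa [consumeCount_cons, hd] using h)
      refine ⟨d :: γ, c, s, ?_, h2, rfl⟩
      simpa [RefSym.isBracket_iff, hd] using h1

theorem List.exists_common_prefix {α : Type*} (l₁ l₂ : List α) : ∃ q t₁ t₂, l₁ = q ++ t₁ ∧
    l₂ = q ++ t₂ ∧ (t₁ = [] ∨ t₂ = [] ∨ t₁.head? ≠ t₂.head?) := by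
  induction l₁ generalizing l₂ with
  | nil => exact ⟨[], [], l₂, rfl, rfl, Or.inl rfl⟩
  | cons c l₁ ih =>
    rcases l₂ with _ | ⟨d, l₂⟩
    · exact ⟨[], c :: l₁, [], rfl, rfl, Or.inr (Or.inl rfl)⟩
    by_cases h : c = d
    · subst h
      obtain ⟨q, t₁, t₂, rfl, rfl, h⟩ := ih l₂
      exact ⟨c :: q, t₁, t₂, rfl, rfl, h⟩
    · exact ⟨[], _, _, rfl, rfl, Or.inr (Or.inr (by simpa using h))⟩

theorem List.append_cons_eq_append {α : Type*} {r s u v : List α} {c : α}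
    (h : r ++ c :: s = u ++ v) : (∃ s', u = r ++ c :: s' ∧ s = s' ++ v) ∨
      ∃ r', r = u ++ r' ∧ v = r' ++ c :: s := by
  rcases List.append_eq_append_iff.1 h with ⟨t, rfl, ht⟩ | ⟨t, rfl, ht⟩
  · rcases t with _ | ⟨d, t⟩
    · exact Or.inr ⟨[], by simp, by simpa using ht.symm⟩
    · simp only [List.cons_append, List.cons.injEq] at ht
      exact Or.inl ⟨t, by rw [ht.1], ht.2⟩
  · exact Or.inr ⟨t, rfl, ht⟩

theorem List.append_cons_eq_flatten {α : Type*} {L : List (List α)} {r s : List α} {c : α}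
    (h : r ++ c :: s = L.flatten) : ∃ P x y Q, L = P ++ (x ++ c :: y) :: Q ∧
      r = P.flatten ++ x ∧ s = y ++ Q.flatten := by
  induction L generalizing r with
  | nil => simp at h
  | cons u L ih =>
    rw [List.flatten_cons] at h
    rcases List.append_cons_eq_append h with ⟨s', rfl, rfl⟩ | ⟨r', rfl, hr⟩
    · exact ⟨[], r, s', L, rfl, by simp, rfl⟩
    · obtain ⟨P, x, y, Q, rfl, rfl, rfl⟩ := ih hr.symm
      exact ⟨u :: P, x, y, Q, rfl, by simp, rfl⟩

theorem Language.mem_mul_kstar_iff {α : Type*} {S : Language α} {w : List α} :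
    w ∈ S * KStar.kstar S ↔ ∃ L : List (List α), L ≠ [] ∧ w = L.flatten ∧ ∀ y ∈ L, y ∈ S := by
  constructor
  · rintro ⟨u, hu, v, hv, rfl⟩
    obtain ⟨L, rfl, hL⟩ := Language.mem_kstar.1 hv
    exact ⟨u :: L, by simp, by simp, by simpa using ⟨hu, hL⟩⟩
  · rintro ⟨L, hL, rfl, h⟩
    rcases L with _ | ⟨u, L⟩
    · exact (hL rfl).elim
    · simp only [List.mem_cons, forall_eq_or_imp] at h
      exact ⟨u, h.1, L.flatten, Language.join_mem_kstar h.2, by simp⟩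

end Words

/-! ### Local languages -/

/-- The letters that occur in the words of a language. -/
def Language.letters {α : Type*} (S : Language α) : Set α := {c | ∃ w ∈ S, c ∈ w}

/-- What may follow a letter in a word of the language does not depend on what precedes it. -/
def Language.IsLocal {α : Type*} (S : Language α) : Prop :=
  ∀ r₁ r₂ s₁ s₂ : List α, ∀ c, r₁ ++ c :: s₁ ∈ S → r₂ ++ c :: s₂ ∈ S → r₁ ++ c :: s₂ ∈ S

theorem Language.IsLocal.mul {α : Type*} {S T : Language α} (hS : S.IsLocal) (hT : T.IsLocal)
    (hd : Disjoint S.letters T.letters) : (S * T).IsLocal := by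
  rintro r₁ r₂ s₁ s₂ c ⟨u₁, hu₁, v₁, hv₁, h₁⟩ ⟨u₂, hu₂, v₂, hv₂, h₂⟩
  rw [Set.disjoint_left] at hd
  simp only at h₁ h₂
  rcases List.append_cons_eq_append h₁.symm with ⟨s₁', rfl, rfl⟩ | ⟨r₁', rfl, rfl⟩ <;>
  rcases List.append_cons_eq_append h₂.symm with ⟨s₂', rfl, rfl⟩ | ⟨r₂', rfl, rfl⟩
  · exact ⟨_, hS _ _ _ _ _ hu₁ hu₂, v₂, hv₂, by simp⟩
  · exact (@hd c ⟨_, hu₁, by simp⟩ ⟨_, hv₂, by simp⟩).elim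
  · exact (@hd c ⟨_, hu₂, by simp⟩ ⟨_, hv₁, by simp⟩).elim
  · exact ⟨u₁, hu₁, _, hT _ _ _ _ _ hv₁ hv₂, by simp⟩

theorem Language.IsLocal.add {α : Type*} {S T : Language α} (hS : S.IsLocal) (hT : T.IsLocal)
    (hd : Disjoint S.letters T.letters) : (S + T).IsLocal := by
  rw [Set.disjoint_left] at hd
  rintro r₁ r₂ s₁ s₂ c (h₁ | h₁) (h₂ | h₂)
  · exact Or.inl (hS _ _ _ _ _ h₁ h₂)
  · exact (@hd c ⟨_, h₁, by simp⟩ ⟨_, h₂, by simp⟩).elim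
  · exact (@hd c ⟨_, h₂, by simp⟩ ⟨_, h₁, by simp⟩).elim
  · exact Or.inr (hT _ _ _ _ _ h₁ h₂)

theorem Language.IsLocal.mul_kstar {α : Type*} {S : Language α} (hS : S.IsLocal) :
    (S * KStar.kstar S).IsLocal := by
  intro r₁ r₂ s₁ s₂ c h₁ h₂
  rw [Language.mem_mul_kstar_iff] at *
  obtain ⟨L₁, -, hL₁, hm₁⟩ := h₁
  obtain ⟨L₂, -, hL₂, hm₂⟩ := h₂
  obtain ⟨P₁, x₁, y₁, Q₁, rfl, rfl, rfl⟩ := List.append_cons_eq_flatten hL₁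
  obtain ⟨P₂, x₂, y₂, Q₂, rfl, rfl, rfl⟩ := List.append_cons_eq_flatten hL₂
  refine ⟨P₁ ++ (x₁ ++ c :: y₂) :: Q₂, by simp, by simp, ?_⟩
  have := hS x₁ x₂ y₁ y₂ c (hm₁ _ (by simp)) (hm₂ _ (by simp))
  intro y hy
  simp only [List.mem_append, List.mem_cons] at hy
  rcases hy with hy | rfl | hy
  · exact hm₁ _ (by simp [hy])
  · exact this
  · exact hm₂ _ (by simp [hy])

theorem Language.isLocal_nil {α : Type*} : ({[]} : Language α).IsLocal := by
  intro r₁ r₂ s₁ s₂ c h₁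
  exact absurd (Set.mem_singleton_iff.1 h₁) (by simp)

theorem Language.isLocal_singleton {α : Type*} (d : α) : ({[d]} : Language α).IsLocal := by
  intro r₁ r₂ s₁ s₂ c h₁ h₂
  have e₁ := Set.mem_singleton_iff.1 h₁
  have e₂ := Set.mem_singleton_iff.1 h₂
  rw [List.append_eq_singleton_iff] at e₁ e₂
  simp at e₁ e₂
  rw [e₁.1, e₁.2.1, e₂.2.2]
  rfl

namespace RegexExpr

variable {A X : Type*}

theorem markedRefLangFrom_mark {α : RegexExpr A X} {n : ℕ} {c : RefSym A X × ℕ}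
    (hc : c ∈ (α.markedRefLangFrom n).letters) : n ≤ c.2 ∧ c.2 < n + α.numOcc := by
  obtain ⟨ρ, hρ, hc⟩ := hc
  induction α generalizing n ρ with
  | eps => rw [Set.mem_singleton_iff.1 hρ] at hc; simp at hc
  | term a => rw [Set.mem_singleton_iff.1 hρ] at hc; simp at hc; simp [hc, numOcc]
  | ref x => rw [Set.mem_singleton_iff.1 hρ] at hc; simp at hc; simp [hc, numOcc]
  | cat α β ihα ihβ =>
    obtain ⟨u, hu, v, hv, rfl⟩ := hρ
    simp only [List.mem_append, numOcc] at hc ⊢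
    rcases hc with hc | hc
    · have := ihα _ hu hc; omega
    · have := ihβ _ hv hc; omega
  | alt α β ihα ihβ =>
    simp only [numOcc]
    rcases hρ with hρ | hρ
    · have := ihα _ hρ hc; omega
    · have := ihβ _ hρ hc; omega
  | plus α ih =>
    obtain ⟨L, -, rfl, hL⟩ := Language.mem_mul_kstar_iff.1 hρ
    obtain ⟨u, hu, hc⟩ := List.mem_flatten.1 hc
    exact ih _ (hL u hu) hc
  | bind x α ih =>
    obtain ⟨u', ⟨o, ho, u, hu, rfl⟩, e, he, rfl⟩ := hρ
    rw [Set.mem_singleton_iff.1 ho, Set.mem_singleton_iff.1 he] at hc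
    simp only [List.mem_append, List.mem_singleton, numOcc] at hc ⊢
    rcases hc with (rfl | hc) | rfl
    · simp
    · have := ih _ hu hc; omega
    · simp only; omega

theorem disjoint_letters {α β : RegexExpr A X} {n m : ℕ} (h : n + α.numOcc ≤ m) :
    Disjoint (α.markedRefLangFrom n).letters (β.markedRefLangFrom m).letters := by
  rw [Set.disjoint_left]
  intro c h1 h2
  have := markedRefLangFrom_mark h1
  have := markedRefLangFrom_mark h2
  omega

theorem mem_letters_singleton {α : Type*} {c d : α} :
    c ∈ ({[d]} : Language α).letters ↔ c = d := by
  constructor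
  · rintro ⟨w, hw, hc⟩
    rw [Set.mem_singleton_iff.1 hw] at hc
    simpa using hc
  · rintro rfl
    exact ⟨[c], rfl, by simp⟩

theorem mem_letters_mul {α : Type*} {S T : Language α} {c : α} (h : c ∈ (S * T).letters) :
    c ∈ S.letters ∨ c ∈ T.letters := by
  obtain ⟨w, ⟨u, hu, v, hv, rfl⟩, hc⟩ := h
  rcases List.mem_append.1 hc with hc | hc
  · exact Or.inl ⟨u, hu, hc⟩
  · exact Or.inr ⟨v, hv, hc⟩

theorem disjoint_letters_opn (x : X) (α : RegexExpr A X) (n : ℕ) :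
    Disjoint ({[(.opn x, n)]} : Language (RefSym A X × ℕ)).letters
      (α.markedRefLangFrom (n + 1)).letters := by
  rw [Set.disjoint_left]
  intro c h1 h2
  rw [mem_letters_singleton.1 h1] at h2
  have := markedRefLangFrom_mark h2
  simp at this

theorem disjoint_letters_cls (x : X) (α : RegexExpr A X) (n : ℕ) :
    Disjoint (({[(.opn x, n)]} : Language (RefSym A X × ℕ)) * α.markedRefLangFrom (n + 1)).letters
      ({[(.cls x, n + 1 + α.numOcc)]} : Language (RefSym A X × ℕ)).letters := by
  rw [Set.disjoint_left]
  intro c h1 h2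
  rw [mem_letters_singleton.1 h2] at h1
  rcases mem_letters_mul h1 with h1 | h1
  · have := (Prod.ext_iff.1 (mem_letters_singleton.1 h1)).2
    simp at this
    omega
  · have := markedRefLangFrom_mark h1
    simp at this

/-- Every mark belongs to one occurrence in the expression, so the parts of products and sums have
disjoint letters, which is what the closure properties of local languages require. -/
theorem markedRefLangFrom_isLocal (α : RegexExpr A X) (n : ℕ) :
    (α.markedRefLangFrom n).IsLocal := by
  induction α generalizing n with
  | eps => exact Language.isLocal_nil
  | term a => exact Language.isLocal_singleton _
  | ref x => exact Language.isLocal_singleton _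
  | cat α β ihα ihβ => exact (ihα n).mul (ihβ _) (disjoint_letters le_rfl)
  | alt α β ihα ihβ => exact (ihα n).add (ihβ _) (disjoint_letters le_rfl)
  | plus α ih => exact (ih n).mul_kstar
  | bind x α ih =>
    exact ((Language.isLocal_singleton _).mul (ih _) (disjoint_letters_opn x α n)).mul
      (Language.isLocal_singleton _) (disjoint_letters_cls x α n)

theorem symbol_eq_of_mark_eq {α : RegexExpr A X} {n i : ℕ} {c d : RefSym A X}
    (hc : (c, i) ∈ (α.markedRefLangFrom n).letters)
    (hd : (d, i) ∈ (α.markedRefLangFrom n).letters) : c = d := by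
  induction α generalizing n with
  | eps =>
    obtain ⟨w, hw, hc⟩ := hc
    rw [Set.mem_singleton_iff.1 hw] at hc; simp at hc
  | term a =>
    have h1 := mem_letters_singleton.1 hc
    have h2 := mem_letters_singleton.1 hd
    simp_all
  | ref x =>
    have h1 := mem_letters_singleton.1 hc
    have h2 := mem_letters_singleton.1 hd
    simp_all
  | cat α β ihα ihβ =>
    rcases mem_letters_mul hc with hc | hc <;> rcases mem_letters_mul hd with hd | hd
    · exact ihα hc hd
    · have := markedRefLangFrom_mark hc
      have := markedRefLangFrom_mark hd
      simp only at *
      omega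
    · have := markedRefLangFrom_mark hc
      have := markedRefLangFrom_mark hd
      simp only at *
      omega
    · exact ihβ hc hd
  | alt α β ihα ihβ =>
    obtain ⟨u, hu | hu, hc⟩ := hc <;> obtain ⟨v, hv | hv, hd⟩ := hd
    · exact ihα ⟨u, hu, hc⟩ ⟨v, hv, hd⟩
    · have := markedRefLangFrom_mark ⟨u, hu, hc⟩
      have := markedRefLangFrom_mark ⟨v, hv, hd⟩
      simp only at *
      omega
    · have := markedRefLangFrom_mark ⟨u, hu, hc⟩
      have := markedRefLangFrom_mark ⟨v, hv, hd⟩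
      simp only at *
      omega
    · exact ihβ ⟨u, hu, hc⟩ ⟨v, hv, hd⟩
  | plus α ih =>
    have key : ∀ {c : RefSym A X × ℕ}, c ∈ (α.plus.markedRefLangFrom n).letters →
        c ∈ (α.markedRefLangFrom n).letters := by
      rintro c ⟨w, hw, hc⟩
      obtain ⟨L, -, rfl, hL⟩ := Language.mem_mul_kstar_iff.1 hw
      obtain ⟨u, hu, hc⟩ := List.mem_flatten.1 hc
      exact ⟨u, hL u hu, hc⟩
    exact ih (key hc) (key hd)
  | bind x α ih =>
    have key : ∀ {c : RefSym A X}, (c, i) ∈ ((α.bind x).markedRefLangFrom n).letters →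
        (c = .opn x ∧ i = n) ∨ ((c, i) ∈ (α.markedRefLangFrom (n + 1)).letters ∧ n + 1 ≤ i ∧
          i < n + 1 + α.numOcc) ∨ c = .cls x ∧ i = n + 1 + α.numOcc := by
      intro c h
      rcases mem_letters_mul h with h | h
      · rcases mem_letters_mul h with h | h
        · have := mem_letters_singleton.1 h
          simp_all
        · exact Or.inr (Or.inl ⟨h, markedRefLangFrom_mark h⟩)
      · have := mem_letters_singleton.1 h
        simp_all
    rcases key hc with ⟨rfl, h1⟩ | ⟨h1, h2, h3⟩ | ⟨rfl, h1⟩ <;>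
    rcases key hd with ⟨rfl, h4⟩ | ⟨h4, h5, h6⟩ | ⟨rfl, h4⟩ <;>
    first | rfl | exact ih h1 h4 | omega

theorem map_markedRefLangFrom (α : RegexExpr A X) (n : ℕ) :
    (α.markedRefLangFrom n).map Prod.fst = α.refLang := by
  induction α generalizing n with
  | eps => exact Set.image_singleton.trans rfl
  | term a => exact Set.image_singleton.trans rfl
  | ref x => exact Set.image_singleton.trans rfl
  | cat α β ihα ihβ => rw [markedRefLangFrom, refLang, map_mul, ihα, ihβ]
  | alt α β ihα ihβ => rw [markedRefLangFrom, refLang, map_add, ihα, ihβ]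
  | plus α ih => rw [markedRefLangFrom, refLang, map_mul, Language.map_kstar, ih]
  | bind x α ih =>
    rw [markedRefLangFrom, refLang, map_mul, map_mul, ih]
    have : ∀ c : RefSym A X × ℕ, Language.map Prod.fst ({[c]} : Language (RefSym A X × ℕ)) =
      {[c.1]} := fun c => Set.image_singleton.trans rfl
    rw [this, this]

end RegexExpr

namespace Regex

variable {A X : Type*}

theorem mem_language_expr {α : RegexExpr A X} {hα : α.WellFormed} {w : List A} :
    w ∈ (expr α hα).language ↔ ∃ ρ ∈ α.markedRefLangFrom 1, deref (ρ.map Prod.fst) = w := by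
  constructor
  · rintro ⟨r, hr, rfl⟩
    change r ∈ α.refLang at hr
    rw [← α.map_markedRefLangFrom 1] at hr
    obtain ⟨ρ, hρ, rfl⟩ := hr
    exact ⟨ρ, hρ, rfl⟩
  · rintro ⟨ρ, hρ, rfl⟩
    refine ⟨_, ?_, rfl⟩
    change _ ∈ α.refLang
    rw [← α.map_markedRefLangFrom 1]
    exact ⟨ρ, hρ, rfl⟩

/-- Where two marked ref-words of a deterministic regex branch before their ends, they go on, up to
brackets, with different terminals. -/
theorem Deterministic.head_eq_or {α : RegexExpr A X} {hα : α.WellFormed}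
    (hd : (expr α hα).Deterministic) {q t₁ t₂ : List (RefSym A X × ℕ)}
    (h₁ : q ++ t₁ ∈ α.markedRefLangFrom 1) (h₂ : q ++ t₂ ∈ α.markedRefLangFrom 1)
    (n₁ : consumeCount t₁ ≠ 0) (n₂ : consumeCount t₂ ≠ 0) : t₁.head? = t₂.head? ∨
      ∃ γ₁ γ₂ a₁ a₂ i₁ i₂ s₁ s₂, (∀ d ∈ γ₁, d.1.IsBracket) ∧ (∀ d ∈ γ₂, d.1.IsBracket) ∧
        a₁ ≠ a₂ ∧ t₁ = γ₁ ++ (.term a₁, i₁) :: s₁ ∧ t₂ = γ₂ ++ (.term a₂, i₂) :: s₂ := by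
  obtain ⟨γ₁, ⟨c₁, i₁⟩, s₁, hγ₁, hc₁, rfl⟩ := exists_first_consuming n₁
  obtain ⟨γ₂, ⟨c₂, i₂⟩, s₂, hγ₂, hc₂, rfl⟩ := exists_first_consuming n₂
  -- Equal marks after different brackets are excluded by condition (3), different marks with a
  -- reference by (2), and different marks with equal terminals by (1).
  by_cases hi : i₁ = i₂
  · subst hi
    have hc : c₁ = c₂ := RegexExpr.symbol_eq_of_mark_eq (i := i₁) ⟨_, h₁, by simp⟩ ⟨_, h₂, by simp⟩
    subst hc
    by_cases hγ : γ₁ = γ₂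
    · left; rw [hγ]; simp [List.head?_append]
    · exact (hd ⟨_, h₁, _, h₂, q, γ₁, γ₂, hγ₁, hγ₂, Or.inr (Or.inr (Or.inl
        ⟨c₁, i₁, s₁, s₂, RefSym.isTermOrRef_iff.2 hc₁, hγ, by simp, by simp⟩))⟩).elim
  · cases c₁ with
    | opn x => simp [RefSym.consumes] at hc₁
    | cls x => simp [RefSym.consumes] at hc₁
    | ref x =>
      exact (hd ⟨_, h₁, _, h₂, q, γ₁, γ₂, hγ₁, hγ₂, Or.inr (Or.inl
        ⟨x, c₂, i₁, i₂, s₁, s₂, RefSym.isTermOrRef_iff.2 hc₂, hi, by simp, by simp⟩)⟩).elim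
    | term a₁ =>
      cases c₂ with
      | opn x => simp [RefSym.consumes] at hc₂
      | cls x => simp [RefSym.consumes] at hc₂
      | ref x =>
        exact (hd ⟨_, h₂, _, h₁, q, γ₂, γ₁, hγ₂, hγ₁, Or.inr (Or.inl
          ⟨x, _, i₂, i₁, s₂, s₁, RefSym.isTermOrRef_iff.2 hc₁, Ne.symm hi, by simp, by simp⟩)⟩).elim
      | term a₂ =>
        by_cases ha : a₁ = a₂
        · subst ha
          exact (hd ⟨_, h₁, _, h₂, q, γ₁, γ₂, hγ₁, hγ₂, Or.inl
            ⟨a₁, i₁, i₂, s₁, s₂, hi, by simp, by simp⟩⟩).elim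
        · exact Or.inr ⟨γ₁, γ₂, a₁, a₂, i₁, i₂, s₁, s₂, hγ₁, hγ₂, ha, rfl, rfl⟩

theorem Deterministic.eq_of_brackets {α : RegexExpr A X} {hα : α.WellFormed}
    (hd : (expr α hα).Deterministic) {q t₁ t₂ : List (RefSym A X × ℕ)}
    (h₁ : q ++ t₁ ∈ α.markedRefLangFrom 1) (h₂ : q ++ t₂ ∈ α.markedRefLangFrom 1)
    (n₁ : consumeCount t₁ = 0) (n₂ : consumeCount t₂ = 0) : t₁ = t₂ := by
  by_contra hne
  exact hd ⟨_, h₁, _, h₂, q, t₁, t₂, consumeCount_eq_zero.1 n₁, consumeCount_eq_zero.1 n₂,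
    Or.inr (Or.inr (Or.inr ⟨hne, rfl, rfl⟩))⟩

end Regex

/-! ### Dereferencing -/

section Deref

variable {A X : Type*}

/-- The state of the dereferencing pass after a marked ref-word. -/
noncomputable def derefRun (s : DerefState A X) (r : List (RefSym A X × ℕ)) : DerefState A X :=
  (r.map Prod.fst).foldl DerefState.step s

/-- The state in which the dereferencing pass begins. -/
def derefInit (A X : Type*) : DerefState A X := ⟨[], fun _ => 0, fun _ => []⟩

/-- The dereference of a marked ref-word. -/
noncomputable def markedDeref (r : List (RefSym A X × ℕ)) : List A := (derefRun (derefInit A X) r).out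

@[simp] theorem derefRun_nil (s : DerefState A X) : derefRun s [] = s := rfl

@[simp] theorem derefRun_cons (s : DerefState A X) (c : RefSym A X × ℕ)
    (r : List (RefSym A X × ℕ)) : derefRun s (c :: r) = derefRun (s.step c.1) r := rfl

@[simp] theorem derefRun_append (s : DerefState A X) (q r : List (RefSym A X × ℕ)) :
    derefRun s (q ++ r) = derefRun (derefRun s q) r := by
  simp [derefRun]

theorem out_prefix_step (s : DerefState A X) (c : RefSym A X) : s.out <+: (s.step c).out := by
  cases c <;> simp [DerefState.step]

theorem out_prefix_derefRun (s : DerefState A X) (r : List (RefSym A X × ℕ)) :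
    s.out <+: (derefRun s r).out := by
  induction r generalizing s with
  | nil => exact List.prefix_rfl
  | cons c r ih => exact (out_prefix_step s c.1).trans (ih _)

theorem markedDeref_prefix (q r : List (RefSym A X × ℕ)) :
    markedDeref q <+: markedDeref (q ++ r) := by
  rw [markedDeref, markedDeref, derefRun_append]
  exact out_prefix_derefRun _ _

theorem out_step_of_isBracket (s : DerefState A X) {c : RefSym A X} (hc : c.IsBracket) :
    (s.step c).out = s.out := by
  cases c <;> simp [DerefState.step, RefSym.IsBracket] at *

theorem out_derefRun_of_brackets (s : DerefState A X) {γ : List (RefSym A X × ℕ)}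
    (hγ : ∀ c ∈ γ, c.1.IsBracket) : (derefRun s γ).out = s.out := by
  induction γ generalizing s with
  | nil => rfl
  | cons c γ ih =>
    simp only [List.mem_cons, forall_eq_or_imp] at hγ
    rw [derefRun_cons, ih _ hγ.2, out_step_of_isBracket _ hγ.1]

theorem markedDeref_append_brackets (q : List (RefSym A X × ℕ)) {γ : List (RefSym A X × ℕ)}
    (hγ : ∀ c ∈ γ, c.1.IsBracket) : markedDeref (q ++ γ) = markedDeref q := by
  rw [markedDeref, derefRun_append, out_derefRun_of_brackets _ hγ]
  rfl

theorem markedDeref_concat_term (q : List (RefSym A X × ℕ)) (a : A) (i : ℕ) :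
    markedDeref (q ++ [(.term a, i)]) = markedDeref q ++ [a] := by
  simp [markedDeref, DerefState.step]

theorem markedDeref_concat_ref (q : List (RefSym A X × ℕ)) (x : X) (i : ℕ) :
    markedDeref (q ++ [(.ref x, i)]) = markedDeref q ++ (derefRun (derefInit A X) q).val x := by
  simp [markedDeref, DerefState.step]

theorem markedDeref_brackets_term (q s : List (RefSym A X × ℕ)) {γ : List (RefSym A X × ℕ)}
    (hγ : ∀ c ∈ γ, c.1.IsBracket) (a : A) (i : ℕ) :
    markedDeref q ++ [a] <+: markedDeref (q ++ (γ ++ (.term a, i) :: s)) := by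
  have : q ++ (γ ++ (.term a, i) :: s) = (q ++ γ ++ [(.term a, i)]) ++ s := by simp
  rw [this, ← markedDeref_append_brackets q hγ, ← markedDeref_concat_term _ a i]
  exact markedDeref_prefix _ _

end Deref

/-! ### Deterministic regex for languages without forced continuations -/

namespace Regex

variable {A X : Type*} {α : RegexExpr A X} {hα : α.WellFormed}

theorem mem_language_iff_markedDeref {w : List A} :
    w ∈ (expr α hα).language ↔ ∃ ρ ∈ α.markedRefLangFrom 1, markedDeref ρ = w :=
  mem_language_expr

/-- Words with a common prefix arise, up to that prefix, from the same marked ref-word. -/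
theorem Deterministic.prefix_of_markedDeref (hd : (expr α hα).Deterministic)
    {r s ρ : List (RefSym A X × ℕ)} {c : RefSym A X × ℕ} {u : List A}
    (h₁ : r ++ c :: s ∈ α.markedRefLangFrom 1) (hc : c.1.consumes = true)
    (h₂ : ρ ∈ α.markedRefLangFrom 1) (hu : u ≠ []) (hρ : markedDeref ρ = markedDeref r ++ u)
    (ha : ∀ a, c.1 = .term a → u.head? = some a) : r ++ [c] <+: ρ := by
  obtain ⟨q, t₁, t₂, e₁, rfl, hne⟩ := List.exists_common_prefix (r ++ c :: s) ρ
  rcases List.append_cons_eq_append e₁ with ⟨s', rfl, rfl⟩ | ⟨r', rfl, rfl⟩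
  · exact ⟨s' ++ t₂, by simp⟩
  exfalso
  have hq := markedDeref_prefix q r'
  -- The word `ρ` stands for strictly more than `r`, hence for more than `q`, so its rest after `q`
  -- contains more than brackets.
  have n₂ : consumeCount t₂ ≠ 0 := by
    intro h0
    rw [markedDeref_append_brackets q (consumeCount_eq_zero.1 h0)] at hρ
    have h1 := hq.length_le
    rw [hρ, List.length_append] at h1
    have := List.length_pos_iff.2 hu
    omega
  have n₁ : consumeCount (r' ++ c :: s) ≠ 0 := by
    simp [consumeCount_cons, hc]
  rw [e₁] at h₁
  rcases hd.head_eq_or h₁ h₂ n₁ n₂ with h | ⟨γ₁, γ₂, a₁, a₂, i₁, i₂, s₁, s₂, hγ₁, hγ₂, haa, ht₁, ht₂⟩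
  · rcases hne with h0 | h0 | h0
    · simp at h0
    · rw [h0] at n₂; exact n₂ rfl
    · exact h0 h
  · have hp₂ := markedDeref_brackets_term q s₂ hγ₂ a₂ i₂
    rw [← ht₂, hρ] at hp₂
    -- The terminal `a₁` is either `c` itself or lies in `r`. In both cases the word of `ρ`
    -- continues that of `q` with `a₁`, although it was seen to continue with `a₂`.
    rcases List.append_cons_eq_append ht₁ with ⟨s', rfl, -⟩ | ⟨r'', rfl, hr⟩
    · have := hγ₁ c (by simp)
      rw [RefSym.isBracket_iff, hc] at this
      cases this
    · rcases r'' with _ | ⟨d, r''⟩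
      · simp only [List.nil_append, List.cons.injEq] at hr
        rw [List.append_nil, markedDeref_append_brackets q hγ₁, List.prefix_append_right_inj] at hp₂
        have h1 := ha a₁ (by rw [← hr.1])
        obtain ⟨t, rfl⟩ := hp₂
        simp at h1
        exact haa h1.symm
      · simp only [List.cons_append, List.cons.injEq] at hr
        have hp₁ := markedDeref_brackets_term q r'' hγ₁ a₁ i₁
        rw [hr.1] at hp₁
        have h3 := hp₁.trans (List.prefix_append _ u)
        have h4 := List.prefix_of_prefix_length_le h3 hp₂ (by simp)
        have h5 := h4.eq_of_length (by simp)
        simp at h5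
        exact haa h5

/-- By `Deterministic.prefix_of_markedDeref`, every word of the language that properly continues
`markedDeref r` runs through this reference and goes on with its value. `NoJump 1` permits this only
for an empty value. -/
theorem Deterministic.val_eq_nil (hd : (expr α hα).Deterministic)
    (hN : (expr α hα).language.NoJump 1) {r s : List (RefSym A X × ℕ)} {x : X} {i : ℕ}
    (h : r ++ (.ref x, i) :: s ∈ α.markedRefLangFrom 1) :
    (derefRun (derefInit A X) r).val x = [] := by
  by_contra hv
  have hpre : ∀ s, markedDeref r ++ (derefRun (derefInit A X) r).val x <+:
      markedDeref (r ++ (.ref x, i) :: s) := by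
    intro s
    rw [← markedDeref_concat_ref r x i, List.append_cons r _ s]
    exact markedDeref_prefix _ _
  obtain ⟨t, ht⟩ := hpre s
  obtain ⟨u, hu, hm, hnp⟩ := hN (markedDeref r) _ (List.length_pos_iff.2 hv)
    ⟨_, mem_language_iff_markedDeref.2 ⟨_, h, by rw [← ht, List.append_assoc]⟩⟩
  obtain ⟨ρ, hρ, hρu⟩ := mem_language_iff_markedDeref.1 hm
  obtain ⟨s', rfl⟩ := hd.prefix_of_markedDeref h rfl hρ hu hρu (by simp)
  have := hpre s'
  rw [List.append_cons, hρu, List.prefix_append_right_inj] at this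
  exact hnp this

/-- The terminals of a marked ref-word. -/
def terminals (r : List (RefSym A X × ℕ)) : List A :=
  r.filterMap fun c => match c.1 with
    | .term a => some a
    | _ => none

theorem Deterministic.markedDeref_eq_terminals (hd : (expr α hα).Deterministic)
    (hN : (expr α hα).language.NoJump 1) {r s : List (RefSym A X × ℕ)}
    (h : r ++ s ∈ α.markedRefLangFrom 1) : markedDeref r = terminals r := by
  induction r using List.reverseRecOn generalizing s with
  | nil => rfl
  | append_singleton r c ih =>
    rw [List.append_assoc] at h
    have hr := ih h
    obtain ⟨c, i⟩ := c
    rw [terminals, List.filterMap_append, ← terminals, ← hr]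
    cases c with
    | term a => rw [markedDeref_concat_term]; rfl
    | ref x => rw [markedDeref_concat_ref, hd.val_eq_nil hN h]; rfl
    | opn x => rw [markedDeref_append_brackets _ (by simp [RefSym.IsBracket])]; simp
    | cls x => rw [markedDeref_append_brackets _ (by simp [RefSym.IsBracket])]; simp

theorem exists_terminal_of_terminals {ρ : List (RefSym A X × ℕ)} {p u : List A} {a : A}
    (h : terminals ρ = p ++ a :: u) : ∃ r i s, ρ = r ++ (.term a, i) :: s ∧ terminals r = p ∧
      terminals s = u := by
  obtain ⟨r, t, rfl, hr, ht⟩ := List.filterMap_eq_append_iff.1 h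
  obtain ⟨γ, ⟨c, i⟩, s, rfl, hγ, hc, hs⟩ := List.filterMap_eq_cons_iff.1 ht
  cases c <;> simp at hc
  subst hc
  refine ⟨r ++ γ, i, s, by simp, ?_, hs⟩
  have h0 : terminals γ = [] := List.filterMap_eq_nil_iff.2 hγ
  have h1 : terminals r = p := hr
  rw [terminals, List.filterMap_append, ← terminals, ← terminals, h0, h1, List.append_nil]

/-- References contribute nothing, so a word is the sequence of its terminals. A nonempty prefix
fixes the marked terminal that produced its last letter, and by locality the possible continuations
depend on that marked terminal only. -/
theorem Deterministic.finite_range_leftQuotient_expr [Finite A] [Nonempty A]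
    (hd : (expr α hα).Deterministic)
    (hN : (expr α hα).language.NoJump 1) :
    (Set.range (expr α hα).language.leftQuotient).Finite := by
  classical
  set L := (expr α hα).language with hL
  have split : ∀ p : List A, p ≠ [] → (∃ u, p ++ u ∈ L) → ∃ p' a r i s, p = p' ++ [a] ∧
      r ++ (.term a, i) :: s ∈ α.markedRefLangFrom 1 ∧ markedDeref r = p' := by
    rintro p hp ⟨u, hu⟩
    obtain ⟨p', a, rfl⟩ := (List.eq_nil_or_concat p).resolve_left hp
    obtain ⟨ρ, hρ, h⟩ := mem_language_iff_markedDeref.1 hu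
    rw [hd.markedDeref_eq_terminals hN (s := []) (by simpa using hρ)] at h
    rw [List.concat_eq_append, List.append_assoc] at h
    obtain ⟨r, i, s, rfl, hr, -⟩ := exists_terminal_of_terminals h
    exact ⟨p', a, r, i, s, by simp, hρ, by rw [← hr, hd.markedDeref_eq_terminals hN hρ]⟩
  have quot : ∀ {p' : List A} {a : A} {r : List (RefSym A X × ℕ)} {i s},
      r ++ (.term a, i) :: s ∈ α.markedRefLangFrom 1 → markedDeref r = p' → ∀ u,
      (p' ++ [a]) ++ u ∈ L ↔
        ∃ t, r ++ (.term a, i) :: t ∈ α.markedRefLangFrom 1 ∧ terminals t = u := by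
    rintro p' a r i s h rfl u
    rw [hL, mem_language_iff_markedDeref]
    have hr := hd.markedDeref_eq_terminals hN h
    constructor
    · rintro ⟨ρ, hρ, hρu⟩
      obtain ⟨t, rfl⟩ := hd.prefix_of_markedDeref (u := a :: u) h rfl hρ (by simp)
        (by simpa using hρu) (by simp)
      rw [hd.markedDeref_eq_terminals hN (s := []) (by simpa using hρ), hr] at hρu
      refine ⟨t, by simpa using hρ, ?_⟩
      simp only [terminals, List.filterMap_append] at hρu
      simpa [terminals] using hρu
    · rintro ⟨t, ht, rfl⟩
      refine ⟨_, ht, ?_⟩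
      rw [hd.markedDeref_eq_terminals hN (s := []) (by simpa using ht), hr]
      simp [terminals]
  have mark : ∀ {a : A} {r : List (RefSym A X × ℕ)} {i s},
      r ++ (.term a, i) :: s ∈ α.markedRefLangFrom 1 → i < 1 + α.numOcc := by
    intro a r i s h
    exact (RegexExpr.markedRefLangFrom_mark (c := (.term a, i)) ⟨_, h, by simp⟩).2
  choose! P a r i s hp hm hr using split
  -- The value `none` stands for the empty prefix, which has no last terminal, and `some none` for
  -- prefixes without continuation.
  let code : List A → Option (Option (A × Fin (1 + α.numOcc))) := fun p =>
    if h0 : p = [] then none else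
      if h : ∃ u, p ++ u ∈ L then some (some (a p, ⟨i p, mark (hm p h0 h)⟩)) else some none
  refine Set.finite_range_of_factor _ code fun p p' hpp => ?_
  by_cases h0 : p = []
  · by_cases h0' : p' = []
    · rw [h0, h0']
    · by_cases h' : ∃ u, p' ++ u ∈ L <;> simp [code, h0, h0', h'] at hpp
  by_cases h0' : p' = []
  · by_cases h : ∃ u, p ++ u ∈ L <;> simp [code, h0, h0', h] at hpp
  by_cases h : ∃ u, p ++ u ∈ L <;> by_cases h' : ∃ u, p' ++ u ∈ L
  · simp only [code, dif_neg h0, dif_neg h0', dif_pos h, dif_pos h', Option.some.injEq,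
      Prod.mk.injEq, Fin.mk.injEq] at hpp
    ext u
    change p ++ u ∈ L ↔ p' ++ u ∈ L
    rw [hp p h0 h, hp p' h0' h', quot (hm p h0 h) (hr p h0 h), quot (hm p' h0' h') (hr p' h0' h')]
    have hm₁ := hm p h0 h
    have hm₂ := hm p' h0' h'
    rw [hpp.1, hpp.2] at *
    have hloc := α.markedRefLangFrom_isLocal 1
    exact ⟨fun ⟨t, h1, h2⟩ => ⟨t, hloc _ _ _ _ _ hm₂ h1, h2⟩,
      fun ⟨t, h1, h2⟩ => ⟨t, hloc _ _ _ _ _ hm₁ h1, h2⟩⟩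
  · simp [code, h0, h0', h, h'] at hpp
  · simp [code, h0, h0', h, h'] at hpp
  · ext u
    change p ++ u ∈ L ↔ p' ++ u ∈ L
    exact ⟨fun hu => (h ⟨u, hu⟩).elim, fun hu => (h' ⟨u, hu⟩).elim⟩

theorem not_mem_drxLanguages_of_noJump [Finite A] [Nonempty A] {L : Language A} (hN : L.NoJump 1)
    (hL : ¬ (Set.range L.leftQuotient).Finite) : L ∉ drxLanguages A X := by
  rintro ⟨α, hd, rfl⟩
  cases α with
  | empty =>
    refine hL ((Set.finite_singleton (∅ : Set (List A))).subset ?_)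
    rintro _ ⟨p, rfl⟩
    refine Set.eq_empty_of_forall_notMem fun u hu => ?_
    obtain ⟨r, hr, -⟩ := hu
    exact hr
  | expr α hα => exact hL (hd.finite_range_leftQuotient_expr hN)

end Regex

/-! ### Commuting words -/

section Commuting

variable {α : Type*}

/-- The `n`-th power of a word. -/
def wordPow (c : List α) (n : ℕ) : List α := (List.replicate n c).flatten

@[simp] theorem wordPow_zero (c : List α) : wordPow c 0 = [] := rfl

theorem wordPow_succ (c : List α) (n : ℕ) : wordPow c (n + 1) = c ++ wordPow c n := by
  simp [wordPow, List.replicate_succ]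

theorem wordPow_add (c : List α) (m n : ℕ) : wordPow c (m + n) = wordPow c m ++ wordPow c n := by
  rw [wordPow, List.replicate_add, List.flatten_append]; rfl

theorem wordPow_one (c : List α) : wordPow c 1 = c := by simp [wordPow]

theorem wordPow_succ' (c : List α) (n : ℕ) : wordPow c (n + 1) = wordPow c n ++ c := by
  rw [wordPow_add, wordPow_one]

theorem le_length_wordPow {c : List α} (hc : c ≠ []) (n : ℕ) : n ≤ (wordPow c n).length := by
  have := List.length_pos_iff.2 hc
  simp only [wordPow, List.length_flatten, List.map_replicate, List.sum_replicate, smul_eq_mul]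
  nlinarith

theorem prefix_wordPow_of_commute {ρ σ : List α} (hσ : σ ≠ []) (h : ρ ++ σ = σ ++ ρ) {n : ℕ}
    (hn : ρ.length ≤ n) : ρ <+: wordPow σ n := by
  have hc : ∀ n, ρ ++ wordPow σ n = wordPow σ n ++ ρ := by
    intro n
    induction n with
    | zero => simp
    | succ n ih => rw [wordPow_succ, ← List.append_assoc, h, List.append_assoc, ih, List.append_assoc]
  exact List.prefix_of_prefix_length_le (l₃ := wordPow σ n ++ ρ) (hc n ▸ List.prefix_append _ _)
    (List.prefix_append _ _) (hn.trans (le_length_wordPow hσ n))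

/-- The words that commute with a given nonempty word are the powers of some word. -/
theorem exists_root {σ : List α} (hσ : σ ≠ []) :
    ∃ c, c ≠ [] ∧ ∀ ρ, ρ ++ σ = σ ++ ρ → ∃ n, ρ = wordPow c n := by
  classical
  -- The root is a shortest nonempty word commuting with `σ`. It is a prefix of every other such
  -- word, and what remains after splitting it off commutes with `σ` again.
  have hex : ∃ n, ∃ c : List α, c ≠ [] ∧ c ++ σ = σ ++ c ∧ c.length = n := ⟨_, σ, hσ, rfl, rfl⟩
  obtain ⟨c, hc, hcσ, hlen⟩ := Nat.find_spec hex
  refine ⟨c, hc, fun ρ => ?_⟩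
  induction hn : ρ.length using Nat.strong_induction_on generalizing ρ with
  | _ n ih =>
    intro hρ
    rcases eq_or_ne ρ [] with rfl | hne
    · exact ⟨0, rfl⟩
    have hle : c.length ≤ ρ.length := hlen ▸ Nat.find_min' hex ⟨ρ, hne, hρ, rfl⟩
    obtain ⟨ρ', rfl⟩ := List.prefix_of_prefix_length_le
      (prefix_wordPow_of_commute hσ hcσ hle) (prefix_wordPow_of_commute hσ hρ le_rfl) hle
    have hρ' : ρ' ++ σ = σ ++ ρ' := by
      rw [List.append_assoc, ← List.append_assoc σ, ← hcσ, List.append_assoc] at hρ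
      exact List.append_cancel_left hρ
    have hpos := List.length_pos_iff.2 hc
    obtain ⟨m, rfl⟩ := ih ρ'.length (by rw [← hn, List.length_append]; omega) ρ' rfl hρ'
    exact ⟨m + 1, (wordPow_succ _ _).symm⟩

end Commuting

/-! ### Marked ref-words along a single path -/

section PathLike

variable {A X : Type*}

/-- Two words of the language do not branch, except that one of them may end, up to brackets. -/
def Language.PathLike (S : Language (RefSym A X × ℕ)) : Prop :=
  ∀ q t₁ t₂, q ++ t₁ ∈ S → q ++ t₂ ∈ S → (consumeCount t₁ = 0 ↔ consumeCount t₂ = 0) →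
    t₁.head? = t₂.head?

/-- Every closing bracket is preceded by an opening bracket of the same variable. -/
def OpensFirst (w : List (RefSym A X × ℕ)) : Prop :=
  ∀ w₁ w₂ x i, w = w₁ ++ (.cls x, i) :: w₂ → ∃ j, (.opn x, j) ∈ w₁

/-- All words with sufficiently many letters are `r₀ * c ^ n * γ` for fixed `r₀`, `c` and `γ`. -/
def Language.EventuallyCyclic (S : Language (RefSym A X × ℕ)) : Prop :=
  ∃ N r₀ c γ, OpensFirst c ∧ (∀ d ∈ γ, d.1.IsBracket) ∧
    ∀ ρ ∈ S, consumeCount ρ ≤ N ∨ ∃ n, ρ = r₀ ++ wordPow c n ++ γ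

theorem OpensFirst.append {u v : List (RefSym A X × ℕ)} (hu : OpensFirst u) (hv : OpensFirst v) :
    OpensFirst (u ++ v) := by
  intro w₁ w₂ x i h
  rcases List.append_cons_eq_append h.symm with ⟨s', h1, -⟩ | ⟨r', rfl, h1⟩
  · exact hu _ _ x i h1
  · obtain ⟨j, hj⟩ := hv _ _ x i h1
    exact ⟨j, List.mem_append_right _ hj⟩

theorem OpensFirst.of_prefix {u v : List (RefSym A X × ℕ)} (hv : OpensFirst v) (h : u <+: v) :
    OpensFirst u := by
  obtain ⟨t, rfl⟩ := h
  rintro w₁ w₂ x i rfl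
  exact hv w₁ (w₂ ++ t) x i (by simp)

theorem OpensFirst.nil : OpensFirst ([] : List (RefSym A X × ℕ)) := by
  intro w₁ w₂ x i h
  simp at h

theorem OpensFirst.singleton {c : RefSym A X × ℕ} (hc : ∀ x, c.1 ≠ .cls x) : OpensFirst [c] := by
  intro w₁ w₂ x i h
  have : ((.cls x, i) : RefSym A X × ℕ) ∈ [c] := by rw [h]; simp
  rw [List.mem_singleton] at this
  exact (hc x (by rw [← this])).elim

theorem RegexExpr.opensFirst {α : RegexExpr A X} {n : ℕ} {ρ : List (RefSym A X × ℕ)}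
    (h : ρ ∈ α.markedRefLangFrom n) : OpensFirst ρ := by
  induction α generalizing n ρ with
  | eps => rw [Set.mem_singleton_iff.1 h]; exact .nil
  | term a => rw [Set.mem_singleton_iff.1 h]; exact .singleton (by simp)
  | ref x => rw [Set.mem_singleton_iff.1 h]; exact .singleton (by simp)
  | cat α β ihα ihβ =>
    obtain ⟨u, hu, v, hv, rfl⟩ := h
    exact (ihα hu).append (ihβ hv)
  | alt α β ihα ihβ =>
    rcases h with h | h
    · exact ihα h
    · exact ihβ h
  | plus α ih =>
    obtain ⟨L, -, rfl, hL⟩ := Language.mem_mul_kstar_iff.1 h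
    clear h
    induction L with
    | nil => exact .nil
    | cons u L ihL =>
      simp only [List.mem_cons, forall_eq_or_imp] at hL
      exact (ih hL.1).append (ihL hL.2)
  | bind x α ih =>
    obtain ⟨u', ⟨o, ho, u, hu, rfl⟩, e, he, rfl⟩ := h
    rw [Set.mem_singleton_iff.1 ho, Set.mem_singleton_iff.1 he]
    intro w₁ w₂ y i h
    rcases List.append_cons_eq_append h.symm with ⟨s', h1, -⟩ | ⟨r', rfl, h1⟩
    · exact (OpensFirst.singleton (by simp)).append (ih hu) _ _ y i h1
    · have : ((.cls y, i) : RefSym A X × ℕ) ∈ [(.cls x, n + 1 + α.numOcc)] := by rw [h1]; simp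
      simp only [List.mem_singleton, Prod.mk.injEq, RefSym.cls.injEq] at this
      exact ⟨n, by simp [this.1]⟩

theorem Language.PathLike.eq {S : Language (RefSym A X × ℕ)} (hS : S.PathLike)
    {ρ₁ ρ₂ : List (RefSym A X × ℕ)} (h₁ : ρ₁ ∈ S) (h₂ : ρ₂ ∈ S)
    (h : ∀ q t₁ t₂, ρ₁ = q ++ t₁ → ρ₂ = q ++ t₂ → (consumeCount t₁ = 0 ↔ consumeCount t₂ = 0)) :
    ρ₁ = ρ₂ := by
  obtain ⟨q, t₁, t₂, rfl, rfl, hne⟩ := List.exists_common_prefix ρ₁ ρ₂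
  have hh := hS q t₁ t₂ h₁ h₂ (h q t₁ t₂ rfl rfl)
  rcases hne with rfl | rfl | hne
  · rw [List.head?_nil, eq_comm, List.head?_eq_none_iff] at hh
    rw [hh]
  · rw [List.head?_nil, List.head?_eq_none_iff] at hh
    rw [hh]
  · exact (hne hh).elim

/-- In consequence only finitely many words have a bounded number of terminals and references. -/
theorem Language.PathLike.injOn {S : Language (RefSym A X × ℕ)} (hS : S.PathLike) :
    Set.InjOn consumeCount (S : Set (List (RefSym A X × ℕ))) := by
  intro ρ₁ h₁ ρ₂ h₂ h
  refine hS.eq h₁ h₂ ?_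
  rintro q t₁ t₂ rfl rfl
  simp only [consumeCount_append, Nat.add_left_cancel_iff] at h
  rw [h]

/-- Appending `σ` turns a branching of `S` into one of `S * T`; where a tail is empty, `σ` takes its
place, and disjointness tells its letters from those of `S`. If `σ` has a terminal or reference,
both tails acquire one, so words of `S` can neither branch nor end early. -/
theorem Language.PathLike.left {S T : Language (RefSym A X × ℕ)} (h : (S * T).PathLike)
    (hd : Disjoint S.letters T.letters) {σ : List (RefSym A X × ℕ)} (hσ : σ ∈ T)
    {q t₁ t₂ : List (RefSym A X × ℕ)} (h₁ : q ++ t₁ ∈ S) (h₂ : q ++ t₂ ∈ S)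
    (hc : consumeCount σ ≠ 0 ∨ (consumeCount t₁ = 0 ↔ consumeCount t₂ = 0)) :
    t₁.head? = t₂.head? := by
  rw [Set.disjoint_left] at hd
  have key := h q (t₁ ++ σ) (t₂ ++ σ) ⟨_, h₁, σ, hσ, by simp⟩ ⟨_, h₂, σ, hσ, by simp⟩ (by
    simp only [consumeCount_append]; omega)
  rcases t₁ with _ | ⟨c, t₁⟩ <;> rcases t₂ with _ | ⟨d, t₂⟩
  · rfl
  · rcases σ with _ | ⟨e, σ⟩
    · simp at key
    · simp only [List.nil_append, List.cons_append, List.head?_cons, Option.some.injEq] at key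
      subst key
      exact (hd (a := e) ⟨_, h₂, by simp⟩ ⟨_, hσ, by simp⟩).elim
  · rcases σ with _ | ⟨e, σ⟩
    · simp at key
    · simp only [List.nil_append, List.cons_append, List.head?_cons, Option.some.injEq] at key
      subst key
      exact (hd (a := c) ⟨_, h₁, by simp⟩ ⟨_, hσ, by simp⟩).elim
  · simpa using key

theorem Language.PathLike.right {S T : Language (RefSym A X × ℕ)} (h : (S * T).PathLike)
    {σ : List (RefSym A X × ℕ)} (hσ : σ ∈ S) : T.PathLike := by
  intro q t₁ t₂ h₁ h₂ hc
  exact h (σ ++ q) t₁ t₂ ⟨σ, hσ, _, h₁, by simp⟩ ⟨σ, hσ, _, h₂, by simp⟩ hc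

theorem Language.EventuallyCyclic.of_bounded {S : Language (RefSym A X × ℕ)} (N : ℕ)
    (h : ∀ ρ ∈ S, consumeCount ρ ≤ N) : S.EventuallyCyclic :=
  ⟨N, [], [], [], .nil, by simp, fun ρ hρ => Or.inl (h ρ hρ)⟩

/-- Only one factor can vary. If some word of `T` has a terminal or reference, `S` is a single word,
which is prepended to `r₀`. Otherwise `T` is a single word of brackets, which is appended to `γ`. -/
theorem Language.EventuallyCyclic.mul {S T : Language (RefSym A X × ℕ)} (h : (S * T).PathLike)
    (hd : Disjoint S.letters T.letters) (hSne : ∃ σ, σ ∈ S) (hTne : ∃ σ, σ ∈ T)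
    (hS : S.PathLike → S.EventuallyCyclic) (hT : T.PathLike → T.EventuallyCyclic) :
    (S * T).EventuallyCyclic := by
  obtain ⟨s₀, hs₀⟩ := hSne
  obtain ⟨t₀, ht₀⟩ := hTne
  have hTp : T.PathLike := h.right hs₀
  have hSp : S.PathLike := fun q t₁ t₂ h₁ h₂ hc => h.left hd ht₀ h₁ h₂ (Or.inr hc)
  by_cases htriv : ∃ σ ∈ T, consumeCount σ ≠ 0
  · obtain ⟨σ, hσ, hne⟩ := htriv
    have hs : ∀ s ∈ S, s = s₀ := by
      intro s hs
      obtain ⟨q, t₁, t₂, rfl, rfl, hdiff⟩ := List.exists_common_prefix s s₀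
      have hh := h.left hd hσ hs hs₀ (Or.inl hne)
      rcases hdiff with rfl | rfl | hdiff
      · rw [List.head?_nil, eq_comm, List.head?_eq_none_iff] at hh
        rw [hh]
      · rw [List.head?_nil, List.head?_eq_none_iff] at hh
        rw [hh]
      · exact (hdiff hh).elim
    obtain ⟨N, r₀, c, γ, hc, hγ, hN⟩ := hT hTp
    refine ⟨consumeCount s₀ + N, s₀ ++ r₀, c, γ, hc, hγ, ?_⟩
    rintro _ ⟨s, hs', t, ht, rfl⟩
    rw [hs s hs']
    rcases hN t ht with h1 | ⟨n, rfl⟩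
    · left; simp only [consumeCount_append]; omega
    · right; exact ⟨n, by simp⟩
  · push Not at htriv
    have ht : ∀ t ∈ T, t = t₀ := fun t ht => hTp.injOn ht ht₀ (by rw [htriv t ht, htriv t₀ ht₀])
    obtain ⟨N, r₀, c, γ, hc, hγ, hN⟩ := hS hSp
    refine ⟨N, r₀, c, γ ++ t₀, hc, ?_, ?_⟩
    · intro d hd
      rcases List.mem_append.1 hd with hd | hd
      · exact hγ d hd
      · exact consumeCount_eq_zero.1 (htriv t₀ ht₀) d hd
    rintro _ ⟨s, hs, t, ht', rfl⟩
    rw [ht t ht']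
    rcases hN s hs with h1 | ⟨n, rfl⟩
    · left; simp only [consumeCount_append, htriv t₀ ht₀]; omega
    · right; exact ⟨n, by simp⟩

/-- Words with terminals or references in both summands would have to begin with the same letter,
contrary to disjointness. So one summand contains only words of brackets. -/
theorem Language.EventuallyCyclic.add {S T : Language (RefSym A X × ℕ)} (h : (S + T).PathLike)
    (hd : Disjoint S.letters T.letters)
    (hS : S.PathLike → S.EventuallyCyclic) (hT : T.PathLike → T.EventuallyCyclic) :
    (S + T).EventuallyCyclic := by
  rw [Set.disjoint_left] at hd
  have hSp : S.PathLike := fun q t₁ t₂ h₁ h₂ hc => h q t₁ t₂ (Or.inl h₁) (Or.inl h₂) hc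
  have hTp : T.PathLike := fun q t₁ t₂ h₁ h₂ hc => h q t₁ t₂ (Or.inr h₁) (Or.inr h₂) hc
  have htriv : (∀ ρ ∈ S, consumeCount ρ = 0) ∨ ∀ ρ ∈ T, consumeCount ρ = 0 := by
    by_contra! hc
    obtain ⟨⟨s, hs, hs0⟩, t, ht, ht0⟩ := hc
    have hh := h [] s t (Or.inl hs) (Or.inr ht) (by omega)
    rcases s with _ | ⟨c, s⟩
    · exact hs0 rfl
    rcases t with _ | ⟨d, t⟩
    · exact ht0 rfl
    simp only [List.head?_cons, Option.some.injEq] at hh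
    subst hh
    exact hd (a := c) ⟨_, hs, by simp⟩ ⟨_, ht, by simp⟩
  rcases htriv with h0 | h0
  · obtain ⟨N, r₀, c, γ, hc, hγ, hN⟩ := hT hTp
    refine ⟨N, r₀, c, γ, hc, hγ, ?_⟩
    rintro ρ (hρ | hρ)
    · left; rw [h0 ρ hρ]; omega
    · exact hN ρ hρ
  · obtain ⟨N, r₀, c, γ, hc, hγ, hN⟩ := hS hSp
    refine ⟨N, r₀, c, γ, hc, hγ, ?_⟩
    rintro ρ (hρ | hρ)
    · exact hN ρ hρ
    · left; rw [h0 ρ hρ]; omega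

/-- If `σ ∈ S` has a terminal or reference, every `ρ ∈ S` satisfies `ρ ++ σ = σ ++ ρ`, because the
two products cannot branch. Words commuting with `σ` are powers of one word, which serves as the
cycle. -/
theorem Language.EventuallyCyclic.mul_kstar {S : Language (RefSym A X × ℕ)}
    (h : (S * KStar.kstar S).PathLike) (hS : ∀ ρ ∈ S, OpensFirst ρ) :
    (S * KStar.kstar S).EventuallyCyclic := by
  have hmem : ∀ L : List (List (RefSym A X × ℕ)), L ≠ [] → (∀ y ∈ L, y ∈ S) →
      L.flatten ∈ S * KStar.kstar S :=
    fun L h0 hL => Language.mem_mul_kstar_iff.2 ⟨L, h0, rfl, hL⟩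
  by_cases htriv : ∃ σ ∈ S, consumeCount σ ≠ 0
  · obtain ⟨σ, hσ, hσ0⟩ := htriv
    have hne : σ ≠ [] := by rintro rfl; exact hσ0 rfl
    have hcomm : ∀ ρ ∈ S, ρ ++ σ = σ ++ ρ := by
      intro ρ hρ
      -- The extra factor `σ` at the end ensures that both tails still contain a terminal or
      -- reference at a branching inside the first two factors.
      obtain ⟨q, t₁, t₂, h₁, h₂, hdiff⟩ := List.exists_common_prefix (ρ ++ σ ++ σ) (σ ++ ρ ++ σ)
      have hl₁ := congrArg List.length h₁
      have hl₂ := congrArg List.length h₂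
      simp only [List.length_append] at hl₁ hl₂
      by_cases hlen : t₁.length ≤ σ.length
      · have hp₁ : ρ ++ σ <+: q := List.prefix_of_prefix_length_le (l₃ := ρ ++ σ ++ σ)
          (List.prefix_append _ _) (h₁ ▸ List.prefix_append _ _) (by simp; omega)
        have hp₂ : σ ++ ρ <+: q := List.prefix_of_prefix_length_le (l₃ := σ ++ ρ ++ σ)
          (List.prefix_append _ _) (h₂ ▸ List.prefix_append _ _) (by simp; omega)
        exact (List.prefix_of_prefix_length_le hp₁ hp₂ (by simp; omega)).eq_of_length
          (by simp; omega)
      · exfalso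
        have hs₁ : σ <:+ t₁ := List.suffix_of_suffix_length_le (l₃ := ρ ++ σ ++ σ)
          (List.suffix_append _ _) (h₁ ▸ List.suffix_append _ _) (by omega)
        have hs₂ : σ <:+ t₂ := List.suffix_of_suffix_length_le (l₃ := σ ++ ρ ++ σ)
          (List.suffix_append _ _) (h₂ ▸ List.suffix_append _ _) (by omega)
        have hc₁ : consumeCount t₁ ≠ 0 := by
          obtain ⟨t, rfl⟩ := hs₁
          rw [consumeCount_append]; omega
        have hc₂ : consumeCount t₂ ≠ 0 := by
          obtain ⟨t, rfl⟩ := hs₂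
          rw [consumeCount_append]; omega
        have m₁ := hmem [ρ, σ, σ] (by simp) (by simp [hρ, hσ])
        have m₂ := hmem [σ, ρ, σ] (by simp) (by simp [hρ, hσ])
        simp only [List.flatten_cons, List.flatten_nil, List.append_nil] at m₁ m₂
        rw [← List.append_assoc, h₁] at m₁
        rw [← List.append_assoc, h₂] at m₂
        have hh := h q t₁ t₂ m₁ m₂ (by omega)
        rcases hdiff with rfl | rfl | hdiff
        · exact hc₁ rfl
        · exact hc₂ rfl
        · exact hdiff hh
    obtain ⟨c, hc, hroot⟩ := exists_root hne
    -- The root is a prefix of `σ`, because `σ` is a positive power of it.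
    have hopen : OpensFirst c := by
      obtain ⟨n, hn⟩ := hroot σ rfl
      refine (hS σ hσ).of_prefix ?_
      rcases n with _ | n
      · exact (hne hn).elim
      · rw [hn, wordPow_succ]; exact List.prefix_append _ _
    refine ⟨0, [], c, [], hopen, by simp, fun ρ hρ => Or.inr ?_⟩
    obtain ⟨L, -, rfl, hL⟩ := Language.mem_mul_kstar_iff.1 hρ
    simp only [List.nil_append, List.append_nil]
    clear hρ
    induction L with
    | nil => exact ⟨0, rfl⟩
    | cons u L ih =>
      simp only [List.mem_cons, forall_eq_or_imp] at hL
      obtain ⟨m, hm⟩ := hroot u (hcomm u hL.1)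
      obtain ⟨n, hn⟩ := ih hL.2
      exact ⟨m + n, by rw [List.flatten_cons, hn, hm, wordPow_add]⟩
  · push Not at htriv
    refine .of_bounded 0 fun ρ hρ => ?_
    obtain ⟨L, -, rfl, hL⟩ := Language.mem_mul_kstar_iff.1 hρ
    clear hρ
    induction L with
    | nil => simp
    | cons u L ih =>
      simp only [List.mem_cons, forall_eq_or_imp] at hL
      rw [List.flatten_cons, consumeCount_append, htriv u hL.1]
      simpa using ih hL.2

theorem RegexExpr.exists_mem_markedRefLangFrom (α : RegexExpr A X) (n : ℕ) :
    ∃ ρ, ρ ∈ α.markedRefLangFrom n := by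
  induction α generalizing n with
  | eps => exact ⟨_, rfl⟩
  | term a => exact ⟨_, rfl⟩
  | ref x => exact ⟨_, rfl⟩
  | cat α β ihα ihβ =>
    obtain ⟨u, hu⟩ := ihα n
    obtain ⟨v, hv⟩ := ihβ (n + α.numOcc)
    exact ⟨_, u, hu, v, hv, rfl⟩
  | alt α β ihα ihβ => exact (ihα n).imp fun _ h => Or.inl h
  | plus α ih =>
    obtain ⟨u, hu⟩ := ih n
    exact ⟨_, u, hu, [], Language.nil_mem_kstar _, rfl⟩
  | bind x α ih =>
    obtain ⟨u, hu⟩ := ih (n + 1)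
    exact ⟨_, _, ⟨_, rfl, u, hu, rfl⟩, _, rfl, rfl⟩

theorem RegexExpr.eventuallyCyclic {α : RegexExpr A X} {n : ℕ}
    (h : (α.markedRefLangFrom n).PathLike) : (α.markedRefLangFrom n).EventuallyCyclic := by
  have hsing : ∀ c : RefSym A X × ℕ,
      ({[c]} : Language (RefSym A X × ℕ)).EventuallyCyclic := fun c =>
    .of_bounded 1 fun ρ hρ => by
      rw [Set.mem_singleton_iff.1 hρ, consumeCount_cons]; split_ifs <;> simp
  induction α generalizing n with
  | eps => exact .of_bounded 0 fun ρ hρ => by rw [Set.mem_singleton_iff.1 hρ]; simp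
  | term a => exact hsing _
  | ref x => exact hsing _
  | cat α β ihα ihβ =>
    exact .mul h (disjoint_letters le_rfl) (α.exists_mem_markedRefLangFrom _)
      (β.exists_mem_markedRefLangFrom _) ihα ihβ
  | alt α β ihα ihβ => exact .add h (disjoint_letters le_rfl) ihα ihβ
  | plus α ih => exact .mul_kstar h fun ρ hρ => opensFirst hρ
  | bind x α ih =>
    refine .mul h ?_ ?_ ⟨_, rfl⟩ (fun h' => .mul h' ?_ ⟨_, rfl⟩
      (α.exists_mem_markedRefLangFrom _) (fun _ => hsing _) ih) (fun _ => hsing _)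
    · exact disjoint_letters_cls x α n
    · obtain ⟨u, hu⟩ := α.exists_mem_markedRefLangFrom (n + 1)
      exact ⟨_, _, rfl, u, hu, rfl⟩
    · exact disjoint_letters_opn x α n

end PathLike

/-! ### Alternating words -/

section

variable {A : Type*}

/-- The word of length `n` in which `a` and `b` alternate, starting with `a`. -/
def altWord (a b : A) : ℕ → List A
  | 0 => []
  | n + 1 => a :: altWord b a n

@[simp] theorem length_altWord (a b : A) (n : ℕ) : (altWord a b n).length = n := by
  induction n generalizing a b with
  | zero => rfl
  | succ n ih => simp [altWord, ih]

theorem eq_altWord_of_prefix {a b : A} {n : ℕ} {p : List A} (h : p <+: altWord a b n) :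
    p = altWord a b p.length := by
  induction n generalizing a b p with
  | zero => rw [List.prefix_nil.1 h]; rfl
  | succ n ih =>
    rcases p with _ | ⟨c, p⟩
    · rfl
    · rw [altWord, List.cons_prefix_cons] at h
      rw [h.1, List.length_cons, altWord, ← ih h.2]

theorem altWord_ne_repeat {a b d : A} (hab : a ≠ b) {n : ℕ} (u v : List A) :
    u ++ d :: d :: v ≠ altWord a b n := by
  induction n generalizing a b u with
  | zero => simp [altWord]
  | succ n ih =>
    rcases u with _ | ⟨c, u⟩
    · rcases n with _ | n
      · simp [altWord]
      · intro h
        simp only [List.nil_append, altWord, List.cons.injEq] at h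
        exact hab (h.1.symm.trans h.2.1)
    · intro h
      simp only [List.cons_append, altWord, List.cons.injEq] at h
      exact ih hab.symm u h.2

end

/-! ### Repeated dereferencing passes over one word -/

section Deref

variable {A X : Type*}

theorem val_derefRun_of_not_mem {s : DerefState A X} {l : List (RefSym A X × ℕ)} {x : X}
    (h : ∀ i, (.cls x, i) ∉ l) : (derefRun s l).val x = s.val x := by
  induction l generalizing s with
  | nil => rfl
  | cons c l ih =>
    rw [derefRun_cons, ih fun i hi => h i (List.mem_cons_of_mem _ hi)]
    obtain ⟨c, i⟩ := c
    cases c with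
    | cls y =>
      have : x ≠ y := by rintro rfl; exact h i (by simp)
      simp [DerefState.step, this]
    | _ => rfl

theorem length_le_start_of_opensFirst {s : DerefState A X} {l : List (RefSym A X × ℕ)} {x : X}
    (h : ∃ j, (.opn x, j) ∈ l) : s.out.length ≤ (derefRun s l).start x := by
  induction l using List.reverseRecOn with
  | nil => simp at h
  | append_singleton l c ih =>
    obtain ⟨j, hj⟩ := h
    obtain ⟨c, i⟩ := c
    rw [derefRun_append, derefRun_cons, derefRun_nil]
    by_cases hc : c = .opn x
    · subst hc
      simpa [DerefState.step] using (out_prefix_derefRun s l).length_le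
    · have hl : (.opn x, j) ∈ l := by
        rcases List.mem_append.1 hj with hj | hj
        · exact hj
        · simp only [List.mem_singleton, Prod.mk.injEq] at hj
          exact (hc hj.1.symm).elim
      have := ih ⟨j, hl⟩
      cases c with
      | opn y =>
        have : x ≠ y := by rintro rfl; exact hc rfl
        simpa [DerefState.step, this]
      | _ => simpa [DerefState.step]

/-- A value that is assigned during the pass over a word is part of the output of that pass. -/
theorem val_infix_of_opensFirst {s : DerefState A X} {l : List (RefSym A X × ℕ)}
    (hl : OpensFirst l) {x : X} (h : ∃ i, (.cls x, i) ∈ l) :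
    (derefRun s l).val x <:+: (derefRun s l).out.drop s.out.length := by
  induction l using List.reverseRecOn with
  | nil => simp at h
  | append_singleton l c ih =>
    obtain ⟨j, hj⟩ := h
    obtain ⟨c, i⟩ := c
    rw [derefRun_append, derefRun_cons, derefRun_nil]
    by_cases hc : c = .cls x
    · subst hc
      have hle := length_le_start_of_opensFirst (s := s) (hl l [] x i rfl)
      simp only [DerefState.step, Function.update_self]
      exact (List.drop_suffix_drop_left _ hle).isInfix
    · have hmem : (.cls x, j) ∈ l := by
        rcases List.mem_append.1 hj with hj | hj
        · exact hj
        · simp only [List.mem_singleton, Prod.mk.injEq] at hj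
          exact (hc hj.1.symm).elim
      have hval : ((derefRun s l).step c).val x = (derefRun s l).val x := by
        cases c with
        | cls y =>
          have : x ≠ y := by rintro rfl; exact hc rfl
          simp [DerefState.step, this]
        | _ => rfl
      rw [hval]
      refine (ih (hl.of_prefix (List.prefix_append _ _)) ⟨j, hmem⟩).trans ?_
      obtain ⟨t, ht⟩ := out_prefix_step (derefRun s l) c
      rw [← ht, List.drop_append_of_le_length (out_prefix_derefRun s l).length_le]
      exact (List.prefix_append _ _).isInfix

theorem exists_first_output {s : DerefState A X} {l : List (RefSym A X × ℕ)}
    (h : (derefRun s l).out ≠ s.out) : ∃ l₁ c l₂, l = l₁ ++ c :: l₂ ∧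
      (derefRun s l₁).out = s.out ∧ (derefRun s (l₁ ++ [c])).out ≠ s.out := by
  induction l using List.reverseRecOn with
  | nil => exact (h rfl).elim
  | append_singleton l c ih =>
    by_cases hl : (derefRun s l).out = s.out
    · exact ⟨l, c, [], rfl, hl, h⟩
    · obtain ⟨l₁, d, l₂, rfl, h₁, h₂⟩ := ih hl
      exact ⟨l₁, d, l₂ ++ [c], by simp, h₁, h₂⟩

theorem eq_concat_of_prefix {p w : List A} {d : A} {y : List A} (h : p ++ y ++ [d] <+: w)
    (hl : w.length ≤ p.length + 1) : w = p ++ [d] := by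
  obtain ⟨t, rfl⟩ := h
  simp only [List.length_append, List.length_cons, List.length_nil] at hl
  have hy : y = [] := List.length_eq_zero_iff.1 (by omega)
  have ht : t = [] := List.length_eq_zero_iff.1 (by omega)
  simp [hy, ht]

/-- If three consecutive passes over the same word each output at most one letter, then the letter
that is output by the second one occurs also in the first or in the third one. -/
theorem repeat_of_passes {s₀ s₁ s₂ s₃ : DerefState A X} {c : List (RefSym A X × ℕ)}
    (hc : OpensFirst c) (h₁ : derefRun s₀ c = s₁) (h₂ : derefRun s₁ c = s₂)
    (h₃ : derefRun s₂ c = s₃) (hl₁ : s₁.out.length ≤ s₀.out.length + 1)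
    (hl₂ : s₂.out.length = s₁.out.length + 1) (hl₃ : s₃.out.length ≤ s₂.out.length + 1) :
    ∃ d, s₂.out = s₁.out ++ [d] ∧ (s₁.out = s₀.out ++ [d] ∨ s₃.out = s₂.out ++ [d]) := by
  -- Here `e` is the letter at which the second pass produces its only output.
  obtain ⟨c₁, ⟨e, i⟩, c₂, rfl, he, hne⟩ := exists_first_output (s := s₁) (l := c) (by
    rw [h₂]; intro h0; rw [h0] at hl₂; omega)
  have hstep : (derefRun s₁ (c₁ ++ [(e, i)])).out = s₂.out := by
    have hp : (derefRun s₁ (c₁ ++ [(e, i)])).out <+: s₂.out := by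
      rw [← h₂, List.append_cons c₁ _ c₂, derefRun_append _ (c₁ ++ [(e, i)])]
      exact out_prefix_derefRun _ _
    refine hp.eq_of_length (le_antisymm hp.length_le ?_)
    obtain ⟨t, ht⟩ := out_prefix_derefRun s₁ (c₁ ++ [(e, i)])
    rw [← ht] at hne ⊢
    rw [hl₂, List.length_append]
    have : t ≠ [] := by rintro rfl; simp at hne
    have := List.length_pos_iff.2 this
    omega
  have hpre : ∀ s : DerefState A X, ∃ y, (derefRun s c₁).out = s.out ++ y := fun s =>
    (out_prefix_derefRun s c₁).imp fun _ h => h.symm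
  have hpost : ((derefRun s₂ c₁).step e).out <+: s₃.out := by
    rw [← h₃, derefRun_append, derefRun_cons]
    exact out_prefix_derefRun _ _
  obtain ⟨y, hy⟩ := hpre s₂
  rw [derefRun_append, derefRun_cons, derefRun_nil] at hstep hne
  cases e with
  | opn x => exact (hne (by simpa [DerefState.step] using he)).elim
  | cls x => exact (hne (by simpa [DerefState.step] using he)).elim
  | term d =>
    simp only [DerefState.step] at hstep hpost
    rw [he] at hstep
    rw [hy] at hpost
    exact ⟨d, hstep.symm, Or.inr (eq_concat_of_prefix hpost hl₃)⟩
  | ref x =>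
    simp only [DerefState.step] at hstep hpost
    rw [he] at hstep
    obtain ⟨d, hd⟩ : ∃ d, (derefRun s₁ c₁).val x = [d] := by
      rw [← List.length_eq_one_iff]
      have := congrArg List.length hstep
      rw [List.length_append] at this
      omega
    rw [hd] at hstep
    refine ⟨d, hstep.symm, ?_⟩
    -- The second pass outputs nothing before `e`, so a binding of `x` completed there would have an
    -- empty value. The value of `x` is thus the one left by the first pass.
    by_cases hx₁ : ∃ i, (.cls x, i) ∈ c₁
    · have := (val_infix_of_opensFirst (s := s₁)
        (hc.of_prefix (List.prefix_append _ _)) hx₁).length_le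
      rw [hd, he] at this
      simp at this
    have hv : (derefRun s₁ c₁).val x = s₁.val x :=
      val_derefRun_of_not_mem fun i hi => hx₁ ⟨i, hi⟩
    -- If the cycle completes a binding of `x`, the value was assigned in the first pass and makes
    -- up its whole output. Otherwise the value never changes, and the third pass outputs it again.
    by_cases hx : ∃ j, (.cls x, j) ∈ c₁ ++ (.ref x, i) :: c₂
    · left
      have hinf := val_infix_of_opensFirst (s := s₀) hc hx
      rw [h₁, ← hv, hd] at hinf
      obtain ⟨t, ht⟩ := out_prefix_derefRun s₀ (c₁ ++ (.ref x, i) :: c₂)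
      rw [h₁] at ht
      rw [← ht, List.drop_left] at hinf
      rw [← ht]
      congr 1
      refine (hinf.eq_of_length (le_antisymm hinf.length_le ?_)).symm
      rw [← ht, List.length_append] at hl₁
      simp; omega
    · right
      have hv₂ : (derefRun s₂ c₁).val x = [d] := by
        rw [val_derefRun_of_not_mem fun i hi => hx₁ ⟨i, hi⟩, ← h₂,
          val_derefRun_of_not_mem fun i hi => hx ⟨i, hi⟩, ← hv, hd]
      rw [hy, hv₂] at hpost
      exact eq_concat_of_prefix hpost hl₃

end Deref

/-! ### Alternating words and deterministic regex -/

namespace Regex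

variable {A X : Type*} {α : RegexExpr A X} {hα : α.WellFormed}

/-- All words of the language agree at every position they share, so a branching into different
terminals is impossible. -/
theorem Deterministic.pathLike_of_alternating (hd : (expr α hα).Deterministic) {a b : A}
    (hL : ∀ w ∈ (expr α hα).language, w = altWord a b w.length) :
    (α.markedRefLangFrom 1).PathLike := by
  intro q t₁ t₂ h₁ h₂ hc
  by_cases h0 : consumeCount t₁ = 0
  · rw [hd.eq_of_brackets h₁ h₂ h0 (hc.1 h0)]
  rcases hd.head_eq_or h₁ h₂ h0 (fun h => h0 (hc.2 h)) with
    h | ⟨γ₁, γ₂, a₁, a₂, i₁, i₂, s₁, s₂, hγ₁, hγ₂, haa, rfl, rfl⟩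
  · exact h
  exfalso
  have hp₁ := markedDeref_brackets_term q s₁ hγ₁ a₁ i₁
  have hp₂ := markedDeref_brackets_term q s₂ hγ₂ a₂ i₂
  rw [hL _ (mem_language_iff_markedDeref.2 ⟨_, h₁, rfl⟩)] at hp₁
  rw [hL _ (mem_language_iff_markedDeref.2 ⟨_, h₂, rfl⟩)] at hp₂
  have e := (eq_altWord_of_prefix hp₁).trans
    ((congrArg (altWord a b) (by simp)).trans (eq_altWord_of_prefix hp₂).symm)
  simp at e
  exact haa e

theorem not_mem_drxLanguages_of_alternating {L : Language A} {a b : A} (hab : a ≠ b)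
    (hL : ∀ w, w ≠ [] → (w ∈ L ↔ w = altWord a b w.length)) : L ∉ drxLanguages A X := by
  rintro ⟨α, hd, rfl⟩
  cases α with
  | empty =>
    obtain ⟨r, hr, -⟩ := (hL (altWord a b 1) (by simp [altWord])).2 (by simp)
    exact hr
  | expr α hα =>
    have hL' : ∀ w ∈ (expr α hα).language, w = altWord a b w.length := by
      intro w hw
      rcases eq_or_ne w [] with rfl | hne
      · rfl
      · exact (hL w hne).1 hw
    have hpath := hd.pathLike_of_alternating hL'
    obtain ⟨N, r₀, c, γ, hc, hγ, hN⟩ := RegexExpr.eventuallyCyclic hpath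
    -- By `PathLike.injOn` only finitely many marked ref-words have at most `N` terminals and
    -- references; `B` bounds what they stand for.
    obtain ⟨B, hB⟩ : ∃ B, ∀ ρ ∈ α.markedRefLangFrom 1, consumeCount ρ ≤ N →
        (markedDeref ρ).length ≤ B := by
      have hfin : {ρ | ρ ∈ α.markedRefLangFrom 1 ∧ consumeCount ρ ≤ N}.Finite :=
        Set.Finite.of_injOn (t := Set.Iic N) (f := consumeCount) (fun ρ h => h.2)
          (hpath.injOn.mono fun ρ h => h.1) (Set.finite_Iic N)
      obtain ⟨B, hB⟩ := (hfin.image fun ρ => (markedDeref ρ).length).bddAbove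
      exact ⟨B, fun ρ h₁ h₂ => hB ⟨ρ, ⟨h₁, h₂⟩, rfl⟩⟩
    let f : ℕ → List A := fun n => markedDeref (r₀ ++ wordPow c n)
    have hf : ∀ m, B < m → ∃ n, f n = altWord a b m := by
      intro m hm
      have hmem : altWord a b m ∈ (expr α hα).language := (hL _ (by
        rw [← List.length_pos_iff, length_altWord]; omega)).2 (by simp)
      obtain ⟨ρ, hρ, hρm⟩ := mem_language_iff_markedDeref.1 hmem
      rcases hN ρ hρ with h | ⟨n, rfl⟩
      · have := hB ρ hρ h
        rw [hρm, length_altWord] at this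
        omega
      · exact ⟨n, by rw [← hρm, markedDeref_append_brackets _ hγ]⟩
    have hstep : ∀ n, f n <+: f (n + 1) := by
      intro n
      change markedDeref _ <+: markedDeref _
      rw [wordPow_succ', ← List.append_assoc]
      exact markedDeref_prefix _ _
    have hmono : Monotone fun n => (f n).length :=
      monotone_nat_of_le_succ fun n => (hstep n).length_le
    have hpre : ∀ m n, m ≤ n → f m <+: f n := by
      intro m n h
      induction n, h using Nat.le_induction with
      | base => exact List.prefix_rfl
      | succ n _ ih => exact ih.trans (hstep n)
    have halt : ∀ n, f n = altWord a b (f n).length := by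
      intro n
      obtain ⟨n', hn'⟩ := hf (B + (f n).length + 1) (by omega)
      have hlen := congrArg List.length hn'
      rw [length_altWord] at hlen
      have hnn : n ≤ n' := by
        by_contra! hlt
        have := hmono hlt.le
        simp only at this
        omega
      exact eq_altWord_of_prefix (hn' ▸ hpre n n' hnn)
    -- No length above `B` is skipped: the alternating word one letter longer than `f n` is some `f
    -- n'`, necessarily with `n' > n`.
    have hslow : ∀ n, B ≤ (f n).length → (f (n + 1)).length ≤ (f n).length + 1 := by
      intro n hn
      obtain ⟨n', hn'⟩ := hf ((f n).length + 1) (by omega)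
      have hlen := congrArg List.length hn'
      rw [length_altWord] at hlen
      have hnn : n < n' := by
        by_contra! hlt
        have := hmono hlt
        simp only at this
        omega
      have := hmono (Nat.succ_le_of_lt hnn)
      simp only [Nat.succ_eq_add_one] at this
      omega
    obtain ⟨k, hk⟩ := hf (B + 1) (by omega)
    have hkl := congrArg List.length hk
    rw [length_altWord] at hkl
    -- Lengths are unbounded, so growth recurs. The index is shifted by one to leave room for a
    -- preceding pass that is also known to be slow.
    obtain ⟨n, hkn, hn⟩ : ∃ n, k ≤ n ∧ (f (n + 1)).length < (f (n + 2)).length := by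
      by_contra! hcon
      have hconst : ∀ j, (f (k + 1 + j)).length ≤ (f (k + 1)).length := by
        intro j
        induction j with
        | zero => exact le_rfl
        | succ j ih =>
          have := hcon (k + j) (by omega)
          rw [show k + j + 2 = k + 1 + (j + 1) by ring, show k + j + 1 = k + 1 + j by ring] at this
          exact this.trans ih
      obtain ⟨n', hn'⟩ := hf (B + (f (k + 1)).length + 1) (by omega)
      have hlen := congrArg List.length hn'
      rw [length_altWord] at hlen
      have h1 := hmono (show n' ≤ k + 1 + n' by omega)
      have h2 := hconst n'
      simp only at h1
      omega
    have hrun : ∀ n, derefRun (derefRun (derefInit A X) (r₀ ++ wordPow c n)) c =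
        derefRun (derefInit A X) (r₀ ++ wordPow c (n + 1)) := by
      intro n
      rw [wordPow_succ', ← List.append_assoc, derefRun_append _ (r₀ ++ wordPow c n)]
    have hge : ∀ m, k ≤ m → B ≤ (f m).length := by
      intro m hm
      have := hmono hm
      simp only at this
      omega
    have hs := hslow (n + 1) (hge _ (by omega))
    obtain ⟨d, hd₂, hd₁ | hd₃⟩ := repeat_of_passes hc (hrun n) (hrun (n + 1)) (hrun (n + 2))
      (hslow n (hge _ hkn)) (le_antisymm hs hn) (hslow (n + 2) (hge _ (by omega)))
    · have h := halt (n + 2)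
      change f (n + 2) = f (n + 1) ++ [d] at hd₂
      change f (n + 1) = f n ++ [d] at hd₁
      rw [hd₂, hd₁, List.append_assoc] at h
      exact altWord_ne_repeat hab _ _ h
    · have h := halt (n + 3)
      change f (n + 2) = f (n + 1) ++ [d] at hd₂
      change f (n + 3) = f (n + 2) ++ [d] at hd₃
      rw [hd₃, hd₂, List.append_assoc] at h
      exact altWord_ne_repeat hab _ _ h

end Regex

/-! ### Deterministic regular expressions -/

namespace RegexExpr

variable {A X : Type*}

/-- The expression generates the empty word. -/
def Nullable : RegexExpr A X → Prop
  | eps => True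
  | term _ => False
  | ref _ => False
  | cat α β => α.Nullable ∧ β.Nullable
  | alt α β => α.Nullable ∨ β.Nullable
  | plus α => α.Nullable
  | bind _ _ => False

/-- The letters with which marked ref-words may begin. -/
def First : RegexExpr A X → ℕ → RefSym A X × ℕ → Prop
  | eps, _, _ => False
  | term a, n, c => c = (.term a, n)
  | ref x, n, c => c = (.ref x, n)
  | cat α β, n, c => α.First n c ∨ α.Nullable ∧ β.First (n + α.numOcc) c
  | alt α β, n, c => α.First n c ∨ β.First (n + α.numOcc) c
  | plus α, n, c => α.First n c
  | bind x _, n, c => c = (.opn x, n)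

/-- The letters with which marked ref-words may end. -/
def Last : RegexExpr A X → ℕ → RefSym A X × ℕ → Prop
  | eps, _, _ => False
  | term a, n, c => c = (.term a, n)
  | ref x, n, c => c = (.ref x, n)
  | cat α β, n, c => β.Last (n + α.numOcc) c ∨ β.Nullable ∧ α.Last n c
  | alt α β, n, c => α.Last n c ∨ β.Last (n + α.numOcc) c
  | plus α, n, c => α.Last n c
  | bind x α, n, c => c = (.cls x, n + 1 + α.numOcc)

/-- The pairs of letters that may be adjacent in marked ref-words. -/
def Follow : RegexExpr A X → ℕ → RefSym A X × ℕ → RefSym A X × ℕ → Prop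
  | eps, _, _, _ => False
  | term _, _, _, _ => False
  | ref _, _, _, _ => False
  | cat α β, n, c, d => α.Follow n c d ∨ β.Follow (n + α.numOcc) c d ∨
      α.Last n c ∧ β.First (n + α.numOcc) d
  | alt α β, n, c, d => α.Follow n c d ∨ β.Follow (n + α.numOcc) c d
  | plus α, n, c, d => α.Follow n c d ∨ α.Last n c ∧ α.First n d
  | bind x α, n, c, d => α.Follow (n + 1) c d ∨ c = (.opn x, n) ∧ α.First (n + 1) d ∨
      α.Last (n + 1) c ∧ d = (.cls x, n + 1 + α.numOcc) ∨
      α.Nullable ∧ c = (.opn x, n) ∧ d = (.cls x, n + 1 + α.numOcc)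

/-- The word has the given first and last letters and pairs of adjacent letters. -/
structure Fits (nul : Prop) (fst lst : RefSym A X × ℕ → Prop)
    (fol : RefSym A X × ℕ → RefSym A X × ℕ → Prop) (w : List (RefSym A X × ℕ)) : Prop where
  nul : w = [] → nul
  fst : ∀ c ∈ w.head?, fst c
  lst : ∀ c ∈ w.getLast?, lst c
  fol : w.IsChain fol

theorem fits_singleton (c : RefSym A X × ℕ) (fol : RefSym A X × ℕ → RefSym A X × ℕ → Prop) :
    Fits False (· = c) (· = c) fol [c] :=
  ⟨by simp, by simp, by simp, by simp⟩

theorem Fits.append {nul₁ nul₂ : Prop} {fst₁ lst₁ fst₂ lst₂ : RefSym A X × ℕ → Prop}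
    {fol₁ fol₂ fol : RefSym A X × ℕ → RefSym A X × ℕ → Prop} {u v : List (RefSym A X × ℕ)}
    (hu : Fits nul₁ fst₁ lst₁ fol₁ u) (hv : Fits nul₂ fst₂ lst₂ fol₂ v)
    (h₁ : ∀ c d, fol₁ c d → fol c d) (h₂ : ∀ c d, fol₂ c d → fol c d)
    (h : ∀ c d, lst₁ c → fst₂ d → fol c d) :
    Fits (nul₁ ∧ nul₂) (fun c => fst₁ c ∨ nul₁ ∧ fst₂ c) (fun c => lst₂ c ∨ nul₂ ∧ lst₁ c) fol
      (u ++ v) where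
  nul hw := by
    rw [List.append_eq_nil_iff] at hw
    exact ⟨hu.nul hw.1, hv.nul hw.2⟩
  fst c hc := by
    rcases u with _ | ⟨d, u⟩
    · exact Or.inr ⟨hu.nul rfl, hv.fst c (by simpa using hc)⟩
    · exact Or.inl (hu.fst c (by simpa using hc))
  lst c hc := by
    rcases List.eq_nil_or_concat v with rfl | ⟨v', d, rfl⟩
    · exact Or.inr ⟨hv.nul rfl, hu.lst c (by simpa using hc)⟩
    · exact Or.inl (hv.lst c (by simpa [List.getLast?_append] using hc))
  fol := List.isChain_append.2 ⟨hu.fol.imp h₁, hv.fol.imp h₂,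
    fun c hc d hd => h c d (hu.lst c hc) (hv.fst d hd)⟩

theorem Fits.imp {nul nul' : Prop} {fst lst fst' lst' : RefSym A X × ℕ → Prop}
    {fol fol' : RefSym A X × ℕ → RefSym A X × ℕ → Prop} {w : List (RefSym A X × ℕ)}
    (h : Fits nul fst lst fol w) (hn : nul → nul') (hf : ∀ c, fst c → fst' c)
    (hl : ∀ c, lst c → lst' c) (ho : ∀ c d, fol c d → fol' c d) : Fits nul' fst' lst' fol' w :=
  ⟨fun e => hn (h.nul e), fun c hc => hf c (h.fst c hc), fun c hc => hl c (h.lst c hc),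
    h.fol.imp ho⟩

/-- Only this inclusion is needed: determinism quantifies over marked ref-words, so overestimating
the adjacent pairs does no harm. -/
theorem fits (α : RegexExpr A X) (n : ℕ) {w : List (RefSym A X × ℕ)}
    (hw : w ∈ α.markedRefLangFrom n) : Fits α.Nullable (α.First n) (α.Last n) (α.Follow n) w := by
  induction α generalizing n w with
  | eps => rw [Set.mem_singleton_iff.1 hw]; exact ⟨fun _ => trivial, by simp, by simp, by simp⟩
  | term a => rw [Set.mem_singleton_iff.1 hw]; exact fits_singleton _ _
  | ref x => rw [Set.mem_singleton_iff.1 hw]; exact fits_singleton _ _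
  | cat α β ihα ihβ =>
    obtain ⟨u, hu, v, hv, rfl⟩ := hw
    exact (ihα n hu).append (ihβ _ hv) (fun _ _ => Or.inl) (fun _ _ h => Or.inr (Or.inl h))
      fun _ _ h₁ h₂ => Or.inr (Or.inr ⟨h₁, h₂⟩)
  | alt α β ihα ihβ =>
    rcases hw with hw | hw
    · exact (ihα n hw).imp Or.inl (fun _ => Or.inl) (fun _ => Or.inl) (fun _ _ => Or.inl)
    · exact (ihβ _ hw).imp Or.inr (fun _ => Or.inr) (fun _ => Or.inr) (fun _ _ => Or.inr)
  | plus α ih =>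
    obtain ⟨L, h0, rfl, hL⟩ := Language.mem_mul_kstar_iff.1 hw
    clear hw
    induction L with
    | nil => exact (h0 rfl).elim
    | cons u L ihL =>
      simp only [List.mem_cons, forall_eq_or_imp] at hL
      have hu := (ih n hL.1).imp (nul' := α.plus.Nullable) (fst' := α.plus.First n)
        (lst' := α.plus.Last n) (fol' := α.plus.Follow n) id (fun _ => id) (fun _ => id)
        (fun _ _ => Or.inl)
      by_cases hne : L = []
      · subst hne
        simpa using hu
      · rw [List.flatten_cons]
        exact (hu.append (ihL hne hL.2) (fun _ _ => id) (fun _ _ => id)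
          fun _ _ h₁ h₂ => Or.inr ⟨h₁, h₂⟩).imp And.left (fun _ h => h.elim id And.right)
          (fun _ h => h.elim id And.right) (fun _ _ => id)
  | bind x α ih =>
    obtain ⟨u', ⟨o, ho, u, hu, rfl⟩, e, he, rfl⟩ := hw
    rw [Set.mem_singleton_iff.1 ho, Set.mem_singleton_iff.1 he]
    refine (((fits_singleton (.opn x, n) (fun _ _ => False)).append (ih _ hu)
      (fol := fun c d => α.Follow (n + 1) c d ∨ c = (.opn x, n) ∧ α.First (n + 1) d)
      (fun _ _ h => h.elim) (fun _ _ => Or.inl) (fun _ _ h₁ h₂ => Or.inr ⟨h₁, h₂⟩)).append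
      (fits_singleton (.cls x, n + 1 + α.numOcc) (fun _ _ => False))
      (fol := (α.bind x).Follow n) ?_ (fun _ _ h => h.elim) ?_).imp ?_ ?_ ?_ (fun _ _ => id)
    · rintro c d (h | h)
      · exact Or.inl h
      · exact Or.inr (Or.inl h)
    · rintro c d (h | ⟨h, h'⟩) hd
      · exact Or.inr (Or.inr (Or.inl ⟨h, hd⟩))
      · exact Or.inr (Or.inr (Or.inr ⟨h, h', hd⟩))
    · exact fun h => h.1.1.elim
    · rintro c ((h | h) | h)
      · exact h
      · exact h.1.elim
      · exact h.1.1.elim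
    · rintro c (h | h)
      · exact h
      · exact h.1.elim

/-- The next letter, with the previous one given as an option. -/
def Next (α : RegexExpr A X) : Option (RefSym A X × ℕ) → RefSym A X × ℕ → Prop
  | none, c => α.First 1 c
  | some p, c => α.Follow 1 p c

theorem next_of_mem {α : RegexExpr A X} {r s : List (RefSym A X × ℕ)} {c : RefSym A X × ℕ}
    (h : r ++ c :: s ∈ α.markedRefLangFrom 1) : α.Next r.getLast? c := by
  have hf := α.fits 1 h
  rcases List.eq_nil_or_concat r with rfl | ⟨r', d, rfl⟩
  · exact hf.fst c (by simp)
  · have := hf.fol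
    rw [List.isChain_append] at this
    simpa [Next] using this.2.2 d (by simp) c (by simp)

/-- The language of an expression without variables, read as a regular expression. -/
def plainLang : RegexExpr A X → Language A
  | eps => 1
  | term a => {[a]}
  | ref _ => 0
  | cat α β => α.plainLang * β.plainLang
  | alt α β => α.plainLang + β.plainLang
  | plus α => α.plainLang * KStar.kstar α.plainLang
  | bind _ _ => 0

theorem refLang_eq_map_plainLang {α : RegexExpr A X} (h : α.vars = ∅) :
    α.refLang = α.plainLang.map RefSym.term := by
  induction α with
  | eps => exact (map_one _).symm
  | term a => exact (Set.image_singleton (f := List.map RefSym.term) (a := [a])).symm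
  | ref x => simp [vars] at h
  | cat α β ihα ihβ =>
    rw [vars, Set.union_empty_iff] at h
    rw [refLang, plainLang, map_mul, ihα h.1, ihβ h.2]
  | alt α β ihα ihβ =>
    rw [vars, Set.union_empty_iff] at h
    rw [refLang, plainLang, map_add, ihα h.1, ihβ h.2]
  | plus α ih => rw [refLang, plainLang, map_mul, Language.map_kstar, ih h]
  | bind x α ih => exact absurd h (Set.union_singleton.trans_ne (Set.insert_nonempty x _).ne_empty)

theorem wellFormed_of_vars_eq_empty {α : RegexExpr A X} (h : α.vars = ∅) : α.WellFormed := by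
  induction α with
  | cat α β ihα ihβ =>
    rw [vars, Set.union_empty_iff] at h
    exact ⟨ihα h.1, ihβ h.2⟩
  | alt α β ihα ihβ =>
    rw [vars, Set.union_empty_iff] at h
    exact ⟨ihα h.1, ihβ h.2⟩
  | plus α ih => exact ih h
  | bind x α ih => exact absurd h (Set.union_singleton.trans_ne (Set.insert_nonempty x _).ne_empty)
  | _ => trivial

theorem deref_map_term (w : List A) : deref (w.map (RefSym.term : A → RefSym A X)) = w := by
  have : ∀ s : DerefState A X, ((w.map RefSym.term).foldl DerefState.step s).out = s.out ++ w := by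
    induction w with
    | nil => simp
    | cons a w ih => intro s; simp [ih, DerefState.step]
  exact this _

theorem language_eq_plainLang {α : RegexExpr A X} (h : α.vars = ∅) (hα : α.WellFormed) :
    (Regex.expr α hα).language = α.plainLang := by
  ext w
  constructor
  · rintro ⟨r, hr, rfl⟩
    change r ∈ α.refLang at hr
    rw [refLang_eq_map_plainLang h] at hr
    obtain ⟨u, hu, rfl⟩ := hr
    rwa [deref_map_term]
  · intro hw
    refine ⟨w.map RefSym.term, ?_, deref_map_term w⟩
    change _ ∈ α.refLang
    rw [refLang_eq_map_plainLang h]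
    exact ⟨w, hw, rfl⟩

theorem exists_term_of_mem_letters {α : RegexExpr A X} (h : α.vars = ∅) {c : RefSym A X × ℕ}
    {n : ℕ} (hc : c ∈ (α.markedRefLangFrom n).letters) : ∃ a, c.1 = .term a := by
  obtain ⟨ρ, hρ, hc⟩ := hc
  have hr : ρ.map Prod.fst ∈ α.refLang := by
    rw [← α.map_markedRefLangFrom n]
    exact ⟨ρ, hρ, rfl⟩
  rw [refLang_eq_map_plainLang h] at hr
  obtain ⟨u, -, hu⟩ := hr
  have : c.1 ∈ u.map RefSym.term := by rw [hu]; exact List.mem_map_of_mem hc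
  obtain ⟨a, -, ha⟩ := List.mem_map.1 this
  exact ⟨a, ha.symm⟩

/-- Glushkov's criterion for determinism. -/
theorem deterministic_of_next {α : RegexExpr A X} (h : α.vars = ∅) (hα : α.WellFormed)
    (hn : ∀ p a i j, α.Next p (.term a, i) → α.Next p (.term a, j) → i = j) :
    (Regex.expr α hα).Deterministic := by
  rintro ⟨ρ₁, h₁, ρ₂, h₂, r, γ₁, γ₂, hγ₁, hγ₂, hc⟩
  change ρ₁ ∈ α.markedRefLangFrom 1 at h₁
  change ρ₂ ∈ α.markedRefLangFrom 1 at h₂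
  have hnil : ∀ (ρ γ s : List (RefSym A X × ℕ)), ρ ∈ α.markedRefLangFrom 1 →
      (∀ c ∈ γ, c.1.IsBracket) → ρ = r ++ γ ++ s → γ = [] := by
    rintro ρ γ s hρ hγ rfl
    refine List.eq_nil_iff_forall_not_mem.2 fun c hc => ?_
    obtain ⟨a, ha⟩ := exists_term_of_mem_letters (c := c) h ⟨_, hρ, by simp [hc]⟩
    have := hγ c hc
    rw [ha] at this
    exact this
  rcases hc with ⟨a, i, j, s₁, s₂, hij, e₁, e₂⟩ | ⟨x, χ, i, j, s₁, s₂, hχ, hij, e₁, e₂⟩ |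
    ⟨χ, i, s₁, s₂, hχ, hne, e₁, e₂⟩ | ⟨hne, e₁, e₂⟩
  · have g₁ := hnil _ _ _ h₁ hγ₁ e₁
    have g₂ := hnil _ _ _ h₂ hγ₂ e₂
    subst g₁ g₂ e₁ e₂
    rw [List.append_nil] at h₁ h₂
    exact hij (hn _ _ _ _ (next_of_mem h₁) (next_of_mem h₂))
  · obtain ⟨a, ha⟩ := exists_term_of_mem_letters (c := (.ref x, i)) h ⟨_, h₁, by simp [e₁]⟩
    cases ha
  · exact hne ((hnil _ _ _ h₁ hγ₁ e₁).trans (hnil _ _ _ h₂ hγ₂ e₂).symm)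
  · exact hne ((hnil _ _ [] h₁ hγ₁ (by simpa using e₁)).trans
      (hnil _ _ [] h₂ hγ₂ (by simpa using e₂)).symm)

theorem plainLang_mem_dregLanguages {α : RegexExpr A X} (h : α.vars = ∅)
    (hn : ∀ p a i j, α.Next p (.term a, i) → α.Next p (.term a, j) → i = j) :
    α.plainLang ∈ dregLanguages A X :=
  ⟨.expr α (wellFormed_of_vars_eq_empty h), h, deterministic_of_next h _ hn,
    language_eq_plainLang h _⟩

end RegexExpr

theorem dregLanguages_subset_drxLanguages (A X : Type*) :
    dregLanguages A X ⊆ drxLanguages A X := fun _ ⟨α, _, hd, hL⟩ => ⟨α, hd, hL⟩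

/-! ### Deterministic regular expressions for the test languages -/

section Memberships

open RegexExpr

variable {A X : Type*} {a b : A}

/-- A star is expressed as `ε ∨ α⁺`. Here and below, Glushkov's criterion holds because occurrences
that compete for the next position carry different letters. -/
theorem kstar_mem_dregLanguages (hab : a ≠ b) :
    KStar.kstar (({[a]} : Language A) * {[b]}) ∈ dregLanguages A X := by
  have h : ((alt eps (plus (cat (term a) (term b))) : RegexExpr A X).plainLang) =
      KStar.kstar (({[a]} : Language A) * {[b]}) := Language.one_add_self_mul_kstar_eq_kstar _
  rw [← h]
  refine plainLang_mem_dregLanguages (by simp [vars]) ?_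
  rintro (_ | p) c i j h₁ h₂ <;>
    simp [Next, First, Follow, Last, Nullable, numOcc] at h₁ h₂ <;> grind

theorem singleton_mul_kstar_mem_dregLanguages (hab : a ≠ b) :
    ({[a]} : Language A) * KStar.kstar (({[b]} : Language A) * {[a]}) ∈ dregLanguages A X := by
  have h : ((cat (term a) (alt eps (plus (cat (term b) (term a)))) : RegexExpr A X).plainLang) =
      ({[a]} : Language A) * KStar.kstar (({[b]} : Language A) * {[a]}) :=
    congrArg _ (Language.one_add_self_mul_kstar_eq_kstar _)
  rw [← h]
  refine plainLang_mem_dregLanguages (by simp [vars]) ?_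
  rintro (_ | p) c i j h₁ h₂ <;>
    simp [Next, First, Follow, Last, Nullable, numOcc] at h₁ h₂ <;> grind

theorem one_add_mem_dregLanguages (a : A) : 1 + ({[a]} : Language A) ∈ dregLanguages A X := by
  refine plainLang_mem_dregLanguages (α := alt eps (term a)) (by simp [vars]) ?_
  rintro (_ | p) c i j h₁ h₂ <;>
    simp [Next, First, Follow] at h₁ h₂
  rw [h₁.2, h₂.2]

theorem one_add_mul_kstar_mem_dregLanguages (hab : a ≠ b) :
    (1 + ({[a]} : Language A)) * KStar.kstar (({[b]} : Language A) * {[a]})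
      ∈ dregLanguages A X := by
  have h : ((cat (alt eps (term a)) (alt eps (plus (cat (term b) (term a)))) :
      RegexExpr A X).plainLang) =
      (1 + ({[a]} : Language A)) * KStar.kstar (({[b]} : Language A) * {[a]}) :=
    congrArg _ (Language.one_add_self_mul_kstar_eq_kstar _)
  rw [← h]
  refine plainLang_mem_dregLanguages (by simp [vars]) ?_
  rintro (_ | p) c i j h₁ h₂ <;>
    simp [Next, First, Follow, Last, Nullable, numOcc] at h₁ h₂ <;> grind

theorem kstar_mul_one_add_mem_dregLanguages (hab : a ≠ b) :
    KStar.kstar ({[a]} : Language A) * (1 + {[b]}) ∈ dregLanguages A X := by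
  have h : ((cat (alt eps (plus (term a))) (alt eps (term b)) : RegexExpr A X).plainLang) =
      KStar.kstar ({[a]} : Language A) * (1 + {[b]}) :=
    congrArg (· * (1 + ({[b]} : Language A))) (Language.one_add_self_mul_kstar_eq_kstar _)
  rw [← h]
  refine plainLang_mem_dregLanguages (by simp [vars]) ?_
  rintro (_ | p) c i j h₁ h₂ <;>
    simp [Next, First, Follow, Last, Nullable, numOcc] at h₁ h₂ <;> grind

theorem kstar_mul_one_add_singleton_mem_dregLanguages (hab : a ≠ b) :
    KStar.kstar (({[a]} : Language A) * (1 + {[b]})) ∈ dregLanguages A X := by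
  have h : ((alt eps (plus (cat (term a) (alt eps (term b)))) : RegexExpr A X).plainLang) =
      KStar.kstar (({[a]} : Language A) * (1 + {[b]})) :=
    Language.one_add_self_mul_kstar_eq_kstar _
  rw [← h]
  refine plainLang_mem_dregLanguages (by simp [vars]) ?_
  rintro (_ | p) c i j h₁ h₂ <;>
    simp [Next, First, Follow, Last, Nullable, numOcc] at h₁ h₂ <;> grind

theorem one_add_mul_kstar_one_add_mem_dregLanguages (hab : a ≠ b) :
    (1 + ({[a]} : Language A)) * KStar.kstar (({[b]} : Language A) * (1 + {[a]}))
      ∈ dregLanguages A X := by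
  have h : ((cat (alt eps (term a)) (alt eps (plus (cat (term b) (alt eps (term a))))) :
      RegexExpr A X).plainLang) =
      (1 + ({[a]} : Language A)) * KStar.kstar (({[b]} : Language A) * (1 + {[a]})) :=
    congrArg _ (Language.one_add_self_mul_kstar_eq_kstar _)
  rw [← h]
  refine plainLang_mem_dregLanguages (by simp [vars]) ?_
  rintro (_ | p) c i j h₁ h₂ <;>
    simp [Next, First, Follow, Last, Nullable, numOcc] at h₁ h₂ <;> grind

/-- The words `ε`, `b` and `bbb`. -/
def shortBlocks (b : A) : Language A := 1 + {[b]} * (1 + {[b]} * {[b]})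

/-- The words in which the maximal blocks of letters other than `a` are short. -/
def blockLanguage (a b : A) : Language A :=
  shortBlocks b * KStar.kstar ({[a]} * shortBlocks b)

theorem blockLanguage_mem_dregLanguages (hab : a ≠ b) :
    blockLanguage a b ∈ dregLanguages A X := by
  have h : ((cat (alt eps (cat (term b) (alt eps (cat (term b) (term b)))))
      (alt eps (plus (cat (term a) (alt eps (cat (term b) (alt eps (cat (term b) (term b)))))))) :
      RegexExpr A X).plainLang) = blockLanguage a b :=
    congrArg _ (Language.one_add_self_mul_kstar_eq_kstar _)
  rw [← h]
  refine plainLang_mem_dregLanguages (by simp [vars]) ?_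
  rintro (_ | p) c i j h₁ h₂ <;>
    simp [Next, First, Follow, Last, Nullable, numOcc] at h₁ h₂ <;> grind

end Memberships

/-! ### Deterministic regex: failure of closure -/

section

variable {A X : Type*} {a b : A}

theorem Language.cons_mem_singleton_mul {c : A} {y : List A} {L : Language A} :
    c :: y ∈ ({[a]} : Language A) * L ↔ c = a ∧ y ∈ L := by
  constructor
  · rintro ⟨u, hu, v, hv, h⟩
    rw [Set.mem_singleton_iff.1 hu] at h
    simp only [List.cons_append, List.nil_append, List.cons.injEq] at h
    exact ⟨h.1.symm, h.2 ▸ hv⟩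
  · rintro ⟨rfl, hy⟩
    exact ⟨[c], rfl, y, hy, rfl⟩

theorem Language.cons_mem_singleton {c : A} {y : List A} :
    c :: y ∈ ({[a]} : Language A) ↔ c = a ∧ y = [] := by
  refine Set.mem_singleton_iff.trans ?_
  simp

theorem Language.mem_kstar_iff {S : Language A} {w : List A} :
    w ∈ KStar.kstar S ↔ w = [] ∨ w ∈ S * KStar.kstar S := by
  conv_lhs => rw [← Language.one_add_self_mul_kstar_eq_kstar]
  rfl

theorem Language.cons_mem_kstar_singleton_mul {c : A} {y : List A} {S : Language A} :
    c :: y ∈ KStar.kstar ({[a]} * S) ↔ c = a ∧ y ∈ S * KStar.kstar ({[a]} * S) := by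
  rw [Language.mem_kstar_iff, mul_assoc, Language.cons_mem_singleton_mul]
  simp

theorem Language.mem_one_add_mul {S T : Language A} {w : List A} :
    w ∈ (1 + S) * T ↔ w ∈ T ∨ w ∈ S * T := by
  rw [add_mul, one_mul]
  rfl

theorem cons_eq_altWord {c : A} {y : List A} :
    c :: y = altWord a b (c :: y).length ↔ c = a ∧ y = altWord b a y.length := by
  simp [altWord]

/-- Removing the first letter interchanges `a` with `b` and at the same time the two summands, which
carries the induction. -/
theorem mem_kstar_add_iff {w : List A} : w ∈ KStar.kstar (({[a]} : Language A) * {[b]}) +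
    {[a]} * KStar.kstar (({[b]} : Language A) * {[a]}) ↔ w = altWord a b w.length := by
  induction w generalizing a b with
  | nil => exact iff_of_true (Or.inl (Language.nil_mem_kstar _)) rfl
  | cons c y ih =>
    rw [cons_eq_altWord, ← ih, Language.mem_add, Language.mem_add,
      Language.cons_mem_kstar_singleton_mul, Language.cons_mem_singleton_mul]
    tauto

theorem mem_kstar_mul_iff {w : List A} :
    w ∈ KStar.kstar (({[a]} : Language A) * {[b]}) * (1 + {[a]}) ↔ w = altWord a b w.length := by
  set M := KStar.kstar (({[a]} : Language A) * {[b]}) * (1 + {[a]}) with hM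
  have hrec : M = (1 + {[a]}) + {[a]} * ({[b]} * M) := by
    conv_lhs => rw [hM, ← Language.one_add_self_mul_kstar_eq_kstar, add_mul]
    simp only [hM, one_mul, mul_assoc]
  -- The second conjunct describes what may remain after a leading `a`: nothing, or an alternating
  -- word that starts with `b`.
  suffices (w ∈ M ↔ w = altWord a b w.length) ∧
      (w = [] ∨ w ∈ ({[b]} : Language A) * M ↔ w = altWord b a w.length) from this.1
  induction w with
  | nil => exact ⟨iff_of_true ⟨[], Language.nil_mem_kstar _, [], Or.inl rfl, rfl⟩ rfl,
      iff_of_true (Or.inl rfl) rfl⟩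
  | cons c y ih =>
    rw [cons_eq_altWord, cons_eq_altWord, ← ih.1, ← ih.2, Language.cons_mem_singleton_mul]
    refine ⟨?_, by simp⟩
    conv_lhs => rw [hrec]
    rw [Language.mem_add, Language.mem_add, Language.cons_mem_singleton_mul,
      Language.cons_mem_singleton, Language.mem_one]
    simp only [reduceCtorEq, false_or]
    tauto

/-- The first language forbids a leading `b` and the factor `bb`, the second forbids `aa`, and both
forbid other letters. -/
theorem mem_kstar_inf_iff (hab : a ≠ b) {w : List A} :
    w ∈ KStar.kstar (({[a]} : Language A) * (1 + {[b]})) ∧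
      w ∈ (1 + ({[a]} : Language A)) * KStar.kstar (({[b]} : Language A) * (1 + {[a]})) ↔
        w = altWord a b w.length := by
  induction w generalizing a b with
  | nil => exact iff_of_true ⟨Language.nil_mem_kstar _,
      [], Or.inl rfl, [], Language.nil_mem_kstar _, rfl⟩ rfl
  | cons c y ih =>
    rw [cons_eq_altWord, ← ih hab.symm]
    simp only [Language.cons_mem_kstar_singleton_mul, Language.mem_one_add_mul,
      Language.cons_mem_singleton_mul]
    constructor
    · rintro ⟨⟨rfl, h₁⟩, ⟨h₂, -⟩ | ⟨-, h₂⟩⟩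
      · exact (hab h₂).elim
      · exact ⟨rfl, h₂, h₁⟩
    · rintro ⟨rfl, h₂, h₁⟩
      exact ⟨⟨rfl, h₁⟩, Or.inr ⟨rfl, h₂⟩⟩

theorem mem_kstar_singleton_iff {c : A} {w : List A} :
    w ∈ KStar.kstar ({[c]} : Language A) ↔ ∃ n, w = List.replicate n c := by
  induction w with
  | nil => exact iff_of_true (Language.nil_mem_kstar _) ⟨0, rfl⟩
  | cons d w ih =>
    rw [Language.mem_kstar_iff, Language.cons_mem_singleton_mul, ih]
    constructor
    · rintro (h | ⟨rfl, n, rfl⟩)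
      · cases h
      · exact ⟨n + 1, rfl⟩
    · rintro ⟨n, hn⟩
      cases n with
      | zero => cases hn
      | succ n =>
        rw [List.replicate_succ, List.cons.injEq] at hn
        exact Or.inr ⟨hn.1, n, hn.2⟩

open Classical in
/-- The homomorphism that maps `a` to `ab`, `b` to `a` and other letters to `ε`. -/
noncomputable def alternatingHom (a b : A) (c : A) : List A :=
  if c = a then [a, b] else if c = b then [a] else []

theorem mem_alternatingHom_iff (hab : a ≠ b) {w : List A} :
    (∃ u ∈ KStar.kstar ({[a]} : Language A) * (1 + {[b]}), u.flatMap (alternatingHom a b) = w) ↔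
      w = altWord a b w.length := by
  have ha : alternatingHom a b a = [a, b] := by simp [alternatingHom]
  have hb : alternatingHom a b b = [a] := by simp [alternatingHom, hab.symm]
  have hrep : ∀ n m, (List.replicate n a).flatMap (alternatingHom a b) ++ altWord a b m =
      altWord a b (2 * n + m) := by
    intro n m
    induction n with
    | zero => simp
    | succ n ih =>
      rw [show 2 * (n + 1) + m = 2 * n + m + 1 + 1 by ring, List.replicate_succ,
        List.flatMap_cons, ha, List.append_assoc, ih]
      rfl
  constructor
  · rintro ⟨u, ⟨v, hv, t, ht, rfl⟩, rfl⟩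
    obtain ⟨n, rfl⟩ := mem_kstar_singleton_iff.1 hv
    have : ∃ m, t.flatMap (alternatingHom a b) = altWord a b m := by
      rcases ht with ht | ht
      · rw [Set.mem_singleton_iff.1 ht]; exact ⟨0, rfl⟩
      · rw [Set.mem_singleton_iff.1 ht]; exact ⟨1, by simp [hb, altWord]⟩
    obtain ⟨m, hm⟩ := this
    simp only [List.flatMap_append, hm, hrep, length_altWord]
  · intro hw
    obtain ⟨n, hn | hn⟩ := Nat.even_or_odd' w.length
    · refine ⟨_, ⟨_, mem_kstar_singleton_iff.2 ⟨n, rfl⟩, [], Or.inl rfl, rfl⟩, ?_⟩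
      rw [hw, hn]
      simpa [altWord] using hrep n 0
    · refine ⟨_, ⟨_, mem_kstar_singleton_iff.2 ⟨n, rfl⟩, [b], Or.inr rfl, rfl⟩, ?_⟩
      rw [hw, hn, ← hrep n 1]
      simp [altWord, hb]

open Classical in
/-- The homomorphism that maps `a` to `bab`, `b` to `bba` and other letters to `bbbb`. -/
noncomputable def blockHom (a b : A) (c : A) : List A :=
  if c = a then [b, a, b] else if c = b then [b, b, a] else [b, b, b, b]

/-- A leading `b` and the factors `aa` and `bb` create a block `bb` in the image, and any other
letter creates a block of length at least four. The factors `ab` and `ba` create only the admissible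
blocks `bbb` and `b`. -/
theorem flatMap_blockHom_mem_iff (hab : a ≠ b) {w : List A} :
    w.flatMap (blockHom a b) ∈ blockLanguage a b ↔ w = altWord a b w.length := by
  set G := KStar.kstar (({[a]} : Language A) * shortBlocks b) with hG
  have hba := hab.symm
  have hmem : ∀ c y, c :: y ∈ G ↔ c = a ∧ y ∈ blockLanguage a b := fun c y =>
    Language.cons_mem_kstar_singleton_mul
  have hL : ∀ w, w ∈ blockLanguage a b ↔
      w ∈ G ∨ w ∈ ({[b]} : Language A) * G ∨ w ∈ ({[b]} : Language A) * ({[b]} * ({[b]} * G)) := by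
    intro w
    rw [blockLanguage, ← hG, shortBlocks, Language.mem_one_add_mul, mul_assoc, add_mul, one_mul,
      mul_add, mul_assoc]
    rfl
  -- The second conjunct is the situation after the image of an `a`, whose final `b` has opened a
  -- block: the rest must complete it to length one or three.
  suffices (w.flatMap (blockHom a b) ∈ blockLanguage a b ↔ w = altWord a b w.length) ∧
      (w.flatMap (blockHom a b) ∈ G ∨
        w.flatMap (blockHom a b) ∈ ({[b]} : Language A) * ({[b]} * G) ↔
          w = altWord b a w.length) from this.1
  induction w with
  | nil => exact ⟨iff_of_true ((hL _).2 (Or.inl (Language.nil_mem_kstar _))) rfl,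
      iff_of_true (Or.inl (Language.nil_mem_kstar _)) rfl⟩
  | cons c y ih =>
    rw [cons_eq_altWord, cons_eq_altWord, ← ih.1, ← ih.2]
    by_cases hca : c = a
    · subst hca
      simp [blockHom, hL, hmem, Language.cons_mem_singleton_mul, hab, hba]
    · by_cases hcb : c = b
      · subst hcb
        simp [blockHom, hL, hmem, Language.cons_mem_singleton_mul, hab, hba]
      · simp [blockHom, hL, hmem, Language.cons_mem_singleton_mul, hca, hcb, hba]

theorem not_closedUnderUnion_drxLanguages (hab : a ≠ b) :
    ¬ ClosedUnderUnion (drxLanguages A X) := fun h =>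
  Regex.not_mem_drxLanguages_of_alternating hab (fun _ _ => mem_kstar_add_iff)
    (h _ (dregLanguages_subset_drxLanguages A X (kstar_mem_dregLanguages hab))
      _ (dregLanguages_subset_drxLanguages A X (singleton_mul_kstar_mem_dregLanguages hab)))

theorem not_closedUnderConcatenation_drxLanguages (hab : a ≠ b) :
    ¬ ClosedUnderConcatenation (drxLanguages A X) := fun h =>
  Regex.not_mem_drxLanguages_of_alternating hab (fun _ _ => mem_kstar_mul_iff)
    (h _ (dregLanguages_subset_drxLanguages A X (kstar_mem_dregLanguages hab))
      _ (dregLanguages_subset_drxLanguages A X (one_add_mem_dregLanguages a)))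

theorem Language.reverse_singleton (w : List A) :
    ({w} : Language A).reverse = {w.reverse} := by
  ext u
  refine Set.mem_singleton_iff.trans (Iff.trans ?_ Set.mem_singleton_iff.symm)
  exact List.reverse_eq_iff

theorem not_closedUnderReversal_drxLanguages (hab : a ≠ b) :
    ¬ ClosedUnderReversal (drxLanguages A X) := by
  intro h
  have h1 := h _ (dregLanguages_subset_drxLanguages A X (one_add_mul_kstar_mem_dregLanguages hab))
  rw [Language.reverse_mul, Language.reverse_kstar, Language.reverse_mul, Language.reverse_add,
    Language.reverse_one, Language.reverse_singleton, Language.reverse_singleton] at h1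
  exact Regex.not_mem_drxLanguages_of_alternating hab (fun _ _ => mem_kstar_mul_iff) h1

theorem not_closedUnderHomomorphism_drxLanguages (hab : a ≠ b) :
    ¬ ClosedUnderHomomorphism (drxLanguages A X) := fun h =>
  Regex.not_mem_drxLanguages_of_alternating hab (fun _ _ => mem_alternatingHom_iff hab)
    (h _ _ (dregLanguages_subset_drxLanguages A X (kstar_mul_one_add_mem_dregLanguages hab)))

theorem not_closedUnderInverseHomomorphism_drxLanguages (hab : a ≠ b) :
    ¬ ClosedUnderInverseHomomorphism (drxLanguages A X) := fun h =>
  Regex.not_mem_drxLanguages_of_alternating hab (fun _ _ => flatMap_blockHom_mem_iff hab)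
    (h _ _ (dregLanguages_subset_drxLanguages A X (blockLanguage_mem_dregLanguages hab)))

theorem not_closedUnderIntersectionWith_dregLanguages (hab : a ≠ b) :
    ¬ ClosedUnderIntersectionWith (dregLanguages A X) (drxLanguages A X) := fun h =>
  Regex.not_mem_drxLanguages_of_alternating hab (fun _ _ => mem_kstar_inf_iff hab)
    (h _ (dregLanguages_subset_drxLanguages A X (kstar_mul_one_add_singleton_mem_dregLanguages hab))
      _ (one_add_mul_kstar_one_add_mem_dregLanguages hab))

end

/-! ### A deterministic regex with a variable -/

section

variable {A X : Type*} {a b : A}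

namespace RegexExpr

/-- The expression `⟨x : a⁺⟩ b &x`. -/
def copyExpr (a b : A) (x : X) : RegexExpr A X :=
  .cat (.cat (.bind x (.plus (.term a))) (.term b)) (.ref x)

theorem wellFormed_copyExpr (a b : A) (x : X) : (copyExpr a b x).WellFormed := by
  simp [copyExpr, WellFormed, vars]

theorem next_copyExpr {x : X} {p : Option (RefSym A X × ℕ)} {c : RefSym A X × ℕ}
    (h : (copyExpr a b x).Next p c) : p = none ∧ c = (.opn x, 1) ∨
      p = some (.opn x, 1) ∧ c = (.term a, 2) ∨ p = some (.term a, 2) ∧ c = (.term a, 2) ∨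
      p = some (.term a, 2) ∧ c = (.cls x, 3) ∨ p = some (.cls x, 3) ∧ c = (.term b, 4) ∨
      p = some (.term b, 4) ∧ c = (.ref x, 5) := by
  rcases p with _ | p <;>
    simp [copyExpr, Next, First, Follow, Last, Nullable, numOcc] at h <;> grind

/-- No two brackets are adjacent in these marked ref-words, so a block of brackets has at most one
letter, and the letters on both sides of it determine it. -/
theorem brackets_copyExpr {x : X} {r γ s : List (RefSym A X × ℕ)} {c : RefSym A X × ℕ}
    (h : r ++ γ ++ c :: s ∈ (copyExpr a b x).markedRefLangFrom 1)
    (hγ : ∀ d ∈ γ, d.1.IsBracket) (hc : c.1.IsTermOrRef) :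
    r.getLast? = none ∧ γ = [(.opn x, 1)] ∧ c = (.term a, 2) ∨
    r.getLast? = some (.opn x, 1) ∧ γ = [] ∧ c = (.term a, 2) ∨
    r.getLast? = some (.term a, 2) ∧ γ = [] ∧ c = (.term a, 2) ∨
    r.getLast? = some (.term a, 2) ∧ γ = [(.cls x, 3)] ∧ c = (.term b, 4) ∨
    r.getLast? = some (.cls x, 3) ∧ γ = [] ∧ c = (.term b, 4) ∨
    r.getLast? = some (.term b, 4) ∧ γ = [] ∧ c = (.ref x, 5) := by
  rcases γ with _ | ⟨d, γ⟩
  · rw [List.append_nil] at h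
    have := next_copyExpr (next_of_mem h)
    rcases this with h | h | h | h | h | h <;> simp [h.1, h.2, RefSym.IsTermOrRef] at hc ⊢
  · have hd := hγ d (by simp)
    have m₁ : r ++ d :: (γ ++ c :: s) ∈ (copyExpr a b x).markedRefLangFrom 1 := by simpa using h
    have h₁ := next_copyExpr (next_of_mem m₁)
    rcases γ with _ | ⟨e, γ⟩
    · have h₂ := next_copyExpr (next_of_mem h)
      rw [List.getLast?_concat] at h₂
      rcases h₁ with g | g | g | g | g | g <;>
        simp [g.1, g.2, RefSym.IsBracket] at hd h₂ ⊢ <;> exact h₂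
    · have he := hγ e (by simp)
      have m₂ : r ++ [d] ++ e :: (γ ++ c :: s) ∈ (copyExpr a b x).markedRefLangFrom 1 := by
        simpa using h
      have h₂ := next_copyExpr (next_of_mem m₂)
      rw [List.getLast?_concat] at h₂
      rcases h₁ with g | g | g | g | g | g <;>
        simp [g.2, RefSym.IsBracket] at hd h₂ <;> simp [h₂, RefSym.IsBracket] at he

theorem eq_nil_of_brackets_copyExpr {x : X} {r γ : List (RefSym A X × ℕ)}
    (h : r ++ γ ∈ (copyExpr a b x).markedRefLangFrom 1) (hγ : ∀ d ∈ γ, d.1.IsBracket) :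
    γ = [] := by
  rcases List.eq_nil_or_concat γ with rfl | ⟨γ, d, rfl⟩
  · rfl
  · have h₁ := ((copyExpr a b x).fits 1 h).lst d (by simp [List.getLast?_append])
    have h₂ := hγ d (by simp)
    simp [copyExpr, Last, Nullable] at h₁
    rw [h₁] at h₂
    exact h₂.elim

theorem deterministic_copyExpr (hab : a ≠ b) (x : X) :
    (Regex.expr _ (wellFormed_copyExpr a b x)).Deterministic := by
  rintro ⟨ρ₁, h₁, ρ₂, h₂, r, γ₁, γ₂, hγ₁, hγ₂, hc⟩
  change ρ₁ ∈ (copyExpr a b x).markedRefLangFrom 1 at h₁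
  change ρ₂ ∈ (copyExpr a b x).markedRefLangFrom 1 at h₂
  have hba := hab.symm
  rcases hc with ⟨d, i, j, s₁, s₂, hij, rfl, rfl⟩ | ⟨y, χ, i, j, s₁, s₂, hχ, hij, rfl, rfl⟩ |
    ⟨χ, i, s₁, s₂, hχ, hne, rfl, rfl⟩ | ⟨hne, rfl, rfl⟩
  · have e₁ := brackets_copyExpr h₁ hγ₁ trivial
    have e₂ := brackets_copyExpr h₂ hγ₂ trivial
    simp only [Prod.mk.injEq, RefSym.term.injEq] at e₁ e₂
    grind
  · have e₁ := brackets_copyExpr h₁ hγ₁ trivial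
    have e₂ := brackets_copyExpr h₂ hγ₂ hχ
    simp only [Prod.mk.injEq, reduceCtorEq, false_and, and_false, false_or] at e₁ e₂
    grind
  · have e₁ := brackets_copyExpr h₁ hγ₁ hχ
    have e₂ := brackets_copyExpr h₂ hγ₂ hχ
    grind
  · exact hne ((eq_nil_of_brackets_copyExpr h₁ hγ₁).trans
      (eq_nil_of_brackets_copyExpr h₂ hγ₂).symm)

theorem foldl_step_replicate (a : A) (n : ℕ) (s : DerefState A X) :
    (List.replicate n (RefSym.term a)).foldl DerefState.step s =
      { s with out := s.out ++ List.replicate n a } := by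
  induction n generalizing s with
  | zero => simp
  | succ n ih => simp [List.replicate_succ, ih, DerefState.step]

theorem mem_refLang_copyExpr {x : X} {r : List (RefSym A X)} :
    r ∈ (copyExpr a b x).refLang ↔ ∃ n, r = .opn x :: List.replicate (n + 1) (.term a) ++
      [.cls x, .term b, .ref x] := by
  constructor
  · rintro ⟨_, ⟨_, ⟨_, ⟨o, ho, _, ⟨t, ht, u, hu, rfl⟩, rfl⟩, e, he, rfl⟩, f, hf, rfl⟩, g, hg, rfl⟩
    obtain ⟨n, rfl⟩ := mem_kstar_singleton_iff.1 hu
    rw [Set.mem_singleton_iff.1 ho, Set.mem_singleton_iff.1 ht, Set.mem_singleton_iff.1 he,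
      Set.mem_singleton_iff.1 hf, Set.mem_singleton_iff.1 hg]
    exact ⟨n, by simp [List.replicate_succ]⟩
  · rintro ⟨n, rfl⟩
    exact ⟨_, ⟨_, ⟨_, ⟨_, rfl, _, ⟨_, rfl, _, mem_kstar_singleton_iff.2 ⟨n, rfl⟩, rfl⟩, rfl⟩,
      _, rfl, rfl⟩, _, rfl, rfl⟩, _, rfl, by simp [List.replicate_succ]⟩

theorem mem_language_copyExpr {x : X} {w : List A} :
    w ∈ (Regex.expr _ (wellFormed_copyExpr a b x)).language ↔
      ∃ n, w = List.replicate (n + 1) a ++ b :: List.replicate (n + 1) a := by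
  have key : ∀ n, deref (RefSym.opn x :: List.replicate n (RefSym.term a) ++
      [RefSym.cls x, RefSym.term b, RefSym.ref x]) =
        List.replicate n a ++ b :: List.replicate n a := by
    intro n
    simp [deref, foldl_step_replicate, DerefState.step]
  constructor
  · rintro ⟨r, hr, rfl⟩
    obtain ⟨n, rfl⟩ := mem_refLang_copyExpr.1 hr
    exact ⟨n, key _⟩
  · rintro ⟨n, rfl⟩
    exact ⟨_, mem_refLang_copyExpr.2 ⟨n, rfl⟩, key _⟩

end RegexExpr

theorem replicate_append_cons_inj (hab : a ≠ b) {m n : ℕ} {s t : List A}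
    (h : List.replicate m a ++ b :: s = List.replicate n a ++ b :: t) : m = n ∧ s = t := by
  induction m generalizing n with
  | zero =>
    cases n with
    | zero => simpa using h
    | succ n => simp [List.replicate_succ, hab.symm] at h
  | succ m ih =>
    cases n with
    | zero => simp [List.replicate_succ, hab] at h
    | succ n =>
      simp only [List.replicate_succ, List.cons_append, List.cons.injEq, true_and] at h
      simpa using ih h

/-- Words of the language of `copyExpr a b x` end in `a`, so appending `[d, b]` always leads into
the complement, and `d` can be chosen unlike the first letter of `v`. The quotients by `a ^ (i + 1)
* b` are pairwise different, since `a ^ (i + 1)` is the only continuation. -/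
theorem not_closedUnderComplement_drxLanguages [Finite A] [Nonempty X] (hab : a ≠ b) :
    ¬ ClosedUnderComplement (drxLanguages A X) := by
  intro h
  have hba := hab.symm
  obtain ⟨x⟩ := ‹Nonempty X›
  have : Nonempty A := ⟨a⟩
  set L := (Regex.expr _ (RegexExpr.wellFormed_copyExpr a b x)).language with hL
  refine Regex.not_mem_drxLanguages_of_noJump ?_ ?_
    (h L ⟨_, RegexExpr.deterministic_copyExpr hab x, rfl⟩)
  · intro p v hv _
    have : ∃ d, v.head? ≠ some d := by
      by_contra! hc
      exact hab (Option.some.inj ((hc a).symm.trans (hc b)))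
    obtain ⟨d, hd⟩ := this
    refine ⟨[d, b], by simp, ?_, ?_⟩
    · intro hm
      obtain ⟨n, hn⟩ := RegexExpr.mem_language_copyExpr.1 hm
      have := congrArg List.getLast? hn
      simp [List.getLast?_append, List.getLast?_cons, List.getLast?_replicate, hba] at this
    · rintro ⟨t, ht⟩
      rcases v with _ | ⟨c, v⟩
      · simp at hv
      · simp at ht hd
        exact hd ht.1
  · intro hf
    have hfin := finite_range_leftQuotient_compl hf
    obtain ⟨i, -, j, -, hne, hij⟩ := Set.infinite_univ.exists_ne_map_eq_of_mapsTo
      (f := fun i => L.leftQuotient (List.replicate (i + 1) a ++ [b])) (s := (Set.univ : Set ℕ))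
      (fun i _ => Set.mem_range_self _) hfin
    have h₁ : List.replicate (i + 1) a ∈ L.leftQuotient (List.replicate (i + 1) a ++ [b]) :=
      RegexExpr.mem_language_copyExpr.2 ⟨i, by simp⟩
    have h₂ : List.replicate (i + 1) a ∈ L.leftQuotient (List.replicate (j + 1) a ++ [b]) :=
      hij ▸ h₁
    obtain ⟨n, hn⟩ := RegexExpr.mem_language_copyExpr.1 h₂
    rw [List.append_assoc] at hn
    obtain ⟨h₄, h₃⟩ := replicate_append_cons_inj hab hn
    have := congrArg List.length h₃
    simp only [List.append_eq, List.nil_append, List.length_replicate] at this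
    omega

end

theorem mainTheorem8 {A : Type*} [Finite A] (hA : 2 ≤ Nat.card A) {X : Type*} [Infinite X] :
    (¬ ClosedUnderUnion (drxLanguages A X) ∧
      ¬ ClosedUnderConcatenation (drxLanguages A X) ∧
      ¬ ClosedUnderReversal (drxLanguages A X) ∧
      ¬ ClosedUnderComplement (drxLanguages A X) ∧
      ¬ ClosedUnderHomomorphism (drxLanguages A X) ∧
      ¬ ClosedUnderInverseHomomorphism (drxLanguages A X)) ∧
    (¬ ClosedUnderUnion (dtmfaRejLanguages A) ∧
      ¬ ClosedUnderConcatenation (dtmfaRejLanguages A) ∧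
      ¬ ClosedUnderReversal (dtmfaRejLanguages A) ∧
      ¬ ClosedUnderComplement (dtmfaRejLanguages A) ∧
      ¬ ClosedUnderHomomorphism (dtmfaRejLanguages A) ∧
      ¬ ClosedUnderInverseHomomorphism (dtmfaRejLanguages A)) ∧
    (¬ ClosedUnderIntersectionWith (drxLanguages A X) (drxLanguages A X) ∧
      ¬ ClosedUnderIntersectionWith (dregLanguages A X) (drxLanguages A X)) := by
  have : Nontrivial A := Finite.one_lt_card_iff_nontrivial.1 hA
  obtain ⟨a, b, hab⟩ := exists_pair_ne A
  have hi := not_closedUnderIntersectionWith_dregLanguages (X := X) hab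
  exact ⟨⟨not_closedUnderUnion_drxLanguages hab, not_closedUnderConcatenation_drxLanguages hab,
      not_closedUnderReversal_drxLanguages hab, not_closedUnderComplement_drxLanguages hab,
      not_closedUnderHomomorphism_drxLanguages hab,
      not_closedUnderInverseHomomorphism_drxLanguages hab⟩,
    ⟨not_closedUnderUnion_dtmfaRejLanguages hab, not_closedUnderConcatenation_dtmfaRejLanguages hab,
      not_closedUnderReversal_dtmfaRejLanguages hab,
      not_closedUnderComplement_dtmfaRejLanguages hab,
      not_closedUnderHomomorphism_dtmfaRejLanguages hab,
      not_closedUnderInverseHomomorphism_dtmfaRejLanguages hab⟩,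
    fun h => hi fun L hL R hR => h L hL R (dregLanguages_subset_drxLanguages A X hR), hi⟩
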